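/- Let $\mathcal E$ be a topos, i.e. a regular category with power objects and a natural numbers object (NNO). A \emph{family} in $\mathcal E$ is a map $q:\tilde U\to U$; a family is \emph{contained in} another family $q'$ if it is a pullback of $q'$. A family $q$ determines, for each object $X$, the full subcategory of $\mathcal E/X$ on the objects contained in $q$; $q$ is a \emph{simple universe} if for every $X$ this subcategory is closed in $\mathcal E/X$ under binary products and subobjects and contains the terminal object and the NNO. A family $q'$ \emph{has power objects for} $q$ if, for every $X$, each object of $\mathcal E/X$ contained in $q$ has a power object in $\mathcal E/X$ contained in $q'$. For $r\in\mathbb N$, an \emph{$r$-universe} is a simple universe $q:\tilde U\to U$ with subobjects $U_0\hookrightarrow U_1\hookrightarrow\cdots\hookrightarrow U_r\hookrightarrow U$ such that, pulling $q$ back to the $U_i$, each $U_i$ is a simple universe, and $U_{i+1}$ has power objects for $U_i$ for each $i<r$. An \emph{internal $r$-topos} in $\mathcal E$ is an internal category $\mathcal C$ in $\mathcal E$ with internally chosen regular structure (finite limits, image factorisations, pullback-stable covers) and NNO, and with subobjects $\mathcal C_0\hookrightarrow\cdots\hookrightarrow\mathcal C_{r-1}$ of its object of objects, such that each $\mathcal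 C_i$ (as a full internal subcategory) carries chosen regular structure preserved up to isomorphism by the inclusion and contains the NNO, and such that, for $i+1<r$, each object of $\mathcal C_i$ has a chosen power object in $\mathcal C$, lying in $\mathcal C_{i+1}$; equivalently, $\mathcal C$ is a model in $\mathcal E$ of the essentially algebraic theory of such structures. An \emph{internal full sub-$r$-topos} of $\mathcal E$ is such a $\mathcal C$ with a fully faithful $\mathcal E$-indexed functor $I$ from its externalisation $X\mapsto\mathcal E(X,\operatorname{ob}\mathcal C)$ to the self-indexing $X\mapsto\mathcal E/X$ that preserves finite limits, covers, the NNO and the chosen power objects. It \emph{contains} a family $q:A\to B$ if $q\cong I_B(b)$ in $\mathcal E/B$ for some $b:B\to\operatorname{ob}\mathcal C$; it contains it \emph{in lowest rank} if moreover $b$ can be chosen to factor through every $\mathcal C_i$. \textbf{Corollary.} Let $\mathcal E$ be a topos, $r\in\mathbb N$, and $q$ a family in $\mathcal E$. (1) $q$ is contained in some $r$-universe, and moreover in each of its levels $U_0,\dots,U_r$. (2) $q$ is contained, in lowest rank, in some internal full sub-$r$-topos of $\mathcal E$. -/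

import Mathlib

open CategoryTheory CategoryTheory.Limits

universe v u

namespace RankedTopos

/-! ### Covers, power objects, natural numbers objects, toposes -/

section General

variable {C : Type u} [Category.{v} C]

/-- A cover: a map that does not factor through any proper subobject of its target. -/
def IsCover {X Y : C} (e : X ⟶ Y) : Prop :=
  ∀ ⦃Z : C⦄ (g : X ⟶ Z) (m : Z ⟶ Y), Mono m → g ≫ m = e → IsIso m

/-- A pair of maps out of `R` is jointly monic: it presents `R` as a relation, that is, as a
subobject of the product of the two targets. -/
def JointlyMonic {R B A : C} (b : R ⟶ B) (a : R ⟶ A) : Prop :=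
  ∀ ⦃Z : C⦄ (s t : Z ⟶ R), s ≫ b = t ≫ b → s ≫ a = t ≫ a → s = t

/-- The relation `(π, ε) : M ↣ P × A` exhibits `P` as a power object of `A`, with membership
relation `M`: every relation `(b, a) : R ↣ B × A` is the pullback of `(π, ε)` along `χ × A`
for a unique `χ : B ⟶ P`.  (The pullback of `M ↣ P × A` along `χ × A` is the pullback of `π`
along `χ`, with its evident maps to `B` and `A`; in this form no products need to be chosen.) -/
def IsPowerObject {A P M : C} (π : M ⟶ P) (ε : M ⟶ A) : Prop :=
  JointlyMonic π ε ∧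
    ∀ ⦃B R : C⦄ (b : R ⟶ B) (a : R ⟶ A), JointlyMonic b a →
      ∃! χ : B ⟶ P, ∃ t : R ⟶ M, IsPullback t b π χ ∧ t ≫ ε = a

/-- `zero : T ⟶ N` and `succ : N ⟶ N` form a natural numbers object, with `T` terminal. -/
def IsNNO {T N : C} (zero : T ⟶ N) (succ : N ⟶ N) : Prop :=
  Nonempty (IsTerminal T) ∧
    ∀ ⦃A : C⦄ (a : T ⟶ A) (s : A ⟶ A),
      ∃! f : N ⟶ A, zero ≫ f = a ∧ succ ≫ f = f ≫ s

end General

/-- An elementary topos with natural numbers object: a regular category with power objects and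
a natural numbers object. -/
class Topos (E : Type u) [Category.{v} E] : Prop extends Regular E where
  exists_powerObject : ∀ A : E, ∃ (P M : E) (π : M ⟶ P) (ε : M ⟶ A), IsPowerObject π ε
  exists_nno : ∃ (T N : E) (zero : T ⟶ N) (succ : N ⟶ N), IsNNO zero succ

/-! ### Families and universes -/

section Universes

variable {E : Type u} [Category.{v} E]

/-- The family `q` is contained in the family `q'`: it is a pullback of `q'`. -/
def IsContained {A B A' B' : E} (q : A ⟶ B) (q' : A' ⟶ B') : Prop :=
  ∃ (t : A ⟶ A') (b : B ⟶ B'), IsPullback t q q' b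

/-- The fibre over `X` of the full indexed subcategory of (the self-indexing of) `E` determined
by a family `q`: the full subcategory of `Over X` on the objects contained in `q`. -/
def fibreOf {U' U : E} (q : U' ⟶ U) (X : E) : ObjectProperty (Over X) :=
  fun A => IsContained A.hom q

/-- A simple universe: a family whose full indexed subcategory is closed under binary products
and subobjects, and contains the terminal object and the natural numbers object. -/
structure IsSimpleUniverse {U' U : E} (q : U' ⟶ U) : Prop where
  closed_prod : ∀ X : E, (fibreOf q X).IsClosedUnderBinaryProducts
  closed_sub : ∀ X : E, (fibreOf q X).IsClosedUnderSubobjects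
  contains_one : ∀ X : E, ∃ T : Over X, Nonempty (IsTerminal T) ∧ fibreOf q X T
  contains_nno : ∀ X : E, ∃ (T N : Over X) (zero : T ⟶ N) (succ : N ⟶ N),
    IsNNO zero succ ∧ fibreOf q X N

/-- `q'` has power objects for `q`: each object of the slice over `X` contained in `q` has a
power object, in the slice over `X`, which is contained in `q'`. -/
def HasPowerObjectsFor {V' V U' U : E} (q' : V' ⟶ V) (q : U' ⟶ U) : Prop :=
  ∀ (X : E) (A : Over X), fibreOf q X A →
    ∃ (P M : Over X) (π : M ⟶ P) (ε : M ⟶ A), IsPowerObject π ε ∧ fibreOf q' X P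

/-- The restriction of the family `q` to a subobject of its base. -/
noncomputable def restrict [HasPullbacks E] {U' U : E} (q : U' ⟶ U) (S : Subobject U) :
    pullback q S.arrow ⟶ (S : E) :=
  pullback.snd q S.arrow

/-- An `r`-universe: a simple universe `q : total ⟶ base` with a sequence of subobjects
`U₀ ≤ U₁ ≤ ⋯ ≤ U_r` of its base, such that (restricting `q`) each `U_i` is a simple universe
and `U_{i+1}` has power objects for `U_i`. -/
structure RUniverse (E : Type u) [Category.{v} E] [HasPullbacks E] (r : ℕ) where
  total : E
  base : E
  q : total ⟶ base
  simple : IsSimpleUniverse q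
  level : Fin (r + 1) → Subobject base
  level_mono : Monotone level
  level_simple : ∀ i, IsSimpleUniverse (restrict q (level i))
  level_power : ∀ i : Fin r,
    HasPowerObjectsFor (restrict q (level i.succ)) (restrict q (level i.castSucc))

end Universes

/-! ### Internal categories and their externalisations -/

/-- An internal category. -/
structure InternalCategory (E : Type u) [Category.{v} E] [HasPullbacks E] where
  ob : E
  mor : E
  src : mor ⟶ ob
  tgt : mor ⟶ ob
  idn : ob ⟶ mor
  /-- composition, on the object of composable pairs -/
  comp : pullback tgt src ⟶ mor
  idn_src : idn ≫ src = 𝟙 ob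
  idn_tgt : idn ≫ tgt = 𝟙 ob
  comp_src : comp ≫ src = pullback.fst tgt src ≫ src
  comp_tgt : comp ≫ tgt = pullback.snd tgt src ≫ tgt
  id_comp : ∀ {X : E} (f : X ⟶ mor) (h : (f ≫ src ≫ idn) ≫ tgt = f ≫ src),
    pullback.lift (f ≫ src ≫ idn) f h ≫ comp = f
  comp_id : ∀ {X : E} (f : X ⟶ mor) (h : f ≫ tgt = (f ≫ tgt ≫ idn) ≫ src),
    pullback.lift f (f ≫ tgt ≫ idn) h ≫ comp = f
  assoc : ∀ {X : E} (f g k : X ⟶ mor) (h₁ : f ≫ tgt = g ≫ src) (h₂ : g ≫ tgt = k ≫ src)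
    (h₃ : (pullback.lift f g h₁ ≫ comp) ≫ tgt = k ≫ src)
    (h₄ : f ≫ tgt = (pullback.lift g k h₂ ≫ comp) ≫ src),
    pullback.lift (pullback.lift f g h₁ ≫ comp) k h₃ ≫ comp =
      pullback.lift f (pullback.lift g k h₂ ≫ comp) h₄ ≫ comp

namespace InternalCategory

variable {E : Type u} [Category.{v} E] [HasPullbacks E] (𝒞 : InternalCategory E)

/-- The objects of the fibre over `X` of the externalisation: maps `X ⟶ ob`. -/
@[ext]
structure Fib (X : E) where
  name : X ⟶ 𝒞.ob

/-- The fibre over `X` of the externalisation: its arrows are the maps `X ⟶ mor` with the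
appropriate source and target. -/
noncomputable instance (X : E) : Category.{v} (𝒞.Fib X) where
  Hom A B := { f : X ⟶ 𝒞.mor // f ≫ 𝒞.src = A.name ∧ f ≫ 𝒞.tgt = B.name }
  id A := ⟨A.name ≫ 𝒞.idn, by simp [𝒞.idn_src], by simp [𝒞.idn_tgt]⟩
  comp f g := ⟨pullback.lift f.1 g.1 (by rw [f.2.2, g.2.1]) ≫ 𝒞.comp,
    by rw [Category.assoc, 𝒞.comp_src, pullback.lift_fst_assoc, f.2.1],
    by rw [Category.assoc, 𝒞.comp_tgt, pullback.lift_snd_assoc, g.2.2]⟩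
  id_comp := by
    rintro A B ⟨f, hA, hB⟩
    apply Subtype.ext
    refine Eq.trans ?_ (𝒞.id_comp f (by simp [𝒞.idn_tgt]))
    change pullback.lift _ _ _ ≫ 𝒞.comp = _
    congr 1
    apply pullback.hom_ext
    · rw [pullback.lift_fst, pullback.lift_fst]
      exact (congrArg (· ≫ 𝒞.idn) hA.symm).trans (Category.assoc _ _ _)
    · rw [pullback.lift_snd, pullback.lift_snd]
  comp_id := by
    rintro A B ⟨f, hA, hB⟩
    apply Subtype.ext
    refine Eq.trans ?_ (𝒞.comp_id f (by simp [𝒞.idn_src]))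
    change pullback.lift _ _ _ ≫ 𝒞.comp = _
    congr 1
    apply pullback.hom_ext
    · rw [pullback.lift_fst, pullback.lift_fst]
    · rw [pullback.lift_snd, pullback.lift_snd]
      exact (congrArg (· ≫ 𝒞.idn) hB.symm).trans (Category.assoc _ _ _)
  assoc := by
    rintro A B D F ⟨f, hf⟩ ⟨g, hg⟩ ⟨k, hk⟩
    apply Subtype.ext
    exact 𝒞.assoc f g k _ _ _ _

/-- Reindexing in the externalisation, by precomposition. -/
noncomputable def reindex {X Y : E} (h : Y ⟶ X) : 𝒞.Fib X ⥤ 𝒞.Fib Y where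
  obj A := ⟨h ≫ A.name⟩
  map f := ⟨h ≫ f.1, by rw [Category.assoc, f.2.1], by rw [Category.assoc, f.2.2]⟩
  map_id A := Subtype.ext (Category.assoc _ _ _).symm
  map_comp f g := by
    apply Subtype.ext
    change h ≫ pullback.lift _ _ _ ≫ 𝒞.comp = pullback.lift _ _ _ ≫ 𝒞.comp
    rw [← Category.assoc]
    congr 1
    apply pullback.hom_ext
    · rw [Category.assoc, pullback.lift_fst, pullback.lift_fst]
    · rw [Category.assoc, pullback.lift_snd, pullback.lift_snd]

lemma reindex_id_obj {X : E} (A : 𝒞.Fib X) : (𝒞.reindex (𝟙 X)).obj A = A :=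
  Fib.ext (Category.id_comp _)

lemma reindex_comp_obj {X Y Z : E} (k : Z ⟶ Y) (h : Y ⟶ X) (A : 𝒞.Fib X) :
    (𝒞.reindex (k ≫ h)).obj A = (𝒞.reindex k).obj ((𝒞.reindex h).obj A) :=
  Fib.ext (Category.assoc _ _ _)

variable {𝒞}

/-- An object of a fibre belongs to the subobject `S` of the object of objects. -/
def Mem (S : Subobject 𝒞.ob) {X : E} (A : 𝒞.Fib X) : Prop := S.Factors A.name

lemma mem_top {X : E} (A : 𝒞.Fib X) : Mem (⊤ : Subobject 𝒞.ob) A :=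
  Subobject.top_factors A.name

lemma Mem.reindex {S : Subobject 𝒞.ob} {X Y : E} {A : 𝒞.Fib X} (hA : Mem S A) (h : Y ⟶ X) :
    Mem S ((𝒞.reindex h).obj A) :=
  Subobject.factors_of_factors_right h hA

variable (𝒞)

/-- Chosen finite limits and image factorisations on the full internal subcategory of `𝒞` on the
objects in `S`, such that its inclusion into `𝒞` preserves finite limits, covers and monos.

Here and below, an operation of the internal structure is given (by the Yoneda lemma) as an
operation on the fibres of the externalisation which is strictly preserved by reindexing.  For
operations producing arrows this is stated on the underlying maps to `mor`, and so includes the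
preservation of the sources and targets of these arrows. -/
structure RegularOn (S : Subobject 𝒞.ob) where
  /-- the chosen terminal object -/
  one : ∀ X : E, 𝒞.Fib X
  one_mem : ∀ X, Mem S (one X)
  one_isTerminal : ∀ X, Nonempty (IsTerminal (one X))
  one_reindex : ∀ {X Y : E} (h : Y ⟶ X), (𝒞.reindex h).obj (one X) = one Y
  /-- chosen pullbacks -/
  pb : ∀ {X : E} {A B D : 𝒞.Fib X}, Mem S A → Mem S B → Mem S D →
    (A ⟶ D) → (B ⟶ D) → 𝒞.Fib X
  pb_mem : ∀ {X : E} {A B D : 𝒞.Fib X} (hA : Mem S A) (hB : Mem S B) (hD : Mem S D)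
    (f : A ⟶ D) (g : B ⟶ D), Mem S (pb hA hB hD f g)
  pbFst : ∀ {X : E} {A B D : 𝒞.Fib X} (hA : Mem S A) (hB : Mem S B) (hD : Mem S D)
    (f : A ⟶ D) (g : B ⟶ D), pb hA hB hD f g ⟶ A
  pbSnd : ∀ {X : E} {A B D : 𝒞.Fib X} (hA : Mem S A) (hB : Mem S B) (hD : Mem S D)
    (f : A ⟶ D) (g : B ⟶ D), pb hA hB hD f g ⟶ B
  pb_isPullback : ∀ {X : E} {A B D : 𝒞.Fib X} (hA : Mem S A) (hB : Mem S B) (hD : Mem S D)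
    (f : A ⟶ D) (g : B ⟶ D), IsPullback (pbFst hA hB hD f g) (pbSnd hA hB hD f g) f g
  pbFst_reindex : ∀ {X Y : E} (h : Y ⟶ X) {A B D : 𝒞.Fib X}
    (hA : Mem S A) (hB : Mem S B) (hD : Mem S D) (f : A ⟶ D) (g : B ⟶ D),
    ((𝒞.reindex h).map (pbFst hA hB hD f g)).1 =
      (pbFst (hA.reindex h) (hB.reindex h) (hD.reindex h)
        ((𝒞.reindex h).map f) ((𝒞.reindex h).map g)).1
  pbSnd_reindex : ∀ {X Y : E} (h : Y ⟶ X) {A B D : 𝒞.Fib X}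
    (hA : Mem S A) (hB : Mem S B) (hD : Mem S D) (f : A ⟶ D) (g : B ⟶ D),
    ((𝒞.reindex h).map (pbSnd hA hB hD f g)).1 =
      (pbSnd (hA.reindex h) (hB.reindex h) (hD.reindex h)
        ((𝒞.reindex h).map f) ((𝒞.reindex h).map g)).1
  /-- chosen image factorisations -/
  im : ∀ {X : E} {A B : 𝒞.Fib X}, Mem S A → Mem S B → (A ⟶ B) → 𝒞.Fib X
  im_mem : ∀ {X : E} {A B : 𝒞.Fib X} (hA : Mem S A) (hB : Mem S B) (f : A ⟶ B),
    Mem S (im hA hB f)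
  imCover : ∀ {X : E} {A B : 𝒞.Fib X} (hA : Mem S A) (hB : Mem S B) (f : A ⟶ B),
    A ⟶ im hA hB f
  imMono : ∀ {X : E} {A B : 𝒞.Fib X} (hA : Mem S A) (hB : Mem S B) (f : A ⟶ B),
    im hA hB f ⟶ B
  im_fac : ∀ {X : E} {A B : 𝒞.Fib X} (hA : Mem S A) (hB : Mem S B) (f : A ⟶ B),
    imCover hA hB f ≫ imMono hA hB f = f
  imCover_isCover : ∀ {X : E} {A B : 𝒞.Fib X} (hA : Mem S A) (hB : Mem S B) (f : A ⟶ B),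
    IsCover (imCover hA hB f)
  imMono_mono : ∀ {X : E} {A B : 𝒞.Fib X} (hA : Mem S A) (hB : Mem S B) (f : A ⟶ B),
    Mono (imMono hA hB f)
  imCover_reindex : ∀ {X Y : E} (h : Y ⟶ X) {A B : 𝒞.Fib X} (hA : Mem S A) (hB : Mem S B)
    (f : A ⟶ B), ((𝒞.reindex h).map (imCover hA hB f)).1 =
      (imCover (hA.reindex h) (hB.reindex h) ((𝒞.reindex h).map f)).1
  imMono_reindex : ∀ {X Y : E} (h : Y ⟶ X) {A B : 𝒞.Fib X} (hA : Mem S A) (hB : Mem S B)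
    (f : A ⟶ B), ((𝒞.reindex h).map (imMono hA hB f)).1 =
      (imMono (hA.reindex h) (hB.reindex h) ((𝒞.reindex h).map f)).1

end InternalCategory

open InternalCategory

/-! ### Internal `r`-toposes and internal full sub-`r`-toposes -/

/-- An internal `r`-topos: an internal regular category with natural numbers object, with
subobjects `rank 0 ≤ rank 1 ≤ ⋯` (indexed by `i < r`) of its object of objects, such that each
`rank i` is a regular subcategory containing the natural numbers object, and (for `i + 1 < r`)
each object of rank `≤ i` has a power object of rank `≤ i + 1`. -/
structure InternalRTopos (E : Type u) [Category.{v} E] [HasPullbacks E] (r : ℕ)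
    extends InternalCategory E where
  rank : Fin r → Subobject ob
  rank_mono : Monotone rank
  /-- the regular structure of the whole category -/
  reg : toInternalCategory.RegularOn ⊤
  cover_stable : ∀ {X : E} {A B D Q : toInternalCategory.Fib X} {p : Q ⟶ A} {e' : Q ⟶ B}
    {e : A ⟶ D} {g : B ⟶ D}, IsPullback p e' e g → IsCover e → IsCover e'
  /-- the regular structure of each rank -/
  regRank : ∀ i, toInternalCategory.RegularOn (rank i)
  /-- the natural numbers object -/
  nat : ∀ X : E, toInternalCategory.Fib X
  zero : ∀ X, reg.one X ⟶ nat X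
  succ : ∀ X, nat X ⟶ nat X
  nat_isNNO : ∀ X, IsNNO (zero X) (succ X)
  nat_mem : ∀ X i, Mem (rank i) (nat X)
  zero_reindex : ∀ {X Y : E} (h : Y ⟶ X),
    ((toInternalCategory.reindex h).map (zero X)).1 = (zero Y).1
  succ_reindex : ∀ {X Y : E} (h : Y ⟶ X),
    ((toInternalCategory.reindex h).map (succ X)).1 = (succ Y).1
  /-- power objects, for objects of rank `≤ i` -/
  pow : ∀ (i : ℕ) (hi : i + 1 < r) {X : E} {A : toInternalCategory.Fib X},
    Mem (rank ⟨i, by omega⟩) A → toInternalCategory.Fib X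
  pow_mem : ∀ (i : ℕ) (hi : i + 1 < r) {X : E} {A : toInternalCategory.Fib X}
    (hA : Mem (rank ⟨i, by omega⟩) A), Mem (rank ⟨i + 1, hi⟩) (pow i hi hA)
  /-- the membership relation, as an object with maps to the power object and to `A` -/
  elt : ∀ (i : ℕ) (hi : i + 1 < r) {X : E} {A : toInternalCategory.Fib X},
    Mem (rank ⟨i, by omega⟩) A → toInternalCategory.Fib X
  eltPow : ∀ (i : ℕ) (hi : i + 1 < r) {X : E} {A : toInternalCategory.Fib X}
    (hA : Mem (rank ⟨i, by omega⟩) A), elt i hi hA ⟶ pow i hi hA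
  eltArg : ∀ (i : ℕ) (hi : i + 1 < r) {X : E} {A : toInternalCategory.Fib X}
    (hA : Mem (rank ⟨i, by omega⟩) A), elt i hi hA ⟶ A
  pow_isPowerObject : ∀ (i : ℕ) (hi : i + 1 < r) {X : E} {A : toInternalCategory.Fib X}
    (hA : Mem (rank ⟨i, by omega⟩) A), IsPowerObject (eltPow i hi hA) (eltArg i hi hA)
  eltPow_reindex : ∀ (i : ℕ) (hi : i + 1 < r) {X Y : E} (h : Y ⟶ X)
    {A : toInternalCategory.Fib X} (hA : Mem (rank ⟨i, by omega⟩) A),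
    ((toInternalCategory.reindex h).map (eltPow i hi hA)).1 =
      (eltPow i hi (hA.reindex h)).1
  eltArg_reindex : ∀ (i : ℕ) (hi : i + 1 < r) {X Y : E} (h : Y ⟶ X)
    {A : toInternalCategory.Fib X} (hA : Mem (rank ⟨i, by omega⟩) A),
    ((toInternalCategory.reindex h).map (eltArg i hi hA)).1 =
      (eltArg i hi (hA.reindex h)).1

/-- An indexed functor from the externalisation of `𝒞` to the self-indexing of `E`.  As
reindexing in the self-indexing is pullback, the (coherent) compatibility with reindexing is
given as a coherent choice of pullback squares, that is, in fibred terms. -/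
structure IndexedFunctorToSelf {E : Type u} [Category.{v} E] [HasPullbacks E]
    (𝒞 : InternalCategory E) where
  fib : ∀ X : E, 𝒞.Fib X ⥤ Over X
  cart : ∀ {X Y : E} (h : Y ⟶ X) (A : 𝒞.Fib X),
    ((fib Y).obj ((𝒞.reindex h).obj A)).left ⟶ ((fib X).obj A).left
  cart_isPullback : ∀ {X Y : E} (h : Y ⟶ X) (A : 𝒞.Fib X),
    IsPullback (cart h A) ((fib Y).obj ((𝒞.reindex h).obj A)).hom ((fib X).obj A).hom h
  cart_naturality : ∀ {X Y : E} (h : Y ⟶ X) {A B : 𝒞.Fib X} (f : A ⟶ B),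
    ((fib Y).map ((𝒞.reindex h).map f)).left ≫ cart h B = cart h A ≫ ((fib X).map f).left
  cart_id : ∀ {X : E} (A : 𝒞.Fib X),
    cart (𝟙 X) A = ((fib X).map (eqToHom (𝒞.reindex_id_obj A))).left
  cart_comp : ∀ {X Y Z : E} (k : Z ⟶ Y) (h : Y ⟶ X) (A : 𝒞.Fib X),
    cart (k ≫ h) A = ((fib Z).map (eqToHom (𝒞.reindex_comp_obj k h A))).left ≫
      cart k ((𝒞.reindex h).obj A) ≫ cart h A

/-- An internal full sub-`r`-topos of `E`: an internal `r`-topos together with a fully faithful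
`r`-logical indexed functor from its externalisation to the self-indexing of `E`, with its full
ranking. -/
structure FullSubRTopos (E : Type u) [Category.{v} E] [HasPullbacks E] (r : ℕ)
    extends InternalRTopos E r where
  incl : IndexedFunctorToSelf toInternalCategory
  full : ∀ X, (incl.fib X).Full
  faithful : ∀ X, (incl.fib X).Faithful
  preservesFiniteLimits : ∀ X, PreservesFiniteLimits (incl.fib X)
  preserves_cover : ∀ {X : E} {A B : toInternalCategory.Fib X} (e : A ⟶ B),
    IsCover e → IsCover ((incl.fib X).map e)
  preserves_nno : ∀ X, IsNNO ((incl.fib X).map (zero X)) ((incl.fib X).map (succ X))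
  preserves_pow : ∀ (i : ℕ) (hi : i + 1 < r) {X : E} {A : toInternalCategory.Fib X}
    (hA : Mem (rank ⟨i, by omega⟩) A),
    IsPowerObject ((incl.fib X).map (eltPow i hi hA)) ((incl.fib X).map (eltArg i hi hA))

/-- The family `q : A ⟶ B` is contained in the sub-`r`-topos `𝒯`: as an object of `Over B` it is
isomorphic to the image of an object of `𝒯` over `B`, of lowest rank (thus of every rank). -/
def FullSubRTopos.Contains {E : Type u} [Category.{v} E] [HasPullbacks E] {r : ℕ}
    (𝒯 : FullSubRTopos E r) {A B : E} (q : A ⟶ B) : Prop :=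
  ∃ b : 𝒯.toInternalCategory.Fib B, (∀ i, Mem (𝒯.rank i) b) ∧
    Nonempty ((𝒯.incl.fib B).obj b ≅ Over.mk q)

end RankedTopos

namespace RankedTopos
open InternalCategory

attribute [local simp] prod.lift_fst prod.lift_snd prod.lift_fst_assoc prod.lift_snd_assoc
  prod.comp_lift pullback.lift_fst pullback.lift_snd pullback.lift_fst_assoc
  pullback.lift_snd_assoc

/-! ### Relations as jointly monic pairs. -/

section Basics

variable {E : Type u} [Category.{v} E]

/-! For a fixed object K, the membership relation `elemPow K : Elem K ⟶ Pow K` is the universe of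
subobjects of K. A family q : Y ⟶ X is a pullback of it exactly when Y embeds fibrewise in K, that
is, when some k : Y ⟶ K makes (q, k) jointly monic (`Codes`, `codes_elemPow`). Any q : A ⟶ B
qualifies as soon as A itself embeds in K.

Closure properties of this universe come from embeddings into K. Subobjects are free; products
follow from a mono K × K ⟶ K, and the natural numbers object (with it the terminal object) from a
mono N ⟶ K. Every Q embeds in such a K, namely P(PN × PQ), because PN + PN embeds in PN
(`exists_squareClosed`). If Y embeds fibrewise in L over X, then its power object in the slice
embeds fibrewise in PL (`exists_powerObject_over`). So choose square-closed L₀, L₁, … with A inside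
L₀ and P(Lₙ) inside Lₙ₊₁. The universe of subobjects of L_r, with Uᵢ the part consisting of the
subobjects of Lᵢ, is the required r-universe.

For the second claim, the same universe is made into an internal category: objects are named by Pow
L_r, arrows by functional relations. Its externalisation is fully faithful in the slices by
description of maps through their graphs. Each structure is an explicit subobject of L_r: pullbacks
are sets of coded pairs, images are actual subobjects, and power objects are sets of codes of
subsets of Lᵢ. A name is determined by its generalised elements (`pow_ext`), and these structures
are specified by predicates on generalised elements, so they are strictly preserved by reindexing.
Universal properties are verified in the slices and reflected along the inclusion.

All constructions use generalised elements. A predicate is admissible if it is represented by a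
subobject (`Rep`); such predicates include membership and equality and are closed under conjunction,
universally quantified implication and unique existence. General existence is needed only for
images, where it means existence after passing to a cover. -/

theorem jointlyMonic_of_mono_right {R X K : E} (b : R ⟶ X) (a : R ⟶ K) [Mono a] :
    JointlyMonic b a := fun _ _ _ _ h => (cancel_mono a).1 h

theorem jointlyMonic_of_mono_left {R X K : E} (b : R ⟶ X) (a : R ⟶ K) [Mono b] :
    JointlyMonic b a := fun _ _ _ h _ => (cancel_mono b).1 h

/-! ### Representable predicates -/

theorem JointlyMonic.comp_mono {R X K L : E} {b : R ⟶ X} {a : R ⟶ K} (h : JointlyMonic b a)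
    (m : K ⟶ L) [Mono m] : JointlyMonic b (a ≫ m) := fun _ s t h1 h2 =>
  h s t h1 ((cancel_mono m).1 (by simpa using h2))

/-- Joint monicity is the uniqueness half of the universal property, so only existence of lifts
remains to be checked. -/
theorem JointlyMonic.isPullback {R B A D : E} {t : R ⟶ A} {b : R ⟶ B} {f : A ⟶ D} {g : B ⟶ D}
    (h : JointlyMonic t b) (w : t ≫ f = b ≫ g)
    (l : ∀ (Z : E) (x : Z ⟶ A) (y : Z ⟶ B), x ≫ f = y ≫ g → ∃ r : Z ⟶ R, r ≫ t = x ∧ r ≫ b = y) :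
    IsPullback t b f g := by
  choose r h1 h2 using l
  exact ⟨⟨w⟩, ⟨PullbackCone.IsLimit.mk _ (fun s => r _ s.fst s.snd s.condition)
    (fun s => h1 _ _ _ _) (fun s => h2 _ _ _ _) (fun s m e1 e2 => h _ _
      (e1.trans (h1 _ _ _ _).symm) (e2.trans (h2 _ _ _ _).symm))⟩⟩

theorem jointlyMonic_of_isPullback {R B A D : E} {t : R ⟶ A} {b : R ⟶ B} {f : A ⟶ D} {g : B ⟶ D}
    (h : IsPullback t b f g) : JointlyMonic t b := fun _ _ _ h1 h2 => h.hom_ext h1 h2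

/-- A predicate on the generalised elements of `X` is representable if it defines a
subobject of `X`. -/
def Rep {X : E} (φ : ∀ Z : E, (Z ⟶ X) → Prop) : Prop :=
  ∃ (S : E) (m : S ⟶ X), Mono m ∧ ∀ (Z : E) (z : Z ⟶ X), φ Z z ↔ ∃ t : Z ⟶ S, t ≫ m = z

theorem Rep.congr {X : E} {φ ψ : ∀ Z : E, (Z ⟶ X) → Prop} (h : Rep φ)
    (e : ∀ Z z, ψ Z z ↔ φ Z z) : Rep ψ := by
  obtain ⟨S, m, hm, hφ⟩ := h
  exact ⟨S, m, hm, fun Z z => (e Z z).trans (hφ Z z)⟩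

theorem Rep.stable {X : E} {φ : ∀ Z : E, (Z ⟶ X) → Prop} (h : Rep φ) {Z' Z : E} (w : Z' ⟶ Z)
    {z : Z ⟶ X} (hz : φ Z z) : φ Z' (w ≫ z) := by
  obtain ⟨S, m, hm, hφ⟩ := h
  obtain ⟨t, rfl⟩ := (hφ _ _).1 hz
  exact (hφ _ _).2 ⟨w ≫ t, by simp⟩

theorem rep_range {S X : E} (m : S ⟶ X) [hm : Mono m] :
    Rep (fun Z (z : Z ⟶ X) => ∃ t : Z ⟶ S, t ≫ m = z) :=
  ⟨S, m, hm, fun _ _ => Iff.rfl⟩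

theorem rep_true (X : E) : Rep (fun Z (_ : Z ⟶ X) => True) :=
  ⟨X, 𝟙 X, inferInstance, fun _ z => ⟨fun _ => ⟨z, by simp⟩, fun _ => trivial⟩⟩

end Basics

/-! ### Generalised elements of power objects -/

section Calculus

variable {E : Type u} [Category.{v} E] [Topos E]

theorem exists_chosenPower (K : E) :
    ∃ (D : Σ (P M : E), (M ⟶ P) × (M ⟶ K)), IsPowerObject D.2.2.1 D.2.2.2 := by
  obtain ⟨P, M, π, ε, h⟩ := Topos.exists_powerObject K
  exact ⟨⟨P, M, π, ε⟩, h⟩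

/-- The chosen power object of `K`. -/
noncomputable def Pow (K : E) : E := (exists_chosenPower K).choose.1

/-- The membership relation of the chosen power object of `K`. -/
noncomputable def Elem (K : E) : E := (exists_chosenPower K).choose.2.1

noncomputable def elemPow (K : E) : Elem K ⟶ Pow K := (exists_chosenPower K).choose.2.2.1

noncomputable def elemArg (K : E) : Elem K ⟶ K := (exists_chosenPower K).choose.2.2.2

theorem isPowerObject_pow (K : E) : IsPowerObject (elemPow K) (elemArg K) :=
  (exists_chosenPower K).choose_spec

theorem jointlyMonic_elem (K : E) : JointlyMonic (elemPow K) (elemArg K) :=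
  (isPowerObject_pow K).1

/-- The generalised element `k` of `K` belongs to the generalised subobject `A` of `K`. -/
def IsElem {Z K : E} (k : Z ⟶ K) (A : Z ⟶ Pow K) : Prop :=
  ∃ m : Z ⟶ Elem K, m ≫ elemPow K = A ∧ m ≫ elemArg K = k

theorem IsElem.comp {Z' Z K : E} {k : Z ⟶ K} {A : Z ⟶ Pow K} (h : IsElem k A) (w : Z' ⟶ Z) :
    IsElem (w ≫ k) (w ≫ A) := by
  obtain ⟨m, rfl, rfl⟩ := h
  exact ⟨w ≫ m, by simp, by simp⟩

/-- Both maps classify the same relation. The pullback of membership along A is, by the hypothesis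
applied to its generic element, also a pullback along B; uniqueness of classifying maps concludes.
-/
theorem pow_ext {X K : E} {A B : X ⟶ Pow K}
    (h : ∀ (Z : E) (z : Z ⟶ X) (k : Z ⟶ K), IsElem k (z ≫ A) ↔ IsElem k (z ≫ B)) : A = B := by
  obtain ⟨hj, hu⟩ := isPowerObject_pow K
  have hR : JointlyMonic (pullback.snd (elemPow K) A) (pullback.fst (elemPow K) A ≫ elemArg K) := by
    intro Z s t h1 h2
    apply pullback.hom_ext _ h1
    apply hj
    · simp only [Category.assoc, pullback.condition]
      rw [reassoc_of% h1]
    · simpa using h2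
  obtain ⟨t', ht1, ht2⟩ := (h _ (pullback.snd (elemPow K) A)
    (pullback.fst (elemPow K) A ≫ elemArg K)).1 ⟨pullback.fst _ _, pullback.condition, rfl⟩
  obtain ⟨χ, -, hχ⟩ := hu _ _ hR
  rw [hχ A ⟨_, IsPullback.of_hasPullback _ _, rfl⟩]
  have hB (s : PullbackCone (elemPow K) B) : IsElem (s.fst ≫ elemArg K) (s.snd ≫ A) :=
    (h _ s.snd (s.fst ≫ elemArg K)).2 ⟨s.fst, s.condition, rfl⟩
  refine (hχ B ⟨t', ⟨⟨ht1⟩, ⟨PullbackCone.IsLimit.mk _ (fun s => ?_) ?_ ?_ ?_⟩⟩, ht2⟩).symm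
  · exact pullback.lift (hB s).choose s.snd (hB s).choose_spec.1
  · intro s
    apply hj
    · rw [Category.assoc, ht1, pullback.lift_snd_assoc, s.condition]
    · rw [Category.assoc, ht2, pullback.lift_fst_assoc]
      exact (hB s).choose_spec.2
  · intro s
    rw [pullback.lift_snd]
  · intro s m h1 h2
    apply hR
    · rw [pullback.lift_snd, h2]
    · rw [← ht2, reassoc_of% h1, ht2, pullback.lift_fst_assoc]
      exact (hB s).choose_spec.2.symm

theorem exists_name {R X K : E} (b : R ⟶ X) (a : R ⟶ K) (h : JointlyMonic b a) :
    ∃ χ : X ⟶ Pow K, ∀ (Z : E) (z : Z ⟶ X) (k : Z ⟶ K),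
      IsElem k (z ≫ χ) ↔ ∃ r : Z ⟶ R, r ≫ b = z ∧ r ≫ a = k := by
  obtain ⟨χ, ⟨t, ht, hta⟩, -⟩ := (isPowerObject_pow K).2 b a h
  refine ⟨χ, fun Z z k => ⟨?_, ?_⟩⟩
  · rintro ⟨m, h1, rfl⟩
    exact ⟨ht.lift m z h1, ht.lift_snd _ _ _, by rw [← hta, ht.lift_fst_assoc]⟩
  · rintro ⟨r, rfl, rfl⟩
    exact ⟨r ≫ t, by simp [ht.w], by simp [hta]⟩

/-- The map naming a relation. -/
noncomputable def nameOf {R X K : E} (b : R ⟶ X) (a : R ⟶ K) (h : JointlyMonic b a) : X ⟶ Pow K :=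
  (exists_name b a h).choose

theorem isElem_nameOf {R X K : E} {b : R ⟶ X} {a : R ⟶ K} (h : JointlyMonic b a) {Z : E}
    (z : Z ⟶ X) (k : Z ⟶ K) :
    IsElem k (z ≫ nameOf b a h) ↔ ∃ r : Z ⟶ R, r ≫ b = z ∧ r ≫ a = k :=
  (exists_name b a h).choose_spec Z z k

/-- The singleton map. -/
noncomputable def singleton (K : E) : K ⟶ Pow K :=
  nameOf (𝟙 K) (𝟙 K) (jointlyMonic_of_mono_left _ _)

theorem isElem_singleton {Z K : E} (k l : Z ⟶ K) : IsElem k (l ≫ singleton K) ↔ k = l := by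
  rw [singleton, isElem_nameOf]
  constructor
  · rintro ⟨r, rfl, rfl⟩; rfl
  · rintro rfl; exact ⟨k, by simp, by simp⟩

instance mono_singleton (K : E) : Mono (singleton K) where
  right_cancellation f g h := by
    rw [← isElem_singleton, ← h, isElem_singleton]

theorem Rep.comp {X Y : E} {φ : ∀ Z : E, (Z ⟶ Y) → Prop} (h : Rep φ) (f : X ⟶ Y) :
    Rep (fun Z (z : Z ⟶ X) => φ Z (z ≫ f)) := by
  obtain ⟨S, m, hm, hφ⟩ := h
  refine ⟨pullback m f, pullback.snd m f, inferInstance, fun Z z => (hφ _ _).trans ⟨?_, ?_⟩⟩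
  · rintro ⟨t, ht⟩
    exact ⟨pullback.lift t z ht, by simp⟩
  · rintro ⟨t, rfl⟩
    exact ⟨t ≫ pullback.fst m f, by simp [pullback.condition]⟩

theorem Rep.and {X : E} {φ ψ : ∀ Z : E, (Z ⟶ X) → Prop} (hφ : Rep φ) (hψ : Rep ψ) :
    Rep (fun Z (z : Z ⟶ X) => φ Z z ∧ ψ Z z) := by
  obtain ⟨S, m, hm, hφ⟩ := hφ
  obtain ⟨T, n, hn, hψ⟩ := hψ.comp m
  refine ⟨T, n ≫ m, mono_comp _ _, fun Z z => ⟨?_, ?_⟩⟩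
  · rintro ⟨h1, h2⟩
    obtain ⟨t, rfl⟩ := (hφ _ _).1 h1
    obtain ⟨t, rfl⟩ := (hψ _ _).1 h2
    exact ⟨t, by simp⟩
  · rintro ⟨t, rfl⟩
    refine ⟨(hφ _ _).2 ⟨t ≫ n, by simp⟩, ?_⟩
    rw [← Category.assoc]
    exact (hψ _ _).2 ⟨t, rfl⟩

theorem rep_eq {X Y : E} (f g : X ⟶ Y) : Rep (fun Z (z : Z ⟶ X) => z ≫ f = z ≫ g) := by
  refine ⟨equalizer f g, equalizer.ι f g, inferInstance, fun Z z => ⟨?_, ?_⟩⟩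
  · intro h
    exact ⟨equalizer.lift z h, by simp⟩
  · rintro ⟨t, rfl⟩
    rw [Category.assoc, Category.assoc, equalizer.condition]

theorem rep_isElem {X K : E} (k : X ⟶ K) (A : X ⟶ Pow K) :
    Rep (fun Z (z : Z ⟶ X) => IsElem (z ≫ k) (z ≫ A)) := by
  have hm : Mono (prod.lift (elemPow K) (elemArg K)) := ⟨fun s t h => (isPowerObject_pow K).1 s t
    (by simpa using congrArg (· ≫ prod.fst) h) (by simpa using congrArg (· ≫ prod.snd) h)⟩
  refine ((rep_range (prod.lift (elemPow K) (elemArg K))).comp (prod.lift A k)).congr ?_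
  intro Z z
  constructor
  · rintro ⟨m, h1, h2⟩
    exact ⟨m, by ext <;> simp [h1, h2]⟩
  · rintro ⟨m, h⟩
    exact ⟨m, by simpa using congrArg (· ≫ prod.fst) h, by simpa using congrArg (· ≫ prod.snd) h⟩

/-- The generalised subset {k | Φ(z, k)}: a subobject of X × K is a relation, so it has a name. -/
theorem exists_comprehension {X K : E} {Φ : ∀ Z : E, (Z ⟶ X) → (Z ⟶ K) → Prop}
    (h : Rep (fun Z (z : Z ⟶ X ⨯ K) => Φ Z (z ≫ prod.fst) (z ≫ prod.snd))) :
    ∃ χ : X ⟶ Pow K, ∀ (Z : E) (z : Z ⟶ X) (k : Z ⟶ K), IsElem k (z ≫ χ) ↔ Φ Z z k := by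
  obtain ⟨S, m, hm, hΦ⟩ := h
  have hj : JointlyMonic (m ≫ prod.fst) (m ≫ prod.snd) := by
    intro Z s t h1 h2
    rw [← cancel_mono m]
    ext <;> simpa
  refine ⟨nameOf _ _ hj, fun Z z k => ?_⟩
  rw [isElem_nameOf]
  have := hΦ Z (prod.lift z k)
  simp only [prod.lift_fst, prod.lift_snd] at this
  rw [this]
  constructor
  · rintro ⟨r, rfl, rfl⟩
    exact ⟨r, by ext <;> simp⟩
  · rintro ⟨r, hr⟩
    exact ⟨r, by rw [reassoc_of% hr, prod.lift_fst], by rw [reassoc_of% hr, prod.lift_snd]⟩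

/-- "Φ implies Ψ for all k" means that {k | Φ} and {k | Φ ∧ Ψ} coincide, so the subobject is an
equaliser of two maps to `Pow K`. Quantifying over later stages is what makes this the internal
implication. -/
theorem rep_forall_imp {X K : E} {Φ Ψ : ∀ Z : E, (Z ⟶ X) → (Z ⟶ K) → Prop}
    (hΦ : Rep (fun Z (z : Z ⟶ X ⨯ K) => Φ Z (z ≫ prod.fst) (z ≫ prod.snd)))
    (hΨ : Rep (fun Z (z : Z ⟶ X ⨯ K) => Ψ Z (z ≫ prod.fst) (z ≫ prod.snd))) :
    Rep (fun Z (z : Z ⟶ X) => ∀ (Z' : E) (w : Z' ⟶ Z) (k : Z' ⟶ K),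
      Φ Z' (w ≫ z) k → Ψ Z' (w ≫ z) k) := by
  obtain ⟨χ, h1⟩ := exists_comprehension hΦ
  obtain ⟨χ', h2⟩ := exists_comprehension (Φ := fun Z z k => Φ Z z k ∧ Ψ Z z k) (hΦ.and hΨ)
  refine (rep_eq χ χ').congr fun Z z => ⟨fun h => pow_ext fun Z' w k => ?_, fun h Z' w k hk => ?_⟩
  · rw [← Category.assoc, ← Category.assoc, h1, h2]
    exact ⟨fun hk => ⟨hk, h _ _ _ hk⟩, And.left⟩
  · rw [← h1, Category.assoc, h, ← Category.assoc, h2] at hk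
    exact hk.2

/-- Unique existence of a generalised element, at the present stage and at all later ones. -/
def ExistsUniqueAt {X K : E} (Φ : ∀ Z : E, (Z ⟶ X) → (Z ⟶ K) → Prop) {Z : E} (z : Z ⟶ X) : Prop :=
  ∃ k : Z ⟶ K, Φ Z z k ∧ ∀ (Z' : E) (w : Z' ⟶ Z) (k' : Z' ⟶ K), Φ Z' (w ≫ z) k' → k' = w ≫ k

/-- Unique existence means that {k | Φ} is a singleton, so the subobject is a pullback of the
singleton mono. -/
theorem rep_existsUnique {X K : E} {Φ : ∀ Z : E, (Z ⟶ X) → (Z ⟶ K) → Prop}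
    (hΦ : Rep (fun Z (z : Z ⟶ X ⨯ K) => Φ Z (z ≫ prod.fst) (z ≫ prod.snd))) :
    Rep (fun Z (z : Z ⟶ X) => ExistsUniqueAt Φ z) := by
  obtain ⟨χ, h1⟩ := exists_comprehension hΦ
  refine ((rep_range (singleton K)).comp χ).congr fun Z z => ⟨?_, ?_⟩
  · rintro ⟨k, hk, hu⟩
    refine ⟨k, pow_ext fun Z' w k' => ?_⟩
    rw [← Category.assoc, isElem_singleton, ← Category.assoc, h1]
    refine ⟨?_, hu _ _ _⟩
    rintro rfl
    rw [← h1, Category.assoc]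
    exact ((h1 _ _ _).2 hk).comp w
  · rintro ⟨k, hk⟩
    refine ⟨k, ?_, fun Z' w k' h => ?_⟩
    · rw [← h1, ← hk, isElem_singleton]
    · rw [← h1, Category.assoc, ← hk, ← Category.assoc, isElem_singleton] at h
      exact h

end Calculus

/-! ### The natural numbers object -/

section Numbers

variable (E : Type u) [Category.{v} E] [Topos E]

theorem exists_chosenNNO :
    ∃ (D : Σ N : E, (⊤_ E ⟶ N) × (N ⟶ N)), IsNNO D.2.1 D.2.2 := by
  obtain ⟨T, N, zero, succ, ⟨hT⟩, h⟩ := Topos.exists_nno (E := E)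
  refine ⟨⟨N, hT.from _ ≫ zero, succ⟩, ⟨terminalIsTerminal⟩, fun A a s => ?_⟩
  obtain ⟨f, ⟨h1, h2⟩, hu⟩ := h (terminalIsTerminal.from T ≫ a) s
  refine ⟨f, ⟨?_, h2⟩, fun g hg => hu g ⟨?_, hg.2⟩⟩
  · dsimp
    rw [Category.assoc, h1, ← Category.assoc, terminalIsTerminal.hom_ext (_ ≫ _) (𝟙 _),
      Category.id_comp]
  · rw [← hg.1]
    dsimp
    rw [Category.assoc, ← Category.assoc, hT.hom_ext (_ ≫ _) (𝟙 _), Category.id_comp]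

/-- The chosen natural numbers object. -/
noncomputable def Num : E := (exists_chosenNNO E).choose.1

noncomputable def numZero : ⊤_ E ⟶ Num E := (exists_chosenNNO E).choose.2.1

noncomputable def numSucc : Num E ⟶ Num E := (exists_chosenNNO E).choose.2.2

theorem isNNO_num : IsNNO (numZero E) (numSucc E) := (exists_chosenNNO E).choose_spec

variable {E}

/-- Every representable predicate holds at the stage `Z`. -/
def Absurd (Z : E) : Prop := ∀ φ : ∀ Z' : E, (Z' ⟶ Z) → Prop, Rep φ → φ Z (𝟙 Z)

theorem Absurd.isElem {Z K : E} (h : Absurd Z) (k : Z ⟶ K) (A : Z ⟶ Pow K) : IsElem k A := by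
  simpa using h _ (rep_isElem k A)

variable (E) in
-- Recursion on pairs, (n, n - 1) ↦ (n + 1, n) starting from (0, 0). The first component is the
-- identity by uniqueness of recursion, so the second is a left inverse of the successor.
theorem exists_pred : ∃ p : Num E ⟶ Num E, numSucc E ≫ p = 𝟙 _ := by
  obtain ⟨f, ⟨h1, h2⟩, -⟩ := (isNNO_num E).2 (prod.lift (numZero E) (numZero E))
    (prod.lift (prod.fst ≫ numSucc E) prod.fst)
  obtain ⟨i, -, hi⟩ := (isNNO_num E).2 (numZero E) (numSucc E)
  refine ⟨f ≫ prod.snd, ?_⟩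
  rw [← Category.assoc, h2, Category.assoc, prod.lift_snd, hi (f ≫ prod.fst), hi (𝟙 _)]
  · simp
  · constructor
    · rw [← Category.assoc, h1, prod.lift_fst]
    · rw [← Category.assoc, h2]
      simp

instance mono_numSucc : Mono (numSucc E) := by
  obtain ⟨p, hp⟩ := exists_pred E
  exact mono_of_mono_fac hp

/-- Define a map from the numbers to truth values (`Pow (⊤_ E)`) that is true at zero and constantly
false at successors. If some successor is zero, then true equals false at this stage. Falsity is
taken to be "every truth value holds", so each representable predicate follows and no initial object
is needed. -/
theorem absurd_of_succ_eq_zero {Z : E} (n : Z ⟶ Num E)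
    (h : n ≫ numSucc E = terminal.from Z ≫ numZero E) : Absurd Z := by
  obtain ⟨t, ht⟩ := exists_comprehension (X := ⊤_ E) (K := ⊤_ E) (Φ := fun _ _ _ => True)
    (rep_true _)
  obtain ⟨f, hf⟩ := exists_comprehension (X := ⊤_ E) (K := ⊤_ E)
    (Φ := fun Z _ _ => ∀ (Z' : E) (_ : Z' ⟶ Z) (p : Z' ⟶ Pow (⊤_ E)), True →
      IsElem (terminal.from Z') p)
    (rep_forall_imp (Φ := fun _ _ _ => True) (Ψ := fun Z _ p => IsElem (terminal.from Z) p)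
      (rep_true _) ((rep_isElem (terminal.from _) prod.snd).congr fun Z z => by
        rw [terminal.comp_from]))
  obtain ⟨r, ⟨h1, h2⟩, -⟩ := (isNNO_num E).2 t (terminal.from _ ≫ f)
  have e : terminal.from Z ≫ f = terminal.from Z ≫ t := by
    rw [← h1, ← reassoc_of% h, h2]
    simp only [← Category.assoc, terminal.comp_from]
  have key := (ht Z (terminal.from Z) (terminal.from Z)).2 trivial
  rw [← e, hf] at key
  intro φ hφ
  obtain ⟨χ, hχ⟩ := exists_comprehension (X := Z) (K := ⊤_ E) (Φ := fun Z z _ => φ Z z)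
    (hφ.comp prod.fst)
  have := key Z (𝟙 Z) χ trivial
  rwa [← Category.id_comp χ, hχ] at this

/-! ### Objects that embed their own square -/

theorem isElem_image_succ_iff {Z : E} (m : Z ⟶ Num E) (v : Z ⟶ Pow (Num E)) :
    IsElem (m ≫ numSucc E) (v ≫ nameOf (elemPow (Num E)) (elemArg (Num E) ≫ numSucc E)
      ((jointlyMonic_elem _).comp_mono _)) ↔ IsElem m v := by
  rw [isElem_nameOf]
  simp only [← Category.assoc, cancel_mono]
  rfl

variable (E) in
/-- Two jointly injective endomaps of the power object of the natural numbers, with disjoint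
images. -/
theorem exists_disjoint_injections : ∃ d₀ d₁ : Pow (Num E) ⟶ Pow (Num E), Mono d₀ ∧ Mono d₁ ∧
    ∀ (Z : E) (v w : Z ⟶ Pow (Num E)), v ≫ d₀ = w ≫ d₁ → Absurd Z := by
  -- This map sends v to {n | ∀ m, m + 1 = n → m ∈ v}, which is the successor image of v together
  -- with 0. The other map is the plain successor image, which omits 0; the element 0 therefore
  -- separates the two images.
  obtain ⟨d₁, h₁⟩ := exists_comprehension (X := Pow (Num E)) (K := Num E)
    (Φ := fun Z v n => ∀ (Z' : E) (w : Z' ⟶ Z) (m : Z' ⟶ Num E),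
      m ≫ numSucc E = w ≫ n → IsElem m (w ≫ v))
    ((rep_forall_imp (X := Pow (Num E) ⨯ Num E) (K := Num E)
      (Φ := fun Z z m => m ≫ numSucc E = z ≫ prod.snd) (Ψ := fun Z z m => IsElem m (z ≫ prod.fst))
      ((rep_eq (prod.snd ≫ numSucc E) (prod.fst ≫ prod.snd)).congr (by simp))
      ((rep_isElem prod.snd (prod.fst ≫ prod.fst)).congr (by simp))).congr (by simp))
  refine ⟨nameOf (elemPow (Num E)) (elemArg (Num E) ≫ numSucc E)
    ((jointlyMonic_elem _).comp_mono _), d₁, ⟨fun f g h => ?_⟩,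
    ⟨fun f g h => ?_⟩, fun Z v w h => ?_⟩
  · refine pow_ext fun Z z k => ?_
    rw [← isElem_image_succ_iff, Category.assoc, h, ← Category.assoc, isElem_image_succ_iff]
  · refine pow_ext fun Z z k => ?_
    have key (f : Z ⟶ Pow (Num E)) :
        IsElem k f ↔ IsElem (k ≫ numSucc E) (f ≫ d₁) := by
      rw [h₁]
      refine ⟨fun hk Z' w m hm => ?_, fun hk => by simpa using hk _ (𝟙 _) k (by simp)⟩
      rw [← Category.assoc, cancel_mono] at hm
      subst hm
      exact hk.comp w
    rw [key, key, Category.assoc, h, Category.assoc]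
  · have h0 : IsElem (terminal.from Z ≫ numZero E) (w ≫ d₁) := by
      rw [h₁]
      intro Z' w' m hm
      refine (absurd_of_succ_eq_zero m ?_).isElem _ _
      rw [hm, ← Category.assoc, terminal.comp_from]
    rw [← h, isElem_nameOf] at h0
    obtain ⟨r, -, hr⟩ := h0
    exact absurd_of_succ_eq_zero (r ≫ elemArg _) (by rw [Category.assoc, hr])

/-- Morally, P(PN × Q)² is P((PN + PN) × Q), and PN + PN embeds in PN by the two disjoint
injections. The pair (S₀, S₁) is coded by the set of those (u, q) such that (v, q) ∈ Sᵢ whenever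
dᵢ(v) = u. Membership of (v, q) in Sᵢ is read off at (dᵢ(v), q), where the condition for the other
index is vacuous by disjointness. -/
theorem exists_mono_pairing (Q : E) :
    ∃ p : Pow (Pow (Num E) ⨯ Q) ⨯ Pow (Pow (Num E) ⨯ Q) ⟶ Pow (Pow (Num E) ⨯ Q), Mono p := by
  obtain ⟨d₀, d₁, m₀, m₁, hd⟩ := exists_disjoint_injections E
  have rep (d : Pow (Num E) ⟶ Pow (Num E))
      (s : Pow (Pow (Num E) ⨯ Q) ⨯ Pow (Pow (Num E) ⨯ Q) ⟶ Pow (Pow (Num E) ⨯ Q)) :=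
    rep_forall_imp (X := (Pow (Pow (Num E) ⨯ Q) ⨯ Pow (Pow (Num E) ⨯ Q)) ⨯ (Pow (Num E) ⨯ Q))
      (K := Pow (Num E))
      (Φ := fun Z z m => m ≫ d = z ≫ prod.snd ≫ prod.fst)
      (Ψ := fun Z z m => IsElem (prod.lift m (z ≫ prod.snd ≫ prod.snd)) (z ≫ prod.fst ≫ s))
      ((rep_eq (prod.snd ≫ d) (prod.fst ≫ prod.snd ≫ prod.fst)).congr (by simp))
      ((rep_isElem (prod.lift prod.snd (prod.fst ≫ prod.snd ≫ prod.snd))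
        (prod.fst ≫ prod.fst ≫ s)).congr (by simp))
  obtain ⟨p, hp⟩ := exists_comprehension
    (Φ := fun Z (s : Z ⟶ Pow (Pow (Num E) ⨯ Q) ⨯ Pow (Pow (Num E) ⨯ Q)) (x : Z ⟶ _ ⨯ Q) =>
      (∀ (Z' : E) (w : Z' ⟶ Z) (v : Z' ⟶ Pow (Num E)), v ≫ d₀ = w ≫ x ≫ prod.fst →
        IsElem (prod.lift v (w ≫ x ≫ prod.snd)) (w ≫ s ≫ prod.fst)) ∧
      (∀ (Z' : E) (w : Z' ⟶ Z) (v : Z' ⟶ Pow (Num E)), v ≫ d₁ = w ≫ x ≫ prod.fst →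
        IsElem (prod.lift v (w ≫ x ≫ prod.snd)) (w ≫ s ≫ prod.snd)))
    (((rep d₀ prod.fst).and (rep d₁ prod.snd)).congr (by simp))
  refine ⟨p, ⟨fun f g h => ?_⟩⟩
  have key₀ (Z : E) (f : Z ⟶ Pow (Pow (Num E) ⨯ Q) ⨯ Pow (Pow (Num E) ⨯ Q))
      (k : Z ⟶ Pow (Num E) ⨯ Q) : IsElem k (f ≫ prod.fst) ↔
        IsElem (prod.lift (k ≫ prod.fst ≫ d₀) (k ≫ prod.snd)) (f ≫ p) := by
    rw [hp]
    refine ⟨fun hk => ⟨fun Z' w v hv => ?_, fun Z' w v hv => ?_⟩, fun hk => ?_⟩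
    · rw [prod.lift_fst, ← Category.assoc, ← Category.assoc, cancel_mono] at hv
      subst hv
      convert! hk.comp w using 1
      ext <;> simp
    · rw [prod.lift_fst, ← Category.assoc, ← Category.assoc] at hv
      exact (hd _ _ _ hv.symm).isElem _ _
    · convert! hk.1 Z (𝟙 Z) (k ≫ prod.fst) (by simp) using 1
      · ext <;> simp
      · simp
  have key₁ (Z : E) (f : Z ⟶ Pow (Pow (Num E) ⨯ Q) ⨯ Pow (Pow (Num E) ⨯ Q))
      (k : Z ⟶ Pow (Num E) ⨯ Q) : IsElem k (f ≫ prod.snd) ↔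
        IsElem (prod.lift (k ≫ prod.fst ≫ d₁) (k ≫ prod.snd)) (f ≫ p) := by
    rw [hp]
    refine ⟨fun hk => ⟨fun Z' w v hv => ?_, fun Z' w v hv => ?_⟩, fun hk => ?_⟩
    · rw [prod.lift_fst, ← Category.assoc, ← Category.assoc] at hv
      exact (hd _ _ _ hv).isElem _ _
    · rw [prod.lift_fst, ← Category.assoc, ← Category.assoc, cancel_mono] at hv
      subst hv
      convert! hk.comp w using 1
      ext <;> simp
    · convert! hk.2 Z (𝟙 Z) (k ≫ prod.fst) (by simp) using 1
      · ext <;> simp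
      · simp
  ext
  · refine pow_ext fun Z z k => ?_
    rw [← Category.assoc, key₀, ← Category.assoc z, key₀, Category.assoc, h, Category.assoc]
  · refine pow_ext fun Z z k => ?_
    rw [← Category.assoc, key₁, ← Category.assoc z, key₁, Category.assoc, h, Category.assoc]

variable (E) in
/-- An object containing the natural numbers and its own square. -/
structure SquareClosed where
  obj : E
  nat : Num E ⟶ obj
  pair : obj ⨯ obj ⟶ obj
  mono_nat : Mono nat
  mono_pair : Mono pair

attribute [instance] SquareClosed.mono_nat SquareClosed.mono_pair

theorem exists_squareClosed (Q : E) : ∃ (L : SquareClosed E) (i : Q ⟶ L.obj), Mono i := by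
  obtain ⟨p, hp⟩ := exists_mono_pairing (Pow Q)
  obtain ⟨t, -⟩ := exists_comprehension (X := ⊤_ E) (K := Q) (Φ := fun _ _ _ => True)
    (rep_true _)
  -- A number n is coded by {({n}, Q)} and an element q by {({0}, {q})}. The factor `Pow Q` is used
  -- in place of Q because Q need not have a global element to pair with the numbers.
  refine ⟨⟨Pow (Pow (Num E) ⨯ Pow Q), prod.lift (singleton _) (terminal.from _ ≫ t) ≫ singleton _,
    p, mono_comp _ _, hp⟩,
    prod.lift (terminal.from _ ≫ numZero E ≫ singleton _) (singleton Q) ≫ singleton _,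
    mono_comp _ _⟩

/-- A square-closed object containing `Q`. -/
noncomputable def squareClosure (Q : E) : SquareClosed E := (exists_squareClosed Q).choose

noncomputable def toSquareClosure (Q : E) : Q ⟶ (squareClosure Q).obj :=
  (exists_squareClosed Q).choose_spec.choose

instance mono_toSquareClosure (Q : E) : Mono (toSquareClosure Q) :=
  (exists_squareClosed Q).choose_spec.choose_spec

end Numbers

/-! ### Sections, and natural numbers objects of slices -/

section Slices

variable {E : Type u} [Category.{v} E] [Topos E]

/-- The object of sections of `p : A ⟶ X`. -/
theorem exists_sections {A X : E} (p : A ⟶ X) : ∃ (S : E) (ev : S ⨯ X ⟶ A), ev ≫ p = prod.snd ∧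
    ∀ (Z : E) (f : Z ⨯ X ⟶ A), f ≫ p = prod.snd →
      ∃! t : Z ⟶ S, prod.lift (prod.fst ≫ t) prod.snd ≫ ev = f := by
  -- Sections are represented as subsets g of A that contain exactly one element over each x.
  have rep : Rep (fun Z (g : Z ⟶ Pow A) => ∀ (Z' : E) (w : Z' ⟶ Z) (x : Z' ⟶ X), True →
      ExistsUniqueAt (X := Pow A ⨯ X) (fun Z gx (y : Z ⟶ A) => IsElem y (gx ≫ prod.fst) ∧
        y ≫ p = gx ≫ prod.snd) (prod.lift (w ≫ g) x)) :=
    rep_forall_imp (Φ := fun _ _ _ => True) (Ψ := fun Z g x => ExistsUniqueAt (X := Pow A ⨯ X)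
      (fun Z gx (y : Z ⟶ A) => IsElem y (gx ≫ prod.fst) ∧ y ≫ p = gx ≫ prod.snd)
        (prod.lift g x)) (rep_true _)
      ((rep_existsUnique (X := Pow A ⨯ X) (K := A)
        (Φ := fun Z gx y => IsElem y (gx ≫ prod.fst) ∧ y ≫ p = gx ≫ prod.snd)
        (((rep_isElem prod.snd (prod.fst ≫ prod.fst)).and
          (rep_eq (prod.snd ≫ p) (prod.fst ≫ prod.snd))).congr (by simp))).congr
            fun Z z => by rw [← prod.comp_lift, prod.lift_fst_snd, Category.comp_id])
  obtain ⟨S, m, hm, hS⟩ := rep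
  -- Evaluation is the unique element supplied by the generic section at the generic point of X.
  obtain ⟨ev, ⟨h1, h2⟩, h3⟩ := (hS S m).2 ⟨𝟙 S, by simp⟩ (S ⨯ X) prod.fst prod.snd trivial
  simp only [prod.comp_lift, prod.lift_fst, prod.lift_snd, ← Category.assoc] at h1 h2 h3
  refine ⟨S, ev, h2, fun Z f hf => ?_⟩
  have elem_iff (Z' : E) (t : Z' ⟶ S) (y : Z' ⟶ A) :
      IsElem y (t ≫ m) ↔ prod.lift t (y ≫ p) ≫ ev = y := by
    refine ⟨fun h => (h3 Z' (prod.lift t (y ≫ p)) y ⟨by simpa using h, by simp⟩).symm, fun h => ?_⟩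
    have := h1.comp (prod.lift t (y ≫ p))
    simpa [h] using this
  have hj : JointlyMonic (prod.fst : Z ⨯ X ⟶ Z) f := by
    intro W s t e1 e2
    ext
    · exact e1
    · rw [← hf, reassoc_of% e2]
  have hχ : ∃ t : Z ⟶ S, t ≫ m = nameOf prod.fst f hj := by
    refine (hS _ _).1 fun Z' w x _ => ⟨prod.lift w x ≫ f, ⟨?_, ?_⟩, fun Z'' w' y hy => ?_⟩
    · rw [prod.lift_fst, isElem_nameOf]
      exact ⟨prod.lift w x, by simp⟩
    · simp [hf]
    · obtain ⟨hy, hp⟩ := hy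
      rw [prod.comp_lift, prod.lift_fst, ← Category.assoc, isElem_nameOf] at hy
      obtain ⟨r, hr, rfl⟩ := hy
      rw [Category.assoc, hf, prod.comp_lift, prod.lift_snd] at hp
      rw [← Category.assoc]
      congr 1
      ext <;> simp [hr, hp]
  obtain ⟨t, ht⟩ := hχ
  refine ⟨t, ?_, fun t' ht' => ?_⟩
  · have h : IsElem f (prod.fst ≫ t ≫ m) := by
      rw [ht, isElem_nameOf]
      exact ⟨𝟙 _, by simp⟩
    rw [← Category.assoc, elem_iff, hf] at h
    exact h
  · rw [← cancel_mono m, ht]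
    refine pow_ext fun Z' z y => ?_
    rw [isElem_nameOf, ← Category.assoc, elem_iff]
    constructor
    · intro h
      refine ⟨prod.lift z (y ≫ p), by simp, ?_⟩
      rw [← ht', ← Category.assoc, prod.comp_lift, prod.lift_snd, prod.lift_fst_assoc, h]
    · rintro ⟨r, rfl, rfl⟩
      rw [Category.assoc r f p, hf]
      conv_rhs => rw [← ht']
      simp [← Category.assoc]

/-- The natural numbers object of a slice. -/
noncomputable abbrev overNum (X : E) : Over X := Over.mk (prod.snd : Num E ⨯ X ⟶ X)

noncomputable def overZero (X : E) : Over.mk (𝟙 X) ⟶ overNum X :=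
  Over.homMk (prod.lift (terminal.from X ≫ numZero E) (𝟙 X)) (by simp)

noncomputable def overSucc (X : E) : overNum X ⟶ overNum X :=
  Over.homMk (prod.lift (prod.fst ≫ numSucc E) prod.snd) (by simp)

/-- Maps Num × X ⟶ A over X correspond to maps from Num to the object S of sections of A.
Transposing turns the recursion data (a, s) over X into data (a', σ) on S, and `key` matches the two
recursion equations, so the universal property over X reduces to that of Num. -/
theorem isNNO_over (X : E) : IsNNO (overZero X) (overSucc X) := by
  refine ⟨⟨Over.mkIdTerminal⟩, fun A a s => ?_⟩
  obtain ⟨S, ev, hev, hS⟩ := exists_sections A.hom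
  obtain ⟨a', ha', -⟩ := hS (⊤_ E) (prod.snd ≫ a.left) (by
    rw [Category.assoc, Over.w a]; exact Category.comp_id _)
  obtain ⟨σ, hσ, -⟩ := hS S (ev ≫ s.left) (by simp [hev])
  have key (g : Num E ⨯ X ⟶ A.left) (t : Num E ⟶ S)
      (ht : prod.lift (prod.fst ≫ t) prod.snd ≫ ev = g) :
      (numZero E ≫ t = a' ∧ numSucc E ≫ t = t ≫ σ) ↔
      (prod.lift (terminal.from X ≫ numZero E) (𝟙 X) ≫ g = a.left ∧
        prod.lift (prod.fst ≫ numSucc E) prod.snd ≫ g = g ≫ s.left) := by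
    have hg : g ≫ A.hom = prod.snd := by rw [← ht, Category.assoc, hev, prod.lift_snd]
    refine and_congr ⟨fun h => ?_, fun h => ?_⟩ ⟨fun h => ?_, fun h => ?_⟩
    · subst h ht
      have := congrArg (prod.lift (terminal.from X) (𝟙 X) ≫ ·) ha'
      simpa [← Category.assoc] using this
    · refine (hS (⊤_ E) (prod.snd ≫ a.left) (by
        rw [Category.assoc, Over.w a]; exact Category.comp_id _)).unique ?_ ha'
      rw [← h, ← ht]
      simp only [← Category.assoc]
      congr 1
      ext
      · simp [← Category.assoc,
          Subsingleton.elim (prod.fst : (⊤_ E) ⨯ X ⟶ ⊤_ E) (terminal.from _)]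
      · simp
    · subst ht
      have := congrArg (prod.lift (prod.fst ≫ t) prod.snd ≫ ·) hσ
      simp only [← Category.assoc, prod.comp_lift, prod.lift_fst, prod.lift_snd] at this ⊢
      rw [← this]
      simp [h]
    · refine (hS (Num E) (g ≫ s.left) (by simp [hg])).unique ?_ ?_
      · rw [← h, ← ht]
        simp [← Category.assoc]
      · subst ht
        rw [Category.assoc, ← hσ]
        simp [← Category.assoc]
  obtain ⟨f, hf, hfu⟩ := (isNNO_num E).2 a' σ
  have hw : (prod.lift (prod.fst ≫ f) prod.snd ≫ ev) ≫ A.hom = prod.snd := by simp [hev]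
  refine ⟨Over.homMk (prod.lift (prod.fst ≫ f) prod.snd ≫ ev) hw, ?_, fun g hg => ?_⟩
  · obtain ⟨h1, h2⟩ := (key _ f rfl).1 hf
    exact ⟨Over.OverMorphism.ext h1, Over.OverMorphism.ext h2⟩
  · obtain ⟨t, ht, -⟩ := hS _ g.left (Over.w g)
    have := hfu t ((key _ t ht).2 ⟨congrArg CommaMorphism.left hg.1,
      congrArg CommaMorphism.left hg.2⟩)
    ext
    rw [← ht, this]
    rfl

end Slices

/-! ### Power objects of slices -/

section SlicePower

variable {E : Type u} [Category.{v} E]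

/-- Two maps of E into R that agree after b automatically have the same composite to X, so they can
be compared in the slice. -/
theorem jointlyMonic_left {X : E} {R B A : Over X} {b : R ⟶ B} {a : R ⟶ A}
    (h : JointlyMonic b a) : JointlyMonic b.left a.left := by
  intro Z s t h1 h2
  have e : t ≫ R.hom = s ≫ R.hom := by
    rw [← Over.w b, ← Category.assoc, ← h1, Category.assoc]
  exact congrArg CommaMorphism.left (h (Z := Over.mk (s ≫ R.hom)) (Over.homMk s) (Over.homMk t e)
    (Over.OverMorphism.ext h1) (Over.OverMorphism.ext h2))

theorem jointlyMonic_of_left {X : E} {R B A : Over X} {b : R ⟶ B} {a : R ⟶ A}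
    (h : JointlyMonic b.left a.left) : JointlyMonic b a := fun _ _ _ h1 h2 =>
  Over.OverMorphism.ext (h _ _ (congrArg CommaMorphism.left h1) (congrArg CommaMorphism.left h2))

variable [Topos E]

/-- The generalised subobject `S` of `L` is contained in the fibre over `x` of the relation
`(q, k)`. -/
def SubFibre {Y X L Z : E} (q : Y ⟶ X) (k : Y ⟶ L) (x : Z ⟶ X) (S : Z ⟶ Pow L) : Prop :=
  ∀ (Z' : E) (w : Z' ⟶ Z) (l : Z' ⟶ L), IsElem l (w ≫ S) → ∃ y : Z' ⟶ Y, y ≫ q = w ≫ x ∧ y ≫ k = l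

theorem SubFibre.comp {Y X L Z Z' : E} {q : Y ⟶ X} {k : Y ⟶ L} {x : Z ⟶ X} {S : Z ⟶ Pow L}
    (h : SubFibre q k x S) (w : Z' ⟶ Z) : SubFibre q k (w ≫ x) (w ≫ S) := fun Z'' w' l hl => by
  simpa using h Z'' (w' ≫ w) l (by simpa using hl)

/-- Power objects of a slice, in terms of generalised elements. -/
theorem isPowerObject_over {X L : E} {Y P M : Over X} (π : M ⟶ P) (ε : M ⟶ Y) (k : Y.left ⟶ L)
    (s : P.left ⟶ Pow L) (hk : JointlyMonic Y.hom k) (hs : JointlyMonic P.hom s)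
    (hP : SubFibre Y.hom k P.hom s)
    (hP' : ∀ (Z : E) (x : Z ⟶ X) (S : Z ⟶ Pow L), SubFibre Y.hom k x S →
      ∃ t : Z ⟶ P.left, t ≫ P.hom = x ∧ t ≫ s = S)
    (hπ : JointlyMonic π.left ε.left) (hM : IsElem (ε.left ≫ k) (π.left ≫ s))
    (hM' : ∀ (Z : E) (t : Z ⟶ P.left) (y : Z ⟶ Y.left), t ≫ P.hom = y ≫ Y.hom →
      IsElem (y ≫ k) (t ≫ s) → ∃ m : Z ⟶ M.left, m ≫ π.left = t ∧ m ≫ ε.left = y) :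
    IsPowerObject π ε := by
  refine ⟨jointlyMonic_of_left hπ, fun B R b a hR => ?_⟩
  have hR' := jointlyMonic_left hR
  have hRk : JointlyMonic b.left (a.left ≫ k) := by
    intro Z u v h1 h2
    refine hR' u v h1 (hk _ _ ?_ (by simpa using h2))
    rw [Category.assoc, Category.assoc, Over.w a, ← Over.w b, ← Category.assoc, h1, Category.assoc]
  have hχ : SubFibre Y.hom k B.hom (nameOf b.left (a.left ≫ k) hRk) := by
    intro Z w l hl
    rw [isElem_nameOf] at hl
    obtain ⟨r, rfl, rfl⟩ := hl
    exact ⟨r ≫ a.left, by simp, by simp⟩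
  obtain ⟨χ₀, h1, h2⟩ := hP' _ _ _ hχ
  obtain ⟨t₀, h3, h4⟩ := hM' R.left (b.left ≫ χ₀) a.left (by simp [h1]) (by
    rw [Category.assoc, h2, isElem_nameOf]
    exact ⟨𝟙 _, by simp, by simp⟩)
  have h5 : t₀ ≫ M.hom = R.hom := by rw [← Over.w ε, reassoc_of% h4, Over.w a]
  refine ⟨Over.homMk χ₀ h1, ⟨Over.homMk t₀ h5, JointlyMonic.isPullback ?_ ?_ ?_, ?_⟩, ?_⟩
  · intro Z u v e1 e2
    refine hR u v e2 ?_
    ext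
    have : u.left ≫ t₀ = v.left ≫ t₀ := congrArg CommaMorphism.left e1
    rw [Over.comp_left, Over.comp_left, ← h4, reassoc_of% this]
  · ext
    exact h3
  · intro Z m z hz
    have hz' : m.left ≫ π.left = z.left ≫ χ₀ := congrArg CommaMorphism.left hz
    have hm := hM.comp m.left
    rw [reassoc_of% hz', h2, isElem_nameOf] at hm
    obtain ⟨r, e1, e2⟩ := hm
    have e3 : r ≫ R.hom = Z.hom := by rw [← Over.w b, reassoc_of% e1, Over.w z]
    have e4 : r ≫ a.left = m.left ≫ ε.left := by
      refine hk _ _ ?_ (by simpa using e2)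
      simp [e3]
    refine ⟨Over.homMk r e3, ?_, Over.OverMorphism.ext e1⟩
    ext
    refine hπ _ _ ?_ ?_
    · simp [h3, hz', reassoc_of% e1]
    · simp [h4, e4]
  · ext
    exact h4
  · rintro χ' ⟨t', ht', rfl⟩
    ext
    -- Uniqueness: a classifying map is determined by its subset of L, and the pullback square
    -- forces the elements of that subset to be the codes of elements of R.
    refine hs _ _ (by simp [h1]) (Eq.trans ?_ h2.symm)
    refine pow_ext fun Z z l => ?_
    rw [isElem_nameOf]
    have hw : t'.left ≫ π.left = b.left ≫ χ'.left := congrArg CommaMorphism.left ht'.w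
    constructor
    · intro hl
      obtain ⟨y, e1, e2⟩ := (hP.comp (z ≫ χ'.left)) _ (𝟙 _) l (by simpa using hl)
      simp only [Category.assoc, Over.w, Category.id_comp] at e1
      obtain ⟨m, e3, e4⟩ := hM' Z (z ≫ χ'.left) y (by simp [e1]) (by simpa [e2] using hl)
      have e5 : m ≫ M.hom = z ≫ B.hom := by rw [← Over.w ε, reassoc_of% e4, e1]
      have e6 : (Over.homMk m e5 : Over.mk (z ≫ B.hom) ⟶ M) ≫ π =
        (Over.homMk z : Over.mk (z ≫ B.hom) ⟶ B) ≫ χ' := Over.OverMorphism.ext e3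
      have e7 : (ht'.lift _ _ e6).left ≫ t'.left = m :=
        congrArg CommaMorphism.left (ht'.lift_fst _ _ e6)
      refine ⟨(ht'.lift _ _ e6).left, congrArg CommaMorphism.left (ht'.lift_snd _ _ e6), ?_⟩
      rw [Over.comp_left, Category.assoc, reassoc_of% e7, reassoc_of% e4, e2]
    · rintro ⟨r, rfl, rfl⟩
      have := hM.comp (r ≫ t'.left)
      simpa [hw, reassoc_of% hw] using this

/-- Power objects of slices, as objects of subsets of an object in which the given family
embeds fibrewise. -/
theorem exists_powerObject_over {X L : E} (Y : Over X) (k : Y.left ⟶ L)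
    (hk : JointlyMonic Y.hom k) :
    ∃ (P M : Over X) (π : M ⟶ P) (ε : M ⟶ Y) (s : P.left ⟶ Pow L), IsPowerObject π ε ∧
      JointlyMonic P.hom s := by
  -- The power object is {(x, S) | S ⊆ k(Yₓ)}, and M is the membership relation on it.
  have rep : Rep (X := X ⨯ Pow L) (fun Z z => SubFibre Y.hom k (z ≫ prod.fst) (z ≫ prod.snd)) := by
    have hm : Mono (prod.lift Y.hom k) := ⟨fun f g h => hk f g
      (by simpa using congrArg (· ≫ prod.fst) h) (by simpa using congrArg (· ≫ prod.snd) h)⟩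
    refine (rep_forall_imp (X := X ⨯ Pow L) (K := L)
      (Φ := fun Z z l => IsElem l (z ≫ prod.snd))
      (Ψ := fun Z z l => ∃ y : Z ⟶ Y.left, y ≫ Y.hom = z ≫ prod.fst ∧ y ≫ k = l)
      ((rep_isElem prod.snd (prod.fst ≫ prod.snd)).congr (by simp))
      (((rep_range (prod.lift Y.hom k)).comp (prod.lift (prod.fst ≫ prod.fst) prod.snd)).congr
        fun Z z => exists_congr fun y => ?_)).congr (by simp [SubFibre])
    constructor
    · rintro ⟨h1, h2⟩
      simp [h1, h2]
    · intro h
      exact ⟨by simpa using congrArg (· ≫ prod.fst) h, by simpa using congrArg (· ≫ prod.snd) h⟩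
  obtain ⟨P, i, hi, h⟩ := rep
  have hP : SubFibre Y.hom k (i ≫ prod.fst) (i ≫ prod.snd) := (h _ i).2 ⟨𝟙 _, by simp⟩
  -- Each member of S is the code of an element of the fibre; decoding the generic member gives the
  -- map from M to Y.
  obtain ⟨y, hy1, hy2⟩ := hP _ (pullback.snd (elemPow L) (i ≫ prod.snd))
    (pullback.fst (elemPow L) (i ≫ prod.snd) ≫ elemArg L)
    ⟨pullback.fst _ _, pullback.condition, rfl⟩
  have hs : JointlyMonic (i ≫ prod.fst) (i ≫ prod.snd) := by
    intro Z f g h1 h2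
    rw [← cancel_mono i]
    ext <;> simpa
  refine ⟨Over.mk (i ≫ prod.fst), Over.mk (pullback.snd (elemPow L) (i ≫ prod.snd) ≫ i ≫ prod.fst),
    Over.homMk (pullback.snd _ _), Over.homMk y, i ≫ prod.snd, ?_, hs⟩
  refine isPowerObject_over _ _ k (i ≫ prod.snd) hk hs hP ?_ ?_ ?_ ?_
  · intro Z x S hS
    obtain ⟨t, ht⟩ := (h Z (prod.lift x S)).1 (by simpa using hS)
    exact ⟨t, by simp [reassoc_of% ht], by simp [reassoc_of% ht]⟩
  · intro Z f g h1 h2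
    refine pullback.hom_ext (jointlyMonic_elem L _ _ ?_ ?_) h1
    · simp only [Category.assoc, pullback.condition]
      simp only [Over.homMk_left] at h1
      rw [reassoc_of% h1]
    · simp only [Over.homMk_left] at h2
      rw [Category.assoc, Category.assoc, ← hy2, reassoc_of% h2]
  · exact ⟨pullback.fst _ _, pullback.condition, hy2.symm⟩
  · rintro Z t y' e ⟨m, h1, h2⟩
    refine ⟨pullback.lift m t h1, by simp, hk _ _ ?_ ?_⟩
    · simp only [Over.homMk_left, Category.assoc, hy1]
      simpa using e
    · simp [hy2, h2]

end SlicePower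

/-! ### Universes of subobjects of a fixed object -/

section Bounded

variable {E : Type u} [Category.{v} E] [Topos E]

/-- The generalised subobject `A` of `K` is contained in the image of `j : L ⟶ K`. -/
def BoundedBy {L K X : E} (j : L ⟶ K) (A : X ⟶ Pow K) : Prop :=
  ∀ (Z : E) (z : Z ⟶ X) (k : Z ⟶ K), IsElem k (z ≫ A) → ∃ l : Z ⟶ L, l ≫ j = k

theorem exists_bounded {L K : E} (j : L ⟶ K) [Mono j] :
    ∃ S : Subobject (Pow K), ∀ (X : E) (A : X ⟶ Pow K), S.Factors A ↔ BoundedBy j A := by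
  obtain ⟨S, m, hm, h⟩ := rep_forall_imp (X := Pow K) (K := K) (Φ := fun Z A k => IsElem k A)
    (Ψ := fun Z A k => ∃ l : Z ⟶ L, l ≫ j = k) (rep_isElem prod.snd prod.fst)
    ((rep_range j).comp prod.snd)
  exact ⟨Subobject.mk m, fun X A => (Subobject.mk_factors_iff m A).trans (h X A).symm⟩

/-- The subobject of `Pow K` of the subobjects of `K` contained in the subobject `j` of `K`. -/
noncomputable def bounded {L K : E} (j : L ⟶ K) [Mono j] : Subobject (Pow K) :=
  (exists_bounded j).choose

theorem bounded_factors {L K X : E} (j : L ⟶ K) [Mono j] (A : X ⟶ Pow K) :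
    (bounded j).Factors A ↔ BoundedBy j A := (exists_bounded j).choose_spec X A

theorem bounded_le {L L' K : E} (j : L ⟶ K) (j' : L' ⟶ K) [Mono j] [Mono j'] (f : L ⟶ L')
    (h : f ≫ j' = j) : bounded j ≤ bounded j' := by
  refine Subobject.le_of_comm ((bounded j').factorThru (bounded j).arrow
    ((bounded_factors j' _).2 fun Z z k hk => ?_)) (Subobject.factorThru_arrow _ _ _)
  obtain ⟨l, rfl⟩ := (bounded_factors j _).1 (Subobject.factors_of_le _ le_rfl
    (Subobject.factors_self _)) Z z k hk
  exact ⟨l ≫ f, by simp [h]⟩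

/-- The families contained in `q'` are those which embed fibrewise in `L`. -/
def Codes {U' U : E} (q' : U' ⟶ U) (L : E) : Prop :=
  ∀ ⦃Y X : E⦄ (q : Y ⟶ X), IsContained q q' ↔ ∃ k : Y ⟶ L, JointlyMonic q k

theorem exists_isPullback_nameOf {Y X K : E} {q : Y ⟶ X} {k : Y ⟶ K} (hk : JointlyMonic q k) :
    ∃ t : Y ⟶ Elem K, IsPullback t q (elemPow K) (nameOf q k hk) ∧ t ≫ elemArg K = k := by
  obtain ⟨t, h1, h2⟩ := (isElem_nameOf hk q k).2 ⟨𝟙 _, by simp, by simp⟩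
  refine ⟨t, JointlyMonic.isPullback ?_ h1 ?_, h2⟩
  · intro Z u v e1 e2
    exact hk u v e2 (by rw [← h2, reassoc_of% e1])
  · intro Z m x e
    obtain ⟨r, e1, e2⟩ := (isElem_nameOf hk x (m ≫ elemArg K)).1 ⟨m, e, rfl⟩
    refine ⟨r, jointlyMonic_elem K _ _ ?_ ?_, e1⟩
    · rw [Category.assoc, h1, reassoc_of% e1, e]
    · rw [Category.assoc, h2, e2]

theorem jointlyMonic_of_isPullback_elem {Y X K : E} {q : Y ⟶ X} {t : Y ⟶ Elem K} {A : X ⟶ Pow K}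
    (h : IsPullback t q (elemPow K) A) : JointlyMonic q (t ≫ elemArg K) := by
  intro Z u v h1 h2
  refine h.hom_ext (jointlyMonic_elem K _ _ ?_ (by simpa using h2)) h1
  simp only [Category.assoc, h.w]
  rw [reassoc_of% h1]

theorem codes_elemPow (K : E) : Codes (elemPow K) K := fun _ _ _ =>
  ⟨fun ⟨_, _, h⟩ => ⟨_, jointlyMonic_of_isPullback_elem h⟩, fun ⟨_, hk⟩ =>
    let ⟨t, h, _⟩ := exists_isPullback_nameOf hk
    ⟨t, _, h⟩⟩

theorem isContained_restrict_iff {Y X U' U : E} (q : Y ⟶ X) (q' : U' ⟶ U) (S : Subobject U) :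
    IsContained q (restrict q' S) ↔ ∃ (t : Y ⟶ U') (b : X ⟶ U), S.Factors b ∧
      IsPullback t q q' b := by
  constructor
  · rintro ⟨t, b, h⟩
    exact ⟨t ≫ pullback.fst _ _, b ≫ S.arrow, Subobject.factors_of_factors_right _
      (Subobject.factors_self _), (h.flip.paste_vert (IsPullback.of_hasPullback q' S.arrow).flip).flip⟩
  · rintro ⟨t, b, hb, h⟩
    refine ⟨pullback.lift t (q ≫ S.factorThru b hb) (by simp [h.w]), S.factorThru b hb,
      JointlyMonic.isPullback (fun Z u v h1 h2 => h.hom_ext ?_ h2) (pullback.lift_snd _ _ _)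
        fun Z x y e => ?_⟩
    · simpa using congrArg (· ≫ pullback.fst _ _) h1
    · have e' : (x ≫ pullback.fst q' S.arrow) ≫ q' = y ≫ b := by
        have := congrArg (· ≫ S.arrow) e
        simpa [restrict, pullback.condition] using this
      refine ⟨h.lift _ _ e', pullback.hom_ext (by simp) ?_, h.lift_snd _ _ _⟩
      rw [Category.assoc, pullback.lift_snd, ← Category.assoc, h.lift_snd]
      exact e.symm

/-- A subobject of K that lies inside L is the same as a subobject of L, so this restriction behaves
as the universe of subobjects of L. -/
theorem codes_restrict {L K : E} (j : L ⟶ K) [Mono j] :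
    Codes (restrict (elemPow K) (bounded j)) L := by
  intro Y X q
  rw [isContained_restrict_iff]
  constructor
  · rintro ⟨t, b, hb, h⟩
    obtain ⟨k, hk⟩ := (bounded_factors j b).1 hb Y q (t ≫ elemArg K) ⟨t, h.w, rfl⟩
    refine ⟨k, fun Z u v h1 h2 => jointlyMonic_of_isPullback_elem h u v h1 ?_⟩
    rw [← hk, reassoc_of% h2]
  · rintro ⟨k, hk⟩
    obtain ⟨t, h, -⟩ := exists_isPullback_nameOf (hk.comp_mono j)
    refine ⟨t, _, (bounded_factors j _).2 fun Z z l hl => ?_, h⟩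
    obtain ⟨r, -, hr⟩ := (isElem_nameOf _ z l).1 hl
    exact ⟨r ≫ k, by simpa using hr⟩

/-- Each closure property amounts to producing a fibrewise code in L: a product is coded by pairing
the codes of its components, a subobject by restricting the code, the terminal object by the
constant 0, and the natural numbers object Num × X by its number component. -/
theorem Codes.isSimpleUniverse {U' U : E} {q : U' ⟶ U} {L : SquareClosed E} (h : Codes q L.obj) :
    IsSimpleUniverse q where
  closed_prod X := ⟨fun W ⟨hW⟩ => by
    obtain ⟨k, hk⟩ := (h _).1 (hW.prop_diag_obj ⟨WalkingPair.left⟩)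
    obtain ⟨l, hl⟩ := (h _).1 (hW.prop_diag_obj ⟨WalkingPair.right⟩)
    refine (h _).2 ⟨prod.lift ((hW.π.app ⟨WalkingPair.left⟩).left ≫ k)
      ((hW.π.app ⟨WalkingPair.right⟩).left ≫ l) ≫ L.pair, JointlyMonic.comp_mono ?_ _⟩
    intro Z u v h1 h2
    have h3 := congrArg (· ≫ prod.fst) h2
    have h4 := congrArg (· ≫ prod.snd) h2
    simp only [prod.comp_lift, prod.lift_fst, prod.lift_snd, ← Category.assoc] at h3 h4
    refine congrArg CommaMorphism.left (hW.isLimit.hom_ext (W := Over.mk (u ≫ W.hom))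
      (f := Over.homMk u) (f' := Over.homMk v h1.symm) ?_)
    rintro ⟨_ | _⟩
    · exact Over.OverMorphism.ext (hk _ _ (by simpa using h1) h3)
    · exact Over.OverMorphism.ext (hl _ _ (by simpa using h1) h4)⟩
  closed_sub X := ⟨fun {A B} f _ hB => by
    obtain ⟨k, hk⟩ := (h _).1 hB
    refine (h _).2 ⟨f.left ≫ k, fun Z u v h1 h2 => ?_⟩
    rw [← cancel_mono f.left]
    exact hk _ _ (by simpa using h1) (by simpa using h2)⟩
  contains_one X := ⟨Over.mk (𝟙 X), ⟨Over.mkIdTerminal⟩,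
    (h _).2 ⟨terminal.from _ ≫ numZero E ≫ L.nat, jointlyMonic_of_mono_left (𝟙 X) _⟩⟩
  contains_nno X := by
    refine ⟨_, _, _, _, isNNO_over X, (h _).2 ⟨prod.fst ≫ L.nat, fun Z u v h1 h2 => prod.hom_ext ?_ h1⟩⟩
    simpa [← Category.assoc, cancel_mono] using h2

/-- A code of A in L makes the subsets of its fibres subsets of L, so the power object in the slice
is coded in `Pow L`, and then in M through i. -/
theorem Codes.hasPowerObjectsFor {U' U V' V L M : E} {q : U' ⟶ U} {p : V' ⟶ V} (hq : Codes q L)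
    (hp : Codes p M) (i : Pow L ⟶ M) [Mono i] : HasPowerObjectsFor p q := by
  intro X A hA
  obtain ⟨k, hk⟩ := (hq _).1 hA
  obtain ⟨P, M, π, ε, s, h, hs⟩ := exists_powerObject_over A k hk
  exact ⟨P, M, π, ε, h, (hp _).2 ⟨s ≫ i, hs.comp_mono i⟩⟩

end Bounded

/-! ### A chain of square-closed objects -/

section Chain

variable {E : Type u} [Category.{v} E] [Topos E]

/-- A sequence of square-closed objects, starting with one that contains `A`, each containing the
power object of the preceding one. -/
noncomputable def chain (A : E) : ℕ → SquareClosed E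
  | 0 => squareClosure A
  | n + 1 => squareClosure (Pow (chain A n).obj)

noncomputable def powToChain (A : E) (n : ℕ) : Pow (chain A n).obj ⟶ (chain A (n + 1)).obj :=
  toSquareClosure _

instance (A : E) (n : ℕ) : Mono (powToChain A n) := mono_toSquareClosure _

noncomputable def toChain (A : E) : A ⟶ (chain A 0).obj := toSquareClosure A

instance (A : E) : Mono (toChain A) := mono_toSquareClosure A

/-- Consecutive terms are linked by singletons. Functoriality supplies the composition law for the
inclusions between arbitrary terms. -/
noncomputable def chainFunctor (A : E) : ℕ ⥤ E :=
  Functor.ofSequence (X := fun n => (chain A n).obj) fun n => singleton _ ≫ powToChain A n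

/-- The inclusions of the terms of the chain. -/
noncomputable def chainMap (A : E) {m n : ℕ} (h : m ≤ n) : (chain A m).obj ⟶ (chain A n).obj :=
  (chainFunctor A).map (homOfLE h)

theorem chainMap_comp (A : E) {l m n : ℕ} (h : l ≤ m) (h' : m ≤ n) :
    chainMap A h ≫ chainMap A h' = chainMap A (h.trans h') :=
  ((chainFunctor A).map_comp (homOfLE h) (homOfLE h')).symm

instance mono_chainMap (A : E) {m n : ℕ} (h : m ≤ n) : Mono (chainMap A h) := by
  induction n, h using Nat.le_induction with
  | base =>
    have : chainMap A (le_refl m) = 𝟙 _ := (chainFunctor A).map_id _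
    rw [this]
    infer_instance
  | succ n h ih =>
    rw [← chainMap_comp A h (Nat.le_succ n)]
    have : chainMap A (Nat.le_succ n) = singleton _ ≫ powToChain A n :=
      Functor.ofSequence_map_homOfLE_succ _ n
    rw [this]
    infer_instance

/-- The levels of the universe of subobjects of the `r`-th term of the chain. -/
noncomputable def chainLevel (A : E) {i r : ℕ} (h : i ≤ r) : Subobject (Pow (chain A r).obj) :=
  bounded (chainMap A h)

theorem chainLevel_mono (A : E) {i j r : ℕ} (h : i ≤ j) (hj : j ≤ r) :
    chainLevel A (h.trans hj) ≤ chainLevel A hj :=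
  bounded_le _ _ (chainMap A h) (chainMap_comp A h hj)

theorem exists_rUniverse (r : ℕ) {A B : E} (q : A ⟶ B) : ∃ 𝒰 : RUniverse E r,
    IsContained q 𝒰.q ∧ ∀ i, IsContained q (restrict 𝒰.q (𝒰.level i)) := by
  refine ⟨⟨_, _, elemPow (chain A r).obj, (codes_elemPow _).isSimpleUniverse,
    fun i => chainLevel A (Nat.le_of_lt_succ i.2), fun i j h => chainLevel_mono A h _,
    fun i => (codes_restrict _).isSimpleUniverse, fun i =>
      (codes_restrict _).hasPowerObjectsFor (codes_restrict _) (powToChain A i)⟩, ?_, fun i => ?_⟩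
  · exact (codes_elemPow _ _).2 ⟨toChain A ≫ chainMap A (Nat.zero_le r),
      jointlyMonic_of_mono_right _ _⟩
  · exact (codes_restrict _ _).2 ⟨toChain A ≫ chainMap A (Nat.zero_le i),
      jointlyMonic_of_mono_right _ _⟩

end Chain

/-! ### The internal category of subobjects of a fixed object -/

section Arrows

variable {E : Type u} [Category.{v} E] [Topos E]

/-- The total object of the family named by `A`. -/
noncomputable def El {X K : E} (A : X ⟶ Pow K) : E := pullback (elemPow K) A

noncomputable def elProj {X K : E} (A : X ⟶ Pow K) : El A ⟶ X := pullback.snd _ _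

noncomputable def elElem {X K : E} (A : X ⟶ Pow K) : El A ⟶ Elem K := pullback.fst _ _

theorem isPullback_el {X K : E} (A : X ⟶ Pow K) :
    IsPullback (elElem A) (elProj A) (elemPow K) A := IsPullback.of_hasPullback _ _

noncomputable def elCode {X K : E} (A : X ⟶ Pow K) : El A ⟶ K := elElem A ≫ elemArg K

theorem jointlyMonic_el {X K : E} (A : X ⟶ Pow K) : JointlyMonic (elProj A) (elCode A) :=
  jointlyMonic_of_isPullback_elem (isPullback_el A)

theorem isElem_iff_el {X K Z : E} (A : X ⟶ Pow K) (z : Z ⟶ X) (a : Z ⟶ K) :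
    IsElem a (z ≫ A) ↔ ∃ t : Z ⟶ El A, t ≫ elProj A = z ∧ t ≫ elCode A = a := by
  constructor
  · rintro ⟨m, h, rfl⟩
    exact ⟨(isPullback_el A).lift m z h, (isPullback_el A).lift_snd _ _ _, by
      rw [elCode, ← Category.assoc, (isPullback_el A).lift_fst]⟩
  · rintro ⟨t, rfl, rfl⟩
    exact ⟨t ≫ elElem A, by rw [Category.assoc, (isPullback_el A).w, Category.assoc],
      by rw [Category.assoc, elCode]⟩

theorem isElem_elCode {X K : E} (A : X ⟶ Pow K) : IsElem (elCode A) (elProj A ≫ A) :=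
  (isElem_iff_el _ _ _).2 ⟨𝟙 _, by simp, by simp⟩

/-- `G` is the graph of a map from the family named by `A` to the family named by `B`. -/
def IsGraph {X K : E} (A B : X ⟶ Pow K) (G : X ⟶ Pow (K ⨯ K)) : Prop :=
  (∀ (Z : E) (z : Z ⟶ X) (c : Z ⟶ K ⨯ K), IsElem c (z ≫ G) →
    IsElem (c ≫ prod.fst) (z ≫ A) ∧ IsElem (c ≫ prod.snd) (z ≫ B)) ∧
  ∀ (Z : E) (z : Z ⟶ X) (a : Z ⟶ K), IsElem a (z ≫ A) →
    ExistsUniqueAt (X := Pow (K ⨯ K) ⨯ K) (fun Z p (b : Z ⟶ K) =>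
      IsElem (prod.lift (p ≫ prod.snd) b) (p ≫ prod.fst)) (prod.lift (z ≫ G) a)

/-- Being a functional relation is expressed by membership, implication and unique existence alone,
hence is representable. -/
theorem exists_graphs (K : E) : ∃ (D : Σ M : E, (M ⟶ Pow K) × (M ⟶ Pow K) × (M ⟶ Pow (K ⨯ K))),
    (∀ (X : E) (f g : X ⟶ D.1), f ≫ D.2.1 = g ≫ D.2.1 → f ≫ D.2.2.1 = g ≫ D.2.2.1 →
      f ≫ D.2.2.2 = g ≫ D.2.2.2 → f = g) ∧
    ∀ (X : E) (A B : X ⟶ Pow K) (G : X ⟶ Pow (K ⨯ K)), IsGraph A B G ↔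
      ∃ f : X ⟶ D.1, f ≫ D.2.1 = A ∧ f ≫ D.2.2.1 = B ∧ f ≫ D.2.2.2 = G := by
  obtain ⟨M, m, hm, h⟩ : Rep (X := Pow K ⨯ (Pow K ⨯ Pow (K ⨯ K))) fun Z z =>
      IsGraph (z ≫ prod.fst) (z ≫ prod.snd ≫ prod.fst) (z ≫ prod.snd ≫ prod.snd) := by
    refine Rep.congr (Rep.and
      (rep_forall_imp (X := Pow K ⨯ (Pow K ⨯ Pow (K ⨯ K))) (K := K ⨯ K)
        (Φ := fun Z z c => IsElem c (z ≫ prod.snd ≫ prod.snd))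
        (Ψ := fun Z z c => IsElem (c ≫ prod.fst) (z ≫ prod.fst) ∧
          IsElem (c ≫ prod.snd) (z ≫ prod.snd ≫ prod.fst)) ?_ ?_)
      (rep_forall_imp (X := Pow K ⨯ (Pow K ⨯ Pow (K ⨯ K))) (K := K)
        (Φ := fun Z z a => IsElem a (z ≫ prod.fst))
        (Ψ := fun Z z a => ExistsUniqueAt (X := Pow (K ⨯ K) ⨯ K) (fun Z p (b : Z ⟶ K) =>
          IsElem (prod.lift (p ≫ prod.snd) b) (p ≫ prod.fst))
            (prod.lift (z ≫ prod.snd ≫ prod.snd) a)) ?_ ?_)) ?_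
    · exact (rep_isElem prod.snd (prod.fst ≫ prod.snd ≫ prod.snd)).congr (by simp)
    · exact ((rep_isElem (prod.snd ≫ prod.fst) (prod.fst ≫ prod.fst)).and
        (rep_isElem (prod.snd ≫ prod.snd) (prod.fst ≫ prod.snd ≫ prod.fst))).congr (by simp)
    · exact (rep_isElem prod.snd (prod.fst ≫ prod.fst)).congr (by simp)
    · exact ((rep_existsUnique (X := Pow (K ⨯ K) ⨯ K) (K := K)
        (Φ := fun Z p b => IsElem (prod.lift (p ≫ prod.snd) b) (p ≫ prod.fst))
        ((rep_isElem (prod.lift (prod.fst ≫ prod.snd) prod.snd) (prod.fst ≫ prod.fst)).congr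
          (by simp))).comp (prod.lift (prod.fst ≫ prod.snd ≫ prod.snd) prod.snd)).congr (by simp)
    · intro Z z
      simp [IsGraph]
  refine ⟨⟨M, m ≫ prod.fst, m ≫ prod.snd ≫ prod.fst, m ≫ prod.snd ≫ prod.snd⟩,
    fun X f g h1 h2 h3 => ?_, fun X A B G => ?_⟩
  · rw [← cancel_mono m]
    ext
    · simpa using h1
    · simpa using h2
    · simpa using h3
  · have := h X (prod.lift A (prod.lift B G))
    simp only [prod.lift_fst, prod.lift_snd_assoc, prod.lift_snd] at this
    rw [this]
    refine exists_congr fun f => ⟨fun hf => ?_, fun hf => ?_⟩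
    · simp [reassoc_of% hf]
    · obtain ⟨rfl, rfl, rfl⟩ := hf
      ext <;> simp

/-- The object of maps between subobjects of `K`. -/
noncomputable def Arr (K : E) : E := (exists_graphs K).choose.1

noncomputable def arrSrc (K : E) : Arr K ⟶ Pow K := (exists_graphs K).choose.2.1

noncomputable def arrTgt (K : E) : Arr K ⟶ Pow K := (exists_graphs K).choose.2.2.1

noncomputable def arrGraph (K : E) : Arr K ⟶ Pow (K ⨯ K) := (exists_graphs K).choose.2.2.2

theorem isGraph_iff {X K : E} (A B : X ⟶ Pow K) (G : X ⟶ Pow (K ⨯ K)) : IsGraph A B G ↔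
    ∃ f : X ⟶ Arr K, f ≫ arrSrc K = A ∧ f ≫ arrTgt K = B ∧ f ≫ arrGraph K = G :=
  (exists_graphs K).choose_spec.2 X A B G

/-- The generalised map `f` sends `a` to `b`. -/
def App {X K : E} (f : X ⟶ Arr K) (a b : X ⟶ K) : Prop := IsElem (prod.lift a b) (f ≫ arrGraph K)

variable {X Z K : E} {f : X ⟶ Arr K} {a b b' : X ⟶ K}

theorem App.comp (h : App f a b) (w : Z ⟶ X) : App (w ≫ f) (w ≫ a) (w ≫ b) := by
  have := IsElem.comp h w
  rwa [prod.comp_lift, ← Category.assoc] at this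

theorem isGraph_arr (f : X ⟶ Arr K) : IsGraph (f ≫ arrSrc K) (f ≫ arrTgt K) (f ≫ arrGraph K) :=
  (isGraph_iff _ _ _).2 ⟨f, rfl, rfl, rfl⟩

theorem App.mem (h : App f a b) : IsElem a (f ≫ arrSrc K) ∧ IsElem b (f ≫ arrTgt K) := by
  simpa using (isGraph_arr f).1 X (𝟙 X) (prod.lift a b) (by simpa [App] using h)

theorem App.exists (h : IsElem a (f ≫ arrSrc K)) : ∃ b, App f a b := by
  obtain ⟨b, hb, -⟩ := (isGraph_arr f).2 X (𝟙 X) a (by simpa using h)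
  exact ⟨b, by simpa [App] using hb⟩

theorem App.unique (h : App f a b) (h' : App f a b') : b = b' := by
  obtain ⟨c, -, hc⟩ := (isGraph_arr f).2 X (𝟙 X) a (by simpa using h.mem.1)
  rw [hc X (𝟙 X) b (by simpa [App] using h), hc X (𝟙 X) b' (by simpa [App] using h')]

/-- One inclusion of graphs suffices, since both are total and single-valued on the same source. -/
theorem arr_ext {f g : X ⟶ Arr K} (h1 : f ≫ arrSrc K = g ≫ arrSrc K)
    (h2 : f ≫ arrTgt K = g ≫ arrTgt K)
    (h3 : ∀ (Z : E) (z : Z ⟶ X) (a b : Z ⟶ K), App (z ≫ f) a b → App (z ≫ g) a b) : f = g := by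
  refine (exists_graphs K).choose_spec.1 X f g h1 h2 (pow_ext fun Z z c => ?_)
  have key (f : X ⟶ Arr K) : IsElem c (z ≫ f ≫ arrGraph K) ↔
      App (z ≫ f) (c ≫ prod.fst) (c ≫ prod.snd) := by
    rw [App, Category.assoc, ← prod.comp_lift, prod.lift_fst_snd, Category.comp_id]
  refine (key f).trans (Iff.trans ⟨h3 _ _ _ _, fun h => ?_⟩ (key g).symm)
  obtain ⟨b, hb⟩ := App.exists (f := z ≫ f) (a := c ≫ prod.fst) (by
    rw [Category.assoc, h1, ← Category.assoc]
    exact h.mem.1)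
  rwa [h.unique (h3 _ _ _ _ hb)]

/-- A predicate that defines a map from the family named by `A` to the family named by `B`. -/
structure IsMap (A B : X ⟶ Pow K) (Φ : ∀ Z : E, (Z ⟶ X) → (Z ⟶ K) → (Z ⟶ K) → Prop) : Prop where
  stable : ∀ {Z Z' : E} (w : Z' ⟶ Z) (z : Z ⟶ X) (a b : Z ⟶ K), Φ Z z a b →
    Φ Z' (w ≫ z) (w ≫ a) (w ≫ b)
  mem : ∀ {Z : E} (z : Z ⟶ X) (a b : Z ⟶ K), Φ Z z a b → IsElem a (z ≫ A) ∧ IsElem b (z ≫ B)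
  total : ∀ {Z : E} (z : Z ⟶ X) (a : Z ⟶ K), IsElem a (z ≫ A) → ∃ b, Φ Z z a b
  unique : ∀ {Z : E} (z : Z ⟶ X) (a b b' : Z ⟶ K), Φ Z z a b → Φ Z z a b' → b = b'

/-- It is enough to evaluate Φ at the generic element of A. By stability the resulting value
determines one at every element, and by uniqueness the graph so obtained is Φ itself. -/
theorem IsMap.exists_arr {A B : X ⟶ Pow K} {Φ : ∀ Z : E, (Z ⟶ X) → (Z ⟶ K) → (Z ⟶ K) → Prop}
    (h : IsMap A B Φ) : ∃ f : X ⟶ Arr K, f ≫ arrSrc K = A ∧ f ≫ arrTgt K = B ∧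
      ∀ (Z : E) (z : Z ⟶ X) (a b : Z ⟶ K), App (z ≫ f) a b ↔ Φ Z z a b := by
  obtain ⟨b, hb⟩ := h.total _ _ (isElem_elCode A)
  have hj : JointlyMonic (elProj A) (prod.lift (elCode A) b) := fun Z s t h1 h2 =>
    jointlyMonic_el A s t h1 (by simpa using congrArg (· ≫ prod.fst) h2)
  have hG (Z : E) (z : Z ⟶ X) (c : Z ⟶ K ⨯ K) : IsElem c (z ≫ nameOf _ _ hj) ↔
      Φ Z z (c ≫ prod.fst) (c ≫ prod.snd) := by
    rw [isElem_nameOf]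
    constructor
    · rintro ⟨r, rfl, rfl⟩
      simpa using h.stable r _ _ _ hb
    · intro hc
      obtain ⟨t, h1, h2⟩ := (isElem_iff_el _ _ _).1 (h.mem _ _ _ hc).1
      refine ⟨t, h1, ?_⟩
      have := h.stable t _ _ _ hb
      rw [h1, h2] at this
      ext
      · simp [h2]
      · simp [h.unique _ _ _ _ hc this]
  obtain ⟨f, h1, h2, h3⟩ := (isGraph_iff A B (nameOf _ _ hj)).1
    ⟨fun Z z c hc => h.mem _ _ _ ((hG _ _ _).1 hc), fun Z z a ha => by
      obtain ⟨b', hb'⟩ := h.total z a ha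
      refine ⟨b', ?_, fun Z' w k hk => ?_⟩
      · dsimp only
        rw [prod.lift_fst, prod.lift_snd, hG]
        simpa using hb'
      · dsimp only at hk
        rw [prod.comp_lift, prod.lift_fst, prod.lift_snd, ← Category.assoc, hG] at hk
        simp only [prod.lift_fst, prod.lift_snd] at hk
        exact h.unique _ _ _ _ hk (h.stable w _ _ _ hb')⟩
  refine ⟨f, h1, h2, fun Z z a b => ?_⟩
  rw [App, Category.assoc, h3, hG]
  simp

/-- The map defined by a predicate. -/
noncomputable def IsMap.arr {A B : X ⟶ Pow K}
    {Φ : ∀ Z : E, (Z ⟶ X) → (Z ⟶ K) → (Z ⟶ K) → Prop} (h : IsMap A B Φ) : X ⟶ Arr K :=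
  h.exists_arr.choose

section

variable {A B : X ⟶ Pow K} {Φ : ∀ Z : E, (Z ⟶ X) → (Z ⟶ K) → (Z ⟶ K) → Prop} (h : IsMap A B Φ)

theorem IsMap.arr_src : h.arr ≫ arrSrc K = A := h.exists_arr.choose_spec.1

theorem IsMap.arr_tgt : h.arr ≫ arrTgt K = B := h.exists_arr.choose_spec.2.1

theorem IsMap.app_arr (z : Z ⟶ X) (a b : Z ⟶ K) : App (z ≫ h.arr) a b ↔ Φ Z z a b :=
  h.exists_arr.choose_spec.2.2 Z z a b

end

variable (K) in
theorem isMap_id : IsMap (𝟙 (Pow K)) (𝟙 (Pow K)) (fun _ z a b => IsElem a z ∧ a = b) where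
  stable w z a b h := ⟨h.1.comp w, by rw [h.2]⟩
  mem z a b h := by
    obtain ⟨h, rfl⟩ := h
    simpa using h
  total z a h := ⟨a, by simpa using h, rfl⟩
  unique z a b b' h h' := h.2.symm.trans h'.2

variable (K) in
theorem isMap_comp : IsMap (pullback.fst (arrTgt K) (arrSrc K) ≫ arrSrc K)
    (pullback.snd (arrTgt K) (arrSrc K) ≫ arrTgt K) (fun _ z a c => ∃ b,
      App (z ≫ pullback.fst (arrTgt K) (arrSrc K)) a b ∧
      App (z ≫ pullback.snd (arrTgt K) (arrSrc K)) b c) where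
  stable w z a c := fun ⟨b, h1, h2⟩ => ⟨w ≫ b, by simpa using h1.comp w, by simpa using h2.comp w⟩
  mem z a c := fun ⟨b, h1, h2⟩ => ⟨by simpa using h1.mem.1, by simpa using h2.mem.2⟩
  total z a h := by
    obtain ⟨b, hb⟩ := App.exists (f := z ≫ pullback.fst (arrTgt K) (arrSrc K)) (by simpa using h)
    obtain ⟨c, hc⟩ := App.exists (f := z ≫ pullback.snd (arrTgt K) (arrSrc K)) (a := b) (by
      rw [Category.assoc, ← pullback.condition, ← Category.assoc]
      exact hb.mem.2)
    exact ⟨c, b, hb, hc⟩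
  unique z a c c' := by
    rintro ⟨b, h1, h2⟩ ⟨b', h1', h2'⟩
    obtain rfl := h1.unique h1'
    exact h2.unique h2'

variable (K) in
theorem app_idn (z : X ⟶ Pow K) : App (z ≫ (isMap_id K).arr) a b ↔ IsElem a z ∧ a = b :=
  (isMap_id K).app_arr z a b

theorem app_comp' {f g : X ⟶ Arr K} (h : f ≫ arrTgt K = g ≫ arrSrc K) (z : Z ⟶ X) {a c : Z ⟶ K} :
    App (z ≫ pullback.lift f g h ≫ (isMap_comp K).arr) a c ↔
      ∃ b, App (z ≫ f) a b ∧ App (z ≫ g) b c := by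
  rw [← Category.assoc, (isMap_comp K).app_arr]
  simp

variable (K) in
/-- The full internal subcategory on the universe of subobjects of `K`. -/
noncomputable abbrev univCat : InternalCategory E where
  ob := Pow K
  mor := Arr K
  src := arrSrc K
  tgt := arrTgt K
  idn := (isMap_id K).arr
  comp := (isMap_comp K).arr
  idn_src := (isMap_id K).arr_src
  idn_tgt := (isMap_id K).arr_tgt
  comp_src := (isMap_comp K).arr_src
  comp_tgt := (isMap_comp K).arr_tgt
  id_comp f h := by
    refine arr_ext ?_ ?_ fun Z z a b hab => ?_
    · rw [Category.assoc, (isMap_comp K).arr_src, pullback.lift_fst_assoc, Category.assoc,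
        Category.assoc, (isMap_id K).arr_src, Category.comp_id]
    · rw [Category.assoc, (isMap_comp K).arr_tgt, pullback.lift_snd_assoc]
    · rw [app_comp'] at hab
      obtain ⟨c, h1, h2⟩ := hab
      rw [← Category.assoc, ← Category.assoc, app_idn] at h1
      rwa [h1.2]
  comp_id f h := by
    refine arr_ext ?_ ?_ fun Z z a b hab => ?_
    · rw [Category.assoc, (isMap_comp K).arr_src, pullback.lift_fst_assoc]
    · rw [Category.assoc, (isMap_comp K).arr_tgt, pullback.lift_snd_assoc, Category.assoc,
        Category.assoc, (isMap_id K).arr_tgt, Category.comp_id]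
    · rw [app_comp'] at hab
      obtain ⟨c, h1, h2⟩ := hab
      rw [← Category.assoc, ← Category.assoc, app_idn] at h2
      rwa [← h2.2]
  assoc f g k h₁ h₂ h₃ h₄ := by
    refine arr_ext ?_ ?_ fun Z z a b hab => ?_
    · simp only [Category.assoc, (isMap_comp K).arr_src, pullback.lift_fst_assoc]
    · simp only [Category.assoc, (isMap_comp K).arr_tgt, pullback.lift_snd_assoc]
    · rw [app_comp'] at hab ⊢
      obtain ⟨c, h1, h2⟩ := hab
      rw [app_comp'] at h1
      obtain ⟨d, h3, h4⟩ := h1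
      exact ⟨d, h3, (app_comp' _ _).2 ⟨c, h4, h2⟩⟩

end Arrows

/-! ### The externalisation as a full indexed subcategory -/

section Externalisation

variable {E : Type u} [Category.{v} E] [Topos E] {K X Y Z : E}

/-- The map that names an object of the externalisation. -/
def nm (A : (univCat K).Fib X) : X ⟶ Pow K := A.name

/-- The object of the externalisation named by a map. -/
def ofName (A : X ⟶ Pow K) : (univCat K).Fib X := ⟨A⟩

theorem nm_ofName (A : X ⟶ Pow K) : nm (ofName A) = A := rfl

/-- The map that names an arrow of the externalisation. -/
def ar {A B : (univCat K).Fib X} (f : A ⟶ B) : X ⟶ Arr K := f.1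

theorem nm_reindex (h : Y ⟶ X) (A : (univCat K).Fib X) :
    nm (((univCat K).reindex h).obj A) = h ≫ nm A := rfl

variable {A B D : (univCat K).Fib X}

theorem ar_reindex (h : Y ⟶ X) (f : A ⟶ B) : ar (((univCat K).reindex h).map f) = h ≫ ar f := rfl

theorem ar_src (f : A ⟶ B) : ar f ≫ arrSrc K = nm A := f.2.1

theorem ar_tgt (f : A ⟶ B) : ar f ≫ arrTgt K = nm B := f.2.2

theorem mem_src {f : A ⟶ B} {z : Z ⟶ X} {a b : Z ⟶ K} (h : App (z ≫ ar f) a b) :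
    IsElem a (z ≫ nm A) := by
  rw [← ar_src f, ← Category.assoc]
  exact h.mem.1

theorem mem_tgt {f : A ⟶ B} {z : Z ⟶ X} {a b : Z ⟶ K} (h : App (z ≫ ar f) a b) :
    IsElem b (z ≫ nm B) := by
  rw [← ar_tgt f, ← Category.assoc]
  exact h.mem.2

theorem exists_app (f : A ⟶ B) {z : Z ⟶ X} {a : Z ⟶ K} (h : IsElem a (z ≫ nm A)) :
    ∃ b, App (z ≫ ar f) a b :=
  App.exists (by rwa [Category.assoc, ar_src])

theorem fib_hom_ext {f g : A ⟶ B}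
    (h : ∀ (Z : E) (z : Z ⟶ X) (a b : Z ⟶ K), App (z ≫ ar f) a b → App (z ≫ ar g) a b) : f = g :=
  Subtype.ext (arr_ext ((ar_src f).trans (ar_src g).symm) ((ar_tgt f).trans (ar_tgt g).symm) h)

theorem app_fib_comp (f : A ⟶ B) (g : B ⟶ D) {z : Z ⟶ X} {a c : Z ⟶ K} :
    App (z ≫ ar (f ≫ g)) a c ↔ ∃ b, App (z ≫ ar f) a b ∧ App (z ≫ ar g) b c :=
  app_comp' _ _

theorem app_fib_id {z : Z ⟶ X} {a b : Z ⟶ K} :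
    App (z ≫ ar (𝟙 A)) a b ↔ IsElem a (z ≫ nm A) ∧ a = b := by
  rw [← app_idn, Category.assoc]
  rfl

/-- The arrow of the externalisation defined by a predicate. -/
noncomputable def IsMap.hom {Φ : ∀ Z : E, (Z ⟶ X) → (Z ⟶ K) → (Z ⟶ K) → Prop}
    (h : IsMap (nm A) (nm B) Φ) : A ⟶ B :=
  ⟨h.arr, h.arr_src, h.arr_tgt⟩

theorem IsMap.app_hom {Φ : ∀ Z : E, (Z ⟶ X) → (Z ⟶ K) → (Z ⟶ K) → Prop}
    (h : IsMap (nm A) (nm B) Φ) (z : Z ⟶ X) (a b : Z ⟶ K) :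
    App (z ≫ ar h.hom) a b ↔ Φ Z z a b :=
  h.app_arr z a b

theorem exists_elMap (f : A ⟶ B) : ∃ t : El (nm A) ⟶ El (nm B), t ≫ elProj (nm B) = elProj (nm A) ∧
    App (elProj (nm A) ≫ ar f) (elCode (nm A)) (t ≫ elCode (nm B)) := by
  obtain ⟨b, hb⟩ := exists_app f (isElem_elCode (nm A))
  obtain ⟨t, h1, rfl⟩ := (isElem_iff_el _ _ _).1 (mem_tgt hb)
  exact ⟨t, h1, hb⟩

/-- The action of an arrow on total objects. -/
noncomputable def elMap (f : A ⟶ B) : El (nm A) ⟶ El (nm B) := (exists_elMap f).choose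

theorem elMap_proj (f : A ⟶ B) : elMap f ≫ elProj (nm B) = elProj (nm A) :=
  (exists_elMap f).choose_spec.1

theorem elMap_proj_assoc (f : A ⟶ B) (z : X ⟶ Z) :
    elMap f ≫ elProj (nm B) ≫ z = elProj (nm A) ≫ z := by
  rw [← Category.assoc, elMap_proj]

theorem app_elMap (f : A ⟶ B) :
    App (elProj (nm A) ≫ ar f) (elCode (nm A)) (elMap f ≫ elCode (nm B)) :=
  (exists_elMap f).choose_spec.2

theorem app_iff_elMap (f : A ⟶ B) (z : Z ⟶ X) (a b : Z ⟶ K) : App (z ≫ ar f) a b ↔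
    ∃ t : Z ⟶ El (nm A), t ≫ elProj (nm A) = z ∧ t ≫ elCode (nm A) = a ∧
      t ≫ elMap f ≫ elCode (nm B) = b := by
  constructor
  · intro h
    obtain ⟨t, rfl, rfl⟩ := (isElem_iff_el _ _ _).1 (mem_src h)
    refine ⟨t, rfl, rfl, ?_⟩
    have := (app_elMap f).comp t
    rw [← Category.assoc] at this
    exact this.unique h
  · rintro ⟨t, rfl, rfl, rfl⟩
    have := (app_elMap f).comp t
    rwa [← Category.assoc] at this

/-- The elementwise description of `elMap`. -/
theorem app_comp_elMap (f : A ⟶ B) (t : Z ⟶ El (nm A)) :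
    App ((t ≫ elProj (nm A)) ≫ ar f) (t ≫ elCode (nm A)) (t ≫ elMap f ≫ elCode (nm B)) :=
  (app_iff_elMap f _ _ _).2 ⟨t, rfl, rfl, rfl⟩

variable (K X) in
/-- The inclusion of a fibre of the externalisation into the corresponding slice. -/
noncomputable def inclFib : (univCat K).Fib X ⥤ Over X where
  obj A := Over.mk (elProj (nm A))
  map f := Over.homMk (elMap f) (elMap_proj f)
  map_id A := by
    refine Over.OverMorphism.ext (jointlyMonic_el (nm A) _ _ ?_ ?_)
    · exact (elMap_proj _).trans (Category.id_comp _).symm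
    · exact ((app_fib_id.1 (app_elMap (𝟙 A))).2).symm.trans (Category.id_comp _).symm
  map_comp {A B D} f g := by
    refine Over.OverMorphism.ext (jointlyMonic_el (nm D) _ _ ?_ ?_)
    · change elMap (f ≫ g) ≫ elProj _ = (elMap f ≫ elMap g) ≫ elProj _
      rw [elMap_proj, Category.assoc, elMap_proj, elMap_proj]
    · change elMap (f ≫ g) ≫ elCode _ = (elMap f ≫ elMap g) ≫ elCode _
      obtain ⟨b, h1, h2⟩ := (app_fib_comp f g).1 (app_elMap (f ≫ g))
      obtain rfl := (app_elMap f).unique h1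
      have h3 := app_comp_elMap g (elMap f)
      rw [elMap_proj] at h3
      rw [Category.assoc]
      exact h2.unique h3

/-- A map v over X between total objects yields the predicate "a is the code of some t, and b is the
code of its image under v". This is single-valued because codes determine elements within a fibre.
-/
instance full_inclFib : (inclFib K X).Full where
  map_surjective {A B} u := by
    obtain ⟨v, hv⟩ : ∃ v : El (nm A) ⟶ El (nm B), v = u.left := ⟨_, rfl⟩
    have hu : v ≫ elProj (nm B) = elProj (nm A) := hv ▸ Over.w u
    have h : IsMap (nm A) (nm B) (fun Z z a b => ∃ t : Z ⟶ El (nm A), t ≫ elProj (nm A) = z ∧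
        t ≫ elCode (nm A) = a ∧ t ≫ v ≫ elCode (nm B) = b) :=
      { stable := by
          rintro Z Z' w z a b ⟨t, rfl, rfl, rfl⟩
          exact ⟨w ≫ t, by simp, by simp, by simp⟩
        mem := by
          rintro Z z a b ⟨t, rfl, rfl, rfl⟩
          exact ⟨(isElem_iff_el _ _ _).2 ⟨t, rfl, rfl⟩,
            (isElem_iff_el _ _ _).2 ⟨t ≫ v, by rw [Category.assoc, hu], by simp⟩⟩
        total := by
          intro Z z a ha
          obtain ⟨t, rfl, rfl⟩ := (isElem_iff_el _ _ _).1 ha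
          exact ⟨_, t, rfl, rfl, rfl⟩
        unique := by
          rintro Z z a b b' ⟨t, rfl, rfl, rfl⟩ ⟨t', h1, h2, rfl⟩
          rw [jointlyMonic_el _ _ _ h1 h2] }
    refine ⟨h.hom, Over.OverMorphism.ext (Eq.trans (jointlyMonic_el (nm B) (elMap h.hom) v ?_ ?_)
      hv)⟩
    · exact (elMap_proj _).trans hu.symm
    · obtain ⟨t, h1, h2, h3⟩ := (h.app_hom _ _ _).1 (app_elMap h.hom)
      obtain rfl := jointlyMonic_el _ t (𝟙 _) (by simpa using h1) (by simpa using h2)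
      exact h3.symm.trans (Category.id_comp _)

instance faithful_inclFib : (inclFib K X).Faithful where
  map_injective {A B} f g h := by
    have h' : elMap f = elMap g := congrArg CommaMorphism.left h
    refine fib_hom_ext fun Z z a b hab => ?_
    rw [app_iff_elMap] at hab ⊢
    rwa [← h']

/-- A reindexed family has the same codes as the original. The cartesian map is the one that
preserves codes, and the coherence laws can therefore be checked on codes and projections. -/
theorem exists_elCart (h : Y ⟶ X) (A : (univCat K).Fib X) :
    ∃ t : El (nm (((univCat K).reindex h).obj A)) ⟶ El (nm A),
      t ≫ elProj (nm A) = elProj (nm (((univCat K).reindex h).obj A)) ≫ h ∧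
      t ≫ elCode (nm A) = elCode (nm (((univCat K).reindex h).obj A)) := by
  refine (isElem_iff_el _ _ _).1 ?_
  rw [Category.assoc, ← nm_reindex]
  exact isElem_elCode _

/-- The cartesian maps between total objects. -/
noncomputable def elCart (h : Y ⟶ X) (A : (univCat K).Fib X) :
    El (nm (((univCat K).reindex h).obj A)) ⟶ El (nm A) := (exists_elCart h A).choose

theorem elCart_proj (h : Y ⟶ X) (A : (univCat K).Fib X) :
    elCart h A ≫ elProj (nm A) = elProj (nm (((univCat K).reindex h).obj A)) ≫ h :=
  (exists_elCart h A).choose_spec.1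

theorem elCart_code (h : Y ⟶ X) (A : (univCat K).Fib X) :
    elCart h A ≫ elCode (nm A) = elCode (nm (((univCat K).reindex h).obj A)) :=
  (exists_elCart h A).choose_spec.2

theorem isPullback_elCart (h : Y ⟶ X) (A : (univCat K).Fib X) :
    IsPullback (elCart h A) (elProj (nm (((univCat K).reindex h).obj A))) (elProj (nm A)) h := by
  refine JointlyMonic.isPullback (fun Z u v h1 h2 => jointlyMonic_el _ _ _ h2 ?_)
    (elCart_proj h A) fun Z x y e => ?_
  · rw [← elCart_code, reassoc_of% h1]
  · obtain ⟨t, rfl, ht⟩ := (isElem_iff_el (nm (((univCat K).reindex h).obj A)) y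
      (x ≫ elCode (nm A))).1 (by
        rw [nm_reindex, ← Category.assoc, isElem_iff_el]
        exact ⟨x, e, rfl⟩)
    refine ⟨t, jointlyMonic_el (nm A) _ _ ?_ ?_, rfl⟩
    · rw [e, Category.assoc, elCart_proj, Category.assoc]
    · rw [Category.assoc, elCart_code, ht]

theorem elMap_eqToHom_code (e : A = B) : elMap (eqToHom e) ≫ elCode (nm B) = elCode (nm A) := by
  subst e
  exact ((app_fib_id.1 (app_elMap (𝟙 A))).2).symm

variable (K) in
/-- The inclusion of the externalisation into the self-indexing. -/
noncomputable def inclIndexed : IndexedFunctorToSelf (univCat K) where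
  fib X := inclFib K X
  cart h A := elCart h A
  cart_isPullback h A := isPullback_elCart h A
  cart_naturality {X Y} h A B f := by
    change elMap (((univCat K).reindex h).map f) ≫ elCart h B = elCart h A ≫ elMap f
    refine jointlyMonic_el (nm B) _ _ ?_ ?_
    · rw [Category.assoc, Category.assoc, elCart_proj, elMap_proj, elCart_proj, elMap_proj_assoc]
    · rw [Category.assoc, Category.assoc, elCart_code]
      have h1 := app_elMap (((univCat K).reindex h).map f)
      have h2 := app_comp_elMap f (elCart h A)
      rw [elCart_proj, elCart_code, Category.assoc] at h2
      exact h1.unique h2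
  cart_id {X} A := by
    change elCart (𝟙 X) A = elMap (eqToHom _)
    refine jointlyMonic_el (nm A) _ _ ?_ ?_
    · rw [elCart_proj, elMap_proj]
      exact Category.comp_id _
    · rw [elCart_code, elMap_eqToHom_code]
  cart_comp {X Y Z} k h A := by
    change elCart (k ≫ h) A = elMap (eqToHom _) ≫ elCart k (((univCat K).reindex h).obj A) ≫
      elCart h A
    refine jointlyMonic_el (nm A) _ _ ?_ ?_
    · rw [elCart_proj, Category.assoc, Category.assoc, elCart_proj, reassoc_of% elCart_proj k,
        elMap_proj_assoc]
    · rw [elCart_code, Category.assoc, Category.assoc, elCart_code, elCart_code,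
        elMap_eqToHom_code]

end Externalisation

/-! ### Names of coded families -/

section Coded

variable {E : Type u} [Category.{v} E] [Topos E] {K X Y Z : E} {A B D : (univCat K).Fib X}

/-- This produces the chosen objects of the internal structure. Their elements are the codes of
solutions of a predicate, so they are strictly stable under reindexing whenever the predicate is. -/
theorem exists_coded {Q : E} {Ψ : ∀ Z : E, (Z ⟶ X) → (Z ⟶ Q) → Prop}
    (h : Rep (fun Z (z : Z ⟶ X ⨯ Q) => Ψ Z (z ≫ prod.fst) (z ≫ prod.snd))) (c : Q ⟶ K) [Mono c] :
    ∃ A : (univCat K).Fib X, ∀ (Z : E) (z : Z ⟶ X) (k : Z ⟶ K),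
      IsElem k (z ≫ nm A) ↔ ∃ t : Z ⟶ Q, Ψ Z z t ∧ t ≫ c = k := by
  obtain ⟨χ, hχ⟩ := exists_comprehension h
  refine ⟨ofName (nameOf (elProj χ) (elCode χ ≫ c) ((jointlyMonic_el χ).comp_mono c)),
    fun Z z k => ?_⟩
  rw [nm_ofName, isElem_nameOf]
  constructor
  · rintro ⟨r, rfl, rfl⟩
    exact ⟨r ≫ elCode χ, (hχ _ _ _).1 ((isElem_iff_el _ _ _).2 ⟨r, rfl, rfl⟩), by simp⟩
  · rintro ⟨t, ht, rfl⟩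
    obtain ⟨r, h1, h2⟩ := (isElem_iff_el _ _ _).1 ((hχ _ _ _).2 ht)
    exact ⟨r, h1, by rw [reassoc_of% h2]⟩

/-- The object of the externalisation with elements the codes of the solutions of `Ψ`. -/
noncomputable def coded {Q : E} {Ψ : ∀ Z : E, (Z ⟶ X) → (Z ⟶ Q) → Prop}
    (h : Rep (fun Z (z : Z ⟶ X ⨯ Q) => Ψ Z (z ≫ prod.fst) (z ≫ prod.snd))) (c : Q ⟶ K) [Mono c] :
    (univCat K).Fib X := (exists_coded h c).choose

theorem isElem_coded {Q : E} {Ψ : ∀ Z : E, (Z ⟶ X) → (Z ⟶ Q) → Prop}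
    (h : Rep (fun Z (z : Z ⟶ X ⨯ Q) => Ψ Z (z ≫ prod.fst) (z ≫ prod.snd))) (c : Q ⟶ K) [Mono c]
    (z : Z ⟶ X) (k : Z ⟶ K) :
    IsElem k (z ≫ nm (coded h c)) ↔ ∃ t : Z ⟶ Q, Ψ Z z t ∧ t ≫ c = k :=
  (exists_coded h c).choose_spec Z z k

theorem boundedBy_coded {Q L : E} {Ψ : ∀ Z : E, (Z ⟶ X) → (Z ⟶ Q) → Prop}
    (h : Rep (fun Z (z : Z ⟶ X ⨯ Q) => Ψ Z (z ≫ prod.fst) (z ≫ prod.snd))) (c : Q ⟶ K) [Mono c]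
    (j : L ⟶ K) (c' : Q ⟶ L) (hc : c' ≫ j = c) : BoundedBy j (nm (coded h c)) := by
  intro Z z k hk
  obtain ⟨t, -, rfl⟩ := (isElem_coded h c z k).1 hk
  exact ⟨t ≫ c', by simp [hc]⟩

theorem fib_ext {A A' : (univCat K).Fib X}
    (h : ∀ (Z : E) (z : Z ⟶ X) (k : Z ⟶ K), IsElem k (z ≫ nm A) ↔ IsElem k (z ≫ nm A')) : A = A' :=
  Fib.ext (pow_ext h)

/-- Maps given by the same predicate are compatible with reindexing. -/
theorem reindex_map_eq (h : Y ⟶ X) {A' B' : (univCat K).Fib Y} {f : A ⟶ B} {f' : A' ⟶ B'}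
    (hA : ((univCat K).reindex h).obj A = A') (hB : ((univCat K).reindex h).obj B = B')
    (hf : ∀ (Z : E) (z : Z ⟶ Y) (a b : Z ⟶ K), App ((z ≫ h) ≫ ar f) a b → App (z ≫ ar f') a b) :
    (((univCat K).reindex h).map f).1 = f'.1 := by
  subst hA hB
  refine congrArg Subtype.val (fib_hom_ext fun Z z a b hab => hf Z z a b ?_)
  rw [ar_reindex, ← Category.assoc] at hab
  exact hab

/-! ### Finite limits of the fibres -/

theorem exists_iso_of_isElem_iff (A : (univCat K).Fib X) (Y : Over X) (k : Y.left ⟶ K)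
    (hk : JointlyMonic Y.hom k) (h : ∀ (Z : E) (z : Z ⟶ X) (a : Z ⟶ K), IsElem a (z ≫ nm A) ↔
      ∃ y : Z ⟶ Y.left, y ≫ Y.hom = z ∧ y ≫ k = a) :
    ∃ e : (inclFib K X).obj A ≅ Y, e.hom.left ≫ k = elCode (nm A) := by
  obtain ⟨t, ht1, ht2⟩ := (h _ _ _).1 (isElem_elCode (nm A))
  obtain ⟨s, hs1, hs2⟩ := (isElem_iff_el (nm A) Y.hom k).1
    ((h _ _ _).2 ⟨𝟙 _, by simp, by simp⟩)
  let e : El (nm A) ≅ Y.left :=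
    ⟨t, s, jointlyMonic_el _ _ _ (by rw [Category.assoc, hs1, ht1, Category.id_comp])
      (by rw [Category.assoc, hs2, ht2, Category.id_comp]),
      hk _ _ (by rw [Category.assoc, ht1, hs1, Category.id_comp])
      (by rw [Category.assoc, ht2, hs2, Category.id_comp])⟩
  exact ⟨Over.isoMk e ht1, ht2⟩

theorem exists_iso_ofName_nameOf (Y : Over X) (k : Y.left ⟶ K) (hk : JointlyMonic Y.hom k) :
    Nonempty ((inclFib K X).obj (ofName (nameOf Y.hom k hk)) ≅ Y) :=
  ⟨(exists_iso_of_isElem_iff (ofName (nameOf Y.hom k hk)) Y k hk fun _ z a =>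
    isElem_nameOf hk z a).choose⟩

theorem exists_iso_inclFib (Y : Over X) (k : Y.left ⟶ K) (hk : JointlyMonic Y.hom k) :
    ∃ A : (univCat K).Fib X, Nonempty ((inclFib K X).obj A ≅ Y) :=
  ⟨_, exists_iso_ofName_nameOf Y k hk⟩

end Coded

section FiniteLimits

variable {E : Type u} [Category.{v} E] [Topos E] (L : SquareClosed E) (X : E)

/-- The pullback formed in the slice embeds fibrewise in L by pairing the codes of its two outer
legs, so it is isomorphic to an object of the fibre; full faithfulness then creates the limit. -/
noncomputable instance : CreatesLimitsOfShape WalkingCospan (inclFib L.obj X) where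
  CreatesLimit {F} := by
    have h : ∃ A : (univCat L.obj).Fib X,
        Nonempty ((inclFib L.obj X).obj A ≅ limit (F ⋙ inclFib L.obj X)) := by
      refine exists_iso_inclFib _ (prod.lift
        ((limit.π (F ⋙ inclFib L.obj X) WalkingCospan.left).left ≫
          elCode (nm (F.obj WalkingCospan.left)))
        ((limit.π (F ⋙ inclFib L.obj X) WalkingCospan.right).left ≫
          elCode (nm (F.obj WalkingCospan.right))) ≫ L.pair) (JointlyMonic.comp_mono ?_ _)
      intro Z u v h1 h2
      have h3 := congrArg (· ≫ prod.fst) h2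
      have h4 := congrArg (· ≫ prod.snd) h2
      simp only [prod.comp_lift, prod.lift_fst, prod.lift_snd] at h3 h4
      have hw (j : WalkingCospan) : (u ≫ (limit.π (F ⋙ inclFib L.obj X) j).left) ≫
          elProj (nm (F.obj j)) = (v ≫ (limit.π (F ⋙ inclFib L.obj X) j).left) ≫
          elProj (nm (F.obj j)) := by
        have e : (limit.π (F ⋙ inclFib L.obj X) j).left ≫ elProj (nm (F.obj j)) =
          (limit (F ⋙ inclFib L.obj X)).hom := Over.w (limit.π (F ⋙ inclFib L.obj X) j)
        exact (Category.assoc _ _ _).trans ((u ≫= e).trans (h1.trans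
          ((v ≫= e).symm.trans (Category.assoc _ _ _).symm)))
      have e1 := jointlyMonic_el _ _ _ (hw WalkingCospan.left)
        ((Category.assoc _ _ _).trans (h3.trans (Category.assoc _ _ _).symm))
      have e2 := jointlyMonic_el _ _ _ (hw WalkingCospan.right)
        ((Category.assoc _ _ _).trans (h4.trans (Category.assoc _ _ _).symm))
      -- The leg to the middle of the cospan factors through the left leg, so agreement on the two
      -- outer legs is enough.
      have hone : ∀ (j : WalkingCospan), u ≫ (limit.π (F ⋙ inclFib L.obj X) j).left =
          v ≫ (limit.π (F ⋙ inclFib L.obj X) j).left := by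
        rintro (_ | _ | _)
        · have := congrArg CommaMorphism.left
            (limit.w (F ⋙ inclFib L.obj X) WalkingCospan.Hom.inl)
          have e : (limit.π (F ⋙ inclFib L.obj X) WalkingCospan.left).left ≫
            ((F ⋙ inclFib L.obj X).map WalkingCospan.Hom.inl).left =
            (limit.π (F ⋙ inclFib L.obj X) WalkingCospan.one).left := this
          exact (u ≫= e.symm).trans ((Category.assoc _ _ _).symm.trans
            ((e1 =≫ _).trans ((Category.assoc _ _ _).trans (v ≫= e))))
        · exact e1
        · exact e2
      refine congrArg CommaMorphism.left (limit.hom_ext (F := F ⋙ inclFib L.obj X)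
        (X := Over.mk (u ≫ (limit (F ⋙ inclFib L.obj X)).hom))
        (f := Over.homMk u) (f' := Over.homMk v h1.symm) fun j => ?_)
      exact Over.OverMorphism.ext (hone j)
    exact createsLimitOfFullyFaithfulOfIso h.choose h.choose_spec.some

noncomputable instance : CreatesLimitsOfShape (Discrete.{0} PEmpty) (inclFib L.obj X) where
  CreatesLimit {F} := by
    have h : ∃ A : (univCat L.obj).Fib X, Nonempty ((inclFib L.obj X).obj A ≅ Over.mk (𝟙 X)) :=
      exists_iso_inclFib _ (terminal.from X ≫ numZero E ≫ L.nat) (jointlyMonic_of_mono_left (𝟙 X) _)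
    let c : Cone (F ⋙ inclFib L.obj X) := ⟨Over.mk (𝟙 X), ⟨fun j => j.as.elim, fun j => j.as.elim⟩⟩
    have hc : IsLimit c := isLimitChangeEmptyCone _ Over.mkIdTerminal c (Iso.refl _)
    exact createsLimitOfFullyFaithfulOfIso' hc h.choose h.choose_spec.some

instance : HasTerminal ((univCat L.obj).Fib X) :=
  hasLimitsOfShape_of_hasLimitsOfShape_createsLimitsOfShape (inclFib L.obj X)

instance : HasPullbacks ((univCat L.obj).Fib X) :=
  hasLimitsOfShape_of_hasLimitsOfShape_createsLimitsOfShape (inclFib L.obj X)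

instance : HasFiniteLimits ((univCat L.obj).Fib X) := hasFiniteLimits_of_hasTerminal_and_pullbacks

theorem preservesFiniteLimits_inclFib : PreservesFiniteLimits (inclFib L.obj X) :=
  preservesFiniteLimits_of_preservesTerminal_and_pullbacks _

end FiniteLimits

/-! ### Covers and images -/

section Covers

variable {E : Type u} [Category.{v} E]

theorem isPullback_left {X : E} {R B A D : Over X} {t : R ⟶ A} {b : R ⟶ B} {f : A ⟶ D} {g : B ⟶ D}
    (h : IsPullback t b f g) : IsPullback t.left b.left f.left g.left := by
  refine (jointlyMonic_left (jointlyMonic_of_isPullback h)).isPullback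
    (congrArg CommaMorphism.left h.w) fun Z x y e => ?_
  have hw : y ≫ B.hom = x ≫ A.hom := by
    rw [← Over.w f, ← Over.w g, reassoc_of% e]
  have e' : (Over.homMk x : Over.mk (x ≫ A.hom) ⟶ A) ≫ f =
      (Over.homMk y hw : Over.mk (x ≫ A.hom) ⟶ B) ≫ g := Over.OverMorphism.ext e
  exact ⟨(h.lift _ _ e').left, congrArg CommaMorphism.left (h.lift_fst _ _ e'),
    congrArg CommaMorphism.left (h.lift_snd _ _ e')⟩

theorem isCover_over_of_strongEpi {X : E} {A B : Over X} (f : A ⟶ B) [StrongEpi f.left]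
    [HasPullbacks E] : IsCover f := by
  rintro C g m hm rfl
  have : StrongEpi (g.left ≫ m.left) := ‹StrongEpi (g ≫ m).left›
  have := strongEpi_of_strongEpi g.left m.left
  have : IsIso ((Over.forget X).map m) := isIso_of_mono_of_strongEpi m.left
  exact isIso_of_reflects_iso m (Over.forget X)

variable [Topos E]

theorem strongEpi_of_isPullback {R B A D : E} {t : R ⟶ A} {b : R ⟶ B} {f : A ⟶ D} {g : B ⟶ D}
    (h : IsPullback t b f g) [StrongEpi f] : StrongEpi b := by
  have : IsRegularEpi b := Regular.regularEpiIsStableUnderBaseChange.of_isPullback h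
    (show IsRegularEpi f from inferInstance)
  infer_instance

/-- Membership is a local property. -/
theorem isElem_of_cover {Z Z' K : E} (e : Z' ⟶ Z) [StrongEpi e] {k : Z ⟶ K} {A : Z ⟶ Pow K}
    (h : IsElem (e ≫ k) (e ≫ A)) : IsElem k A := by
  obtain ⟨S, m, hm, hS⟩ := rep_isElem k A
  obtain ⟨t, ht⟩ := (hS _ e).1 h
  have sq : CommSq t e m (𝟙 Z) := ⟨by rw [ht, Category.comp_id]⟩
  have := (hS Z (𝟙 Z)).2 ⟨sq.lift, sq.fac_right⟩
  simpa using this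

variable {K X Y : E} {A B D : (univCat K).Fib X}

/-- An element belongs to the image if it has a preimage after passing to a cover. The image comes
from the regular factorisation of the map of total objects, while this local description makes it
strictly stable under reindexing. -/
theorem exists_image (f : A ⟶ B) : ∃ I : (univCat K).Fib X, ∀ (Z : E) (z : Z ⟶ X) (c : Z ⟶ K),
    IsElem c (z ≫ nm I) ↔ ∃ (Z' : E) (e : Z' ⟶ Z) (a : Z' ⟶ K), StrongEpi e ∧
      App ((e ≫ z) ≫ ar f) a (e ≫ c) := by
  let F := Regular.strongEpiMonoFactorisation (elMap f)
  have hj : JointlyMonic (F.m ≫ elProj (nm B)) (F.m ≫ elCode (nm B)) := by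
    intro Z s t h1 h2
    rw [← cancel_mono F.m]
    exact jointlyMonic_el _ _ _ (by simpa using h1) (by simpa using h2)
  refine ⟨ofName (nameOf _ _ hj), fun Z z c => ⟨?_, ?_⟩⟩
  · intro h
    obtain ⟨r, rfl, rfl⟩ := (isElem_nameOf hj z c).1 h
    have := strongEpi_of_isPullback (IsPullback.of_hasPullback F.e r)
    refine ⟨_, pullback.snd F.e r, pullback.fst F.e r ≫ elCode (nm A), this, ?_⟩
    rw [app_iff_elMap]
    refine ⟨pullback.fst F.e r, ?_, rfl, ?_⟩
    · rw [← elMap_proj f, ← F.fac_assoc, pullback.condition_assoc]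
    · rw [← F.fac_assoc, pullback.condition_assoc]
  · rintro ⟨Z', e, a, he, h⟩
    obtain ⟨t, h1, -, h3⟩ := (app_iff_elMap f _ _ _).1 h
    refine isElem_of_cover e ?_
    rw [← Category.assoc]
    refine (isElem_nameOf hj (e ≫ z) (e ≫ c)).2 ⟨t ≫ F.e, ?_, ?_⟩
    · rw [Category.assoc, F.fac_assoc, elMap_proj, h1]
    · rw [Category.assoc, F.fac_assoc, h3]

/-- The image of a map of the externalisation. -/
noncomputable def image (f : A ⟶ B) : (univCat K).Fib X := (exists_image f).choose

theorem isElem_image (f : A ⟶ B) {Z : E} (z : Z ⟶ X) (c : Z ⟶ K) :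
    IsElem c (z ≫ nm (image f)) ↔ ∃ (Z' : E) (e : Z' ⟶ Z) (a : Z' ⟶ K), StrongEpi e ∧
      App ((e ≫ z) ≫ ar f) a (e ≫ c) := (exists_image f).choose_spec Z z c

theorem isElem_of_isElem_image (f : A ⟶ B) {Z : E} (z : Z ⟶ X) (c : Z ⟶ K)
    (h : IsElem c (z ≫ nm (image f))) : IsElem c (z ≫ nm B) := by
  obtain ⟨Z', e, a, he, h⟩ := (isElem_image f z c).1 h
  refine isElem_of_cover e ?_
  rw [← Category.assoc]
  exact mem_tgt h

theorem isMap_imageCover (f : A ⟶ B) :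
    IsMap (nm A) (nm (image f)) (fun _ z a c => App (z ≫ ar f) a c) where
  stable w z a b h := by simpa using h.comp w
  mem z a b h := ⟨mem_src h, (isElem_image f z b).2 ⟨_, 𝟙 _, a, inferInstance, by simpa using h⟩⟩
  total z a h := exists_app f h
  unique z a b b' h h' := h.unique h'

theorem isMap_imageMono (f : A ⟶ B) :
    IsMap (nm (image f)) (nm B) (fun _ z c c' => IsElem c (z ≫ nm (image f)) ∧ c = c') where
  stable w z a b h := ⟨by simpa using h.1.comp w, by rw [h.2]⟩
  mem z a b := by
    rintro ⟨h, rfl⟩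
    exact ⟨h, isElem_of_isElem_image f z a h⟩
  total z a h := ⟨a, h, rfl⟩
  unique z a b b' h h' := h.2.symm.trans h'.2

noncomputable def imageCover (f : A ⟶ B) : A ⟶ image f := (isMap_imageCover f).hom

noncomputable def imageMono (f : A ⟶ B) : image f ⟶ B := (isMap_imageMono f).hom

theorem app_imageCover (f : A ⟶ B) {Z : E} (z : Z ⟶ X) (a c : Z ⟶ K) :
    App (z ≫ ar (imageCover f)) a c ↔ App (z ≫ ar f) a c := (isMap_imageCover f).app_hom z a c

theorem app_imageMono (f : A ⟶ B) {Z : E} (z : Z ⟶ X) (c c' : Z ⟶ K) :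
    App (z ≫ ar (imageMono f)) c c' ↔ IsElem c (z ≫ nm (image f)) ∧ c = c' :=
  (isMap_imageMono f).app_hom z c c'

theorem imageCover_imageMono (f : A ⟶ B) : imageCover f ≫ imageMono f = f := by
  refine fib_hom_ext fun Z z a b h => ?_
  obtain ⟨c, h1, h2⟩ := (app_fib_comp _ _).1 h
  obtain ⟨-, rfl⟩ := (app_imageMono f z c b).1 h2
  exact (app_imageCover f z a c).1 h1

theorem mono_imageMono (f : A ⟶ B) : Mono (imageMono f) := by
  refine ⟨fun {T} g h e => fib_hom_ext fun Z z a c hc => ?_⟩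
  have h1 : App (z ≫ ar (g ≫ imageMono f)) a c :=
    (app_fib_comp _ _).2 ⟨c, hc, (app_imageMono f z c c).2 ⟨mem_tgt hc, rfl⟩⟩
  rw [e] at h1
  obtain ⟨d, h2, h3⟩ := (app_fib_comp _ _).1 h1
  obtain ⟨-, rfl⟩ := (app_imageMono f z d c).1 h3
  exact h2

theorem reindex_image (h : Y ⟶ X) (f : A ⟶ B) :
    ((univCat K).reindex h).obj (image f) = image (((univCat K).reindex h).map f) := by
  refine fib_ext fun Z z k => ?_
  rw [nm_reindex, ← Category.assoc, isElem_image, isElem_image, ar_reindex]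
  simp only [Category.assoc]

theorem reindex_imageCover (h : Y ⟶ X) (f : A ⟶ B) :
    (((univCat K).reindex h).map (imageCover f)).1 =
      (imageCover (((univCat K).reindex h).map f)).1 :=
  reindex_map_eq h rfl (reindex_image h f) fun Z z a b hab => by
    rw [app_imageCover] at hab ⊢
    rwa [ar_reindex, ← Category.assoc]

theorem reindex_imageMono (h : Y ⟶ X) (f : A ⟶ B) :
    (((univCat K).reindex h).map (imageMono f)).1 =
      (imageMono (((univCat K).reindex h).map f)).1 :=
  reindex_map_eq h (reindex_image h f) rfl fun Z z a b hab => by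
    rw [app_imageMono] at hab ⊢
    rwa [← reindex_image, nm_reindex, ← Category.assoc]

/-- The generic element of B has a preimage on a cover e, so e factors through the map of total
objects, which is then itself a strong epimorphism. -/
theorem strongEpi_elMap (f : A ⟶ B) (h : ∀ (Z : E) (z : Z ⟶ X) (b : Z ⟶ K), IsElem b (z ≫ nm B) →
    ∃ (Z' : E) (e : Z' ⟶ Z) (a : Z' ⟶ K), StrongEpi e ∧ App ((e ≫ z) ≫ ar f) a (e ≫ b)) :
    StrongEpi (elMap f) := by
  obtain ⟨Z', e, a, he, h1⟩ := h _ _ _ (isElem_elCode (nm B))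
  obtain ⟨t, h1, -, h2⟩ := (app_iff_elMap f _ _ _).1 h1
  have : t ≫ elMap f = e := jointlyMonic_el _ _ _
    (by rw [Category.assoc, elMap_proj, h1]) (by rw [Category.assoc, h2])
  have : StrongEpi (t ≫ elMap f) := this ▸ he
  exact strongEpi_of_strongEpi t (elMap f)

theorem strongEpi_elMap_imageCover (f : A ⟶ B) : StrongEpi (elMap (imageCover f)) := by
  refine strongEpi_elMap _ fun Z z b hb => ?_
  obtain ⟨Z', e, a, he, h⟩ := (isElem_image f z b).1 hb
  exact ⟨Z', e, a, he, (app_imageCover f _ _ _).2 h⟩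

theorem elMap_comp (f : A ⟶ B) (g : B ⟶ D) : elMap (f ≫ g) = elMap f ≫ elMap g :=
  congrArg CommaMorphism.left ((inclFib K X).map_comp f g)

/-- A cover factors through its image, so the image inclusion is invertible and f has the same total
map as its image cover up to isomorphism. -/
theorem strongEpi_elMap_of_isCover {f : A ⟶ B} (hf : IsCover f) : StrongEpi (elMap f) := by
  have := hf _ _ (mono_imageMono f) (imageCover_imageMono f)
  have h1 : IsIso (elMap (imageMono f)) :=
    inferInstanceAs (IsIso ((inclFib K X ⋙ Over.forget X).map (imageMono f)))
  have h2 := strongEpi_elMap_imageCover f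
  rw [← imageCover_imageMono f, elMap_comp]
  exact strongEpi_comp _ _

/-- The inclusion preserves monos, as it preserves finite limits, and reflects isomorphisms, as it
is fully faithful. -/
theorem isCover_of_map_isCover {T : SquareClosed E} {A B : (univCat T.obj).Fib X} {f : A ⟶ B}
    (hf : IsCover ((inclFib T.obj X).map f)) : IsCover f := by
  intro C g m hm h
  have := preservesFiniteLimits_inclFib T X
  have : IsIso ((inclFib T.obj X).map m) :=
    hf ((inclFib T.obj X).map g) ((inclFib T.obj X).map m) inferInstance (by
      rw [← Functor.map_comp, h])
  exact isIso_of_fully_faithful (inclFib T.obj X) m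

theorem isCover_map_of_strongEpi (f : A ⟶ B) (hf : StrongEpi (elMap f)) :
    IsCover ((inclFib K X).map f) :=
  have : StrongEpi ((inclFib K X).map f).left := hf
  isCover_over_of_strongEpi _

theorem isCover_of_isPullback {T : SquareClosed E} {A B D Q : (univCat T.obj).Fib X} {p : Q ⟶ A}
    {e' : Q ⟶ B} {e : A ⟶ D} {g : B ⟶ D} (h : IsPullback p e' e g) (he : IsCover e) :
    IsCover e' := by
  have := preservesFiniteLimits_inclFib T X
  have h' := isPullback_left (h.map (inclFib T.obj X))
  have : StrongEpi ((inclFib T.obj X).map e).left := strongEpi_elMap_of_isCover he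
  exact isCover_of_map_isCover (isCover_map_of_strongEpi e' (strongEpi_of_isPullback h'))

end Covers

/-! ### The internal regular structure -/

section CodedMaps

variable {E : Type u} [Category.{v} E] [Topos E] {K X Y Z Q : E} {B : (univCat K).Fib X}
  {Ψ : ∀ Z : E, (Z ⟶ X) → (Z ⟶ Q) → Prop}
  (h : Rep (fun Z (z : Z ⟶ X ⨯ Q) => Ψ Z (z ≫ prod.fst) (z ≫ prod.snd))) (c : Q ⟶ K) [Mono c]

theorem isMap_coded (q : Q ⟶ K) (hq : ∀ (Z : E) (z : Z ⟶ X) (t : Z ⟶ Q), Ψ Z z t →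
    IsElem (t ≫ q) (z ≫ nm B)) :
    IsMap (nm (coded h c)) (nm B) (fun Z z k b => ∃ t : Z ⟶ Q, Ψ Z z t ∧ t ≫ c = k ∧ t ≫ q = b) where
  stable {Z Z'} w z k b := by
    rintro ⟨t, ht, rfl, rfl⟩
    have := h.stable w (z := prod.lift z t) (by simpa using ht)
    exact ⟨w ≫ t, by simpa using this, by simp, by simp⟩
  mem {Z} z k b := by
    rintro ⟨t, ht, rfl, rfl⟩
    exact ⟨(isElem_coded h c z _).2 ⟨t, ht, rfl⟩, hq Z z t ht⟩
  total {Z} z k hk := by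
    obtain ⟨t, ht, rfl⟩ := (isElem_coded h c z k).1 hk
    exact ⟨_, t, ht, rfl, rfl⟩
  unique {Z} z k b b' := by
    rintro ⟨t, ht, rfl, rfl⟩ ⟨t', ht', h1, rfl⟩
    rw [cancel_mono] at h1
    rw [h1]

/-- Maps out of a coded object, given by a map defined on the object that is coded. -/
noncomputable def codedMap (q : Q ⟶ K) (hq : ∀ (Z : E) (z : Z ⟶ X) (t : Z ⟶ Q), Ψ Z z t →
    IsElem (t ≫ q) (z ≫ nm B)) : coded h c ⟶ B :=
  (isMap_coded h c q hq).hom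

theorem app_codedMap (q : Q ⟶ K) (hq : ∀ (Z : E) (z : Z ⟶ X) (t : Z ⟶ Q), Ψ Z z t →
    IsElem (t ≫ q) (z ≫ nm B)) (z : Z ⟶ X) (k b : Z ⟶ K) :
    App (z ≫ ar (codedMap h c q hq)) k b ↔ ∃ t : Z ⟶ Q, Ψ Z z t ∧ t ≫ c = k ∧ t ≫ q = b :=
  (isMap_coded h c q hq).app_hom z k b

variable {Ψ' : ∀ Z : E, (Z ⟶ Y) → (Z ⟶ Q) → Prop}
  (h' : Rep (fun Z (z : Z ⟶ Y ⨯ Q) => Ψ' Z (z ≫ prod.fst) (z ≫ prod.snd)))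

theorem reindex_coded (w : Y ⟶ X) (e : ∀ (Z : E) (z : Z ⟶ Y) (t : Z ⟶ Q), Ψ Z (z ≫ w) t ↔ Ψ' Z z t) :
    ((univCat K).reindex w).obj (coded h c) = coded h' c := by
  refine fib_ext fun Z z k => ?_
  rw [nm_reindex, ← Category.assoc, isElem_coded, isElem_coded]
  simp only [e]

theorem reindex_codedMap (w : Y ⟶ X)
    (e : ∀ (Z : E) (z : Z ⟶ Y) (t : Z ⟶ Q), Ψ Z (z ≫ w) t ↔ Ψ' Z z t) {B' : (univCat K).Fib Y}
    (hB : ((univCat K).reindex w).obj B = B') (q : Q ⟶ K)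
    (hq : ∀ (Z : E) (z : Z ⟶ X) (t : Z ⟶ Q), Ψ Z z t → IsElem (t ≫ q) (z ≫ nm B))
    (hq' : ∀ (Z : E) (z : Z ⟶ Y) (t : Z ⟶ Q), Ψ' Z z t → IsElem (t ≫ q) (z ≫ nm B')) :
    (((univCat K).reindex w).map (codedMap h c q hq)).1 = (codedMap h' c q hq').1 := by
  refine reindex_map_eq w (reindex_coded h c h' w e) hB fun Z z a b hab => ?_
  rw [app_codedMap] at hab ⊢
  simpa only [e] using hab

end CodedMaps

/-! ### Terminal objects and pullbacks in the fibres. -/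

section Regular

variable {E : Type u} [Category.{v} E] [Topos E] {K X Y : E}

/-- The terminal object, with a given element as the code of its element. -/
noncomputable def oneFib (p : ⊤_ E ⟶ K) (X : E) : (univCat K).Fib X :=
  have : Mono p := terminalIsTerminal.mono_from p
  coded (Ψ := fun _ _ _ => True) (rep_true _) p

theorem isElem_oneFib (p : ⊤_ E ⟶ K) {Z : E} (z : Z ⟶ X) (k : Z ⟶ K) :
    IsElem k (z ≫ nm (oneFib p X)) ↔ k = terminal.from Z ≫ p := by
  have : Mono p := terminalIsTerminal.mono_from p
  refine (isElem_coded (Ψ := fun _ _ _ => True) (rep_true _) p z k).trans ⟨?_, ?_⟩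
  · rintro ⟨t, -, rfl⟩
    rw [Subsingleton.elim t (terminal.from Z)]
  · rintro rfl
    exact ⟨_, trivial, rfl⟩

theorem isTerminal_oneFib (p : ⊤_ E ⟶ K) (X : E) : Nonempty (IsTerminal (oneFib p X)) := by
  have h (A : (univCat K).Fib X) : IsMap (nm A) (nm (oneFib p X))
      (fun Z z a b => IsElem a (z ≫ nm A) ∧ b = terminal.from Z ≫ p) :=
    { stable := fun w z a b h => ⟨by simpa using h.1.comp w, by
        rw [h.2, ← Category.assoc, terminal.comp_from]⟩
      mem := fun z a b h => ⟨h.1, (isElem_oneFib p z b).2 h.2⟩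
      total := fun z a h => ⟨_, h, rfl⟩
      unique := fun z a b b' h h' => h.2.trans h'.2.symm }
  refine ⟨IsTerminal.ofUniqueHom (fun A => (h A).hom) fun A f => fib_hom_ext fun Z z a b hab => ?_⟩
  rw [(h A).app_hom]
  exact ⟨mem_src hab, (isElem_oneFib p z b).1 (mem_tgt hab)⟩

theorem reindex_oneFib (p : ⊤_ E ⟶ K) (h : Y ⟶ X) :
    ((univCat K).reindex h).obj (oneFib p X) = oneFib p Y := by
  refine fib_ext fun Z z k => ?_
  rw [nm_reindex, ← Category.assoc, isElem_oneFib, isElem_oneFib]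

variable {A B D : (univCat K).Fib X} {L : E} (j : L ⟶ K)

/-- Codes of the elements of a pullback. -/
def PbElem (f : A ⟶ D) (g : B ⟶ D) (Z : E) (z : Z ⟶ X) (t : Z ⟶ L ⨯ L) : Prop :=
  ∃ d : Z ⟶ K, App (z ≫ ar f) (t ≫ prod.fst ≫ j) d ∧ App (z ≫ ar g) (t ≫ prod.snd ≫ j) d

/-- The common value d is unique because f is single-valued, so its existence is unique existence
and hence representable. -/
theorem rep_pbElem (f : A ⟶ D) (g : B ⟶ D) : Rep (fun Z (z : Z ⟶ X ⨯ (L ⨯ L)) =>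
    PbElem j f g Z (z ≫ prod.fst) (z ≫ prod.snd)) := by
  refine (rep_existsUnique (X := X ⨯ (L ⨯ L)) (K := K)
    (Φ := fun Z z d => App (z ≫ prod.fst ≫ ar f) (z ≫ prod.snd ≫ prod.fst ≫ j) d ∧
      App (z ≫ prod.fst ≫ ar g) (z ≫ prod.snd ≫ prod.snd ≫ j) d) (Rep.and ?_ ?_)).congr
    fun Z z => ⟨fun ⟨d, h1, h2⟩ => ?_, fun ⟨d, ⟨h1, h2⟩, _⟩ => ?_⟩
  · exact (rep_isElem (prod.lift (prod.fst ≫ prod.snd ≫ prod.fst ≫ j) prod.snd)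
      (prod.fst ≫ prod.fst ≫ ar f ≫ arrGraph K)).congr (by simp [App])
  · exact (rep_isElem (prod.lift (prod.fst ≫ prod.snd ≫ prod.snd ≫ j) prod.snd)
      (prod.fst ≫ prod.fst ≫ ar g ≫ arrGraph K)).congr (by simp [App])
  · refine ⟨d, ⟨by simpa using h1, by simpa using h2⟩, fun Z' w d' h' => ?_⟩
    refine h'.1.unique ?_
    simpa using h1.comp w
  · exact ⟨d, by simpa using h1, by simpa using h2⟩

theorem PbElem.mem_fst {f : A ⟶ D} {g : B ⟶ D} {Z : E} {z : Z ⟶ X} {t : Z ⟶ L ⨯ L}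
    (h : PbElem j f g Z z t) : IsElem (t ≫ prod.fst ≫ j) (z ≫ nm A) := mem_src h.choose_spec.1

theorem PbElem.mem_snd {f : A ⟶ D} {g : B ⟶ D} {Z : E} {z : Z ⟶ X} {t : Z ⟶ L ⨯ L}
    (h : PbElem j f g Z z t) : IsElem (t ≫ prod.snd ≫ j) (z ≫ nm B) := mem_src h.choose_spec.2

theorem pbElem_reindex (h : Y ⟶ X) (f : A ⟶ D) (g : B ⟶ D) (Z : E) (z : Z ⟶ Y) (t : Z ⟶ L ⨯ L) :
    PbElem j f g Z (z ≫ h) t ↔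
      PbElem j (((univCat K).reindex h).map f) (((univCat K).reindex h).map g) Z z t := by
  simp only [PbElem, ar_reindex, Category.assoc]

/-- Boundedness of A and B allows their elements to be coded in L, where a pair is again an element
of L. No bound on D is needed, since D occurs only in the equation that defines the pullback. -/
theorem isPullback_coded [Mono j] (p : L ⨯ L ⟶ L) [Mono p] (hA : BoundedBy j (nm A))
    (hB : BoundedBy j (nm B)) (f : A ⟶ D) (g : B ⟶ D) :
    IsPullback (codedMap (rep_pbElem j f g) (p ≫ j) (prod.fst ≫ j) fun _ _ _ h => h.mem_fst)
      (codedMap (rep_pbElem j f g) (p ≫ j) (prod.snd ≫ j) fun _ _ _ h => h.mem_snd) f g := by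
  refine JointlyMonic.isPullback (fun T u v h1 h2 => fib_hom_ext fun Z z a c hc => ?_) ?_
    fun T x y e => ?_
  · obtain ⟨t, ht, rfl⟩ := (isElem_coded _ _ _ _).1 (mem_tgt hc)
    have h3 := (app_fib_comp u _).2 ⟨_, hc, (app_codedMap (rep_pbElem j f g) (p ≫ j) (prod.fst ≫ j)
      (fun _ _ _ h => h.mem_fst) z _ _).2 ⟨t, ht, rfl, rfl⟩⟩
    have h4 := (app_fib_comp u _).2 ⟨_, hc, (app_codedMap (rep_pbElem j f g) (p ≫ j) (prod.snd ≫ j)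
      (fun _ _ _ h => h.mem_snd) z _ _).2 ⟨t, ht, rfl, rfl⟩⟩
    rw [h1, app_fib_comp] at h3
    rw [h2, app_fib_comp] at h4
    obtain ⟨b, h5, h6⟩ := h3
    obtain ⟨b', h7, h8⟩ := h4
    obtain rfl := h5.unique h7
    obtain ⟨s, -, h9, h10⟩ := (app_codedMap _ _ _ _ _ _ _).1 h6
    obtain ⟨s', -, h11, h12⟩ := (app_codedMap _ _ _ _ _ _ _).1 h8
    subst h9
    rw [cancel_mono] at h11
    subst h11
    have : s' = t := by
      ext
      · rwa [← Category.assoc, ← Category.assoc, cancel_mono] at h10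
      · rwa [← Category.assoc, ← Category.assoc, cancel_mono] at h12
    rwa [← this]
  · refine fib_hom_ext fun Z z c d h => ?_
    obtain ⟨a, h1, h2⟩ := (app_fib_comp _ _).1 h
    obtain ⟨t, ht, rfl, rfl⟩ := (app_codedMap _ _ _ _ _ _ _).1 h1
    refine (app_fib_comp _ _).2 ⟨_, (app_codedMap _ _ _ _ _ _ _).2 ⟨t, ht, rfl, rfl⟩, ?_⟩
    obtain ⟨d', h3, h4⟩ := ht
    obtain rfl := h2.unique h3
    exact h4
  · have h : IsMap (nm T) (nm (coded (rep_pbElem j f g) (p ≫ j))) (fun Z z a c =>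
        ∃ t : Z ⟶ L ⨯ L, App (z ≫ ar x) a (t ≫ prod.fst ≫ j) ∧
          App (z ≫ ar y) a (t ≫ prod.snd ≫ j) ∧ t ≫ p ≫ j = c) :=
      { stable := by
          rintro Z Z' w z a c ⟨t, h1, h2, rfl⟩
          exact ⟨w ≫ t, by simpa using h1.comp w, by simpa using h2.comp w, by simp⟩
        mem := by
          rintro Z z a c ⟨t, h1, h2, rfl⟩
          refine ⟨mem_src h1, (isElem_coded _ _ _ _).2 ⟨t, ?_, rfl⟩⟩
          obtain ⟨d, hd⟩ := exists_app f (mem_tgt h1)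
          have h3 := (app_fib_comp _ _).2 ⟨_, h1, hd⟩
          rw [e, app_fib_comp] at h3
          obtain ⟨b, h4, h5⟩ := h3
          obtain rfl := h2.unique h4
          exact ⟨d, hd, h5⟩
        total := by
          intro Z z a ha
          obtain ⟨b, hb⟩ := exists_app x ha
          obtain ⟨c, hc⟩ := exists_app y ha
          obtain ⟨l, rfl⟩ := hA _ _ _ (mem_tgt hb)
          obtain ⟨m, rfl⟩ := hB _ _ _ (mem_tgt hc)
          exact ⟨_, prod.lift l m, by simpa using hb, by simpa using hc, rfl⟩
        unique := by
          rintro Z z a c c' ⟨t, h1, h2, rfl⟩ ⟨t', h3, h4, rfl⟩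
          have h5 := h1.unique h3
          have h6 := h2.unique h4
          congr 1
          ext
          · rwa [← Category.assoc, ← Category.assoc, cancel_mono] at h5
          · rwa [← Category.assoc, ← Category.assoc, cancel_mono] at h6 }
    refine ⟨h.hom, fib_hom_ext fun Z z a b hab => ?_, fib_hom_ext fun Z z a b hab => ?_⟩
    all_goals
      obtain ⟨c, h1, h2⟩ := (app_fib_comp _ _).1 hab
      obtain ⟨t, h3, h4, rfl⟩ := (h.app_hom _ _ _).1 h1
      obtain ⟨s, -, h5, rfl⟩ := (app_codedMap _ _ _ _ _ _ _).1 h2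
      rw [cancel_mono] at h5
      subst h5
      assumption

theorem boundedBy_image {f : A ⟶ B} (hB : BoundedBy j (nm B)) : BoundedBy j (nm (image f)) :=
  fun Z z k hk => hB Z z k (isElem_of_isElem_image f z k hk)

end Regular

/-! ### The chosen regular structure on the subobjects of a square-closed object. -/

section RegularOn

variable {E : Type u} [Category.{v} E] [Topos E]

/-- The regular structure of the subcategory of the subobjects of a square-closed subobject. -/
noncomputable def regularOn {T L : SquareClosed E} (j : L.obj ⟶ T.obj) [Mono j]
    (S : Subobject (univCat T.obj).ob)
    (hS : ∀ {X : E} (A : (univCat T.obj).Fib X), Mem S A ↔ BoundedBy j (nm A)) :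
    (univCat T.obj).RegularOn S where
  one X := oneFib (numZero E ≫ L.nat ≫ j) X
  one_mem X := (hS _).2 fun Z z k hk => ⟨terminal.from Z ≫ numZero E ≫ L.nat, by
    rw [(isElem_oneFib _ _ _).1 hk]
    simp⟩
  one_isTerminal X := isTerminal_oneFib _ X
  one_reindex h := reindex_oneFib _ h
  pb _ _ _ f g := coded (rep_pbElem j f g) (L.pair ≫ j)
  pb_mem _ _ _ f g := (hS _).2 (boundedBy_coded _ _ j L.pair rfl)
  pbFst _ _ _ f g := codedMap (rep_pbElem j f g) (L.pair ≫ j) (prod.fst ≫ j) fun _ _ _ h => h.mem_fst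
  pbSnd _ _ _ f g := codedMap (rep_pbElem j f g) (L.pair ≫ j) (prod.snd ≫ j) fun _ _ _ h => h.mem_snd
  pb_isPullback hA hB _ f g := isPullback_coded j L.pair ((hS _).1 hA) ((hS _).1 hB) f g
  pbFst_reindex h _ _ _ _ _ _ f g := reindex_codedMap _ _ _ h (pbElem_reindex j h f g) rfl _ _ _
  pbSnd_reindex h _ _ _ _ _ _ f g := reindex_codedMap _ _ _ h (pbElem_reindex j h f g) rfl _ _ _
  im _ _ f := image f
  im_mem _ hB f := (hS _).2 (boundedBy_image j ((hS _).1 hB))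
  imCover _ _ f := imageCover f
  imMono _ _ f := imageMono f
  im_fac _ _ f := imageCover_imageMono f
  imCover_isCover _ _ f :=
    isCover_of_map_isCover (isCover_map_of_strongEpi _ (strongEpi_elMap_imageCover f))
  imMono_mono _ _ f := mono_imageMono f
  imCover_reindex h _ _ _ _ f := reindex_imageCover h f
  imMono_reindex h _ _ _ _ f := reindex_imageMono h f

end RegularOn

/-! ### The internal natural numbers object -/

theorem IsNNO.of_iso {C : Type u} [Category.{v} C] {T N T' N' : C} {zero : T ⟶ N} {succ : N ⟶ N}
    (h : IsNNO zero succ) {zero' : T' ⟶ N'} {succ' : N' ⟶ N'} (e : T' ≅ T) (e' : N' ≅ N)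
    (h0 : zero' ≫ e'.hom = e.hom ≫ zero) (h1 : succ' ≫ e'.hom = e'.hom ≫ succ) :
    IsNNO zero' succ' := by
  refine ⟨⟨h.1.some.ofIso e.symm⟩, fun A a s => ?_⟩
  obtain ⟨f, ⟨h2, h3⟩, h4⟩ := h.2 (e.inv ≫ a) s
  refine ⟨e'.hom ≫ f, ⟨?_, ?_⟩, fun g ⟨h5, h6⟩ => ?_⟩
  · rw [reassoc_of% h0, h2, e.hom_inv_id_assoc]
  · rw [reassoc_of% h1, h3, Category.assoc]
  · rw [← h4 (e'.inv ≫ g) ⟨?_, ?_⟩, e'.hom_inv_id_assoc]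
    · rw [← h5, ← cancel_epi e.hom, ← reassoc_of% h0]
      simp
    · rw [← cancel_epi e'.hom, ← reassoc_of% h1]
      simp [h6]

theorem IsNNO.of_map {C D : Type*} [Category* C] [Category* D] (F : C ⥤ D) [F.Full] [F.Faithful]
    {T N : C} {zero : T ⟶ N} {succ : N ⟶ N} (h : IsNNO (F.map zero) (F.map succ)) :
    IsNNO zero succ := by
  refine ⟨⟨IsTerminal.ofUniqueHom (fun X => F.preimage (h.1.some.from _)) fun X m =>
    F.map_injective (h.1.some.hom_ext _ _)⟩, fun A a s => ?_⟩
  obtain ⟨f, ⟨h1, h2⟩, h3⟩ := h.2 (F.map a) (F.map s)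
  refine ⟨F.preimage f, ⟨F.map_injective ?_, F.map_injective ?_⟩, fun g ⟨h4, h5⟩ =>
    F.map_injective ?_⟩
  · simpa using h1
  · simpa using h2
  · rw [F.map_preimage]
    exact h3 _ ⟨by rw [← F.map_comp, h4], by rw [← F.map_comp, ← F.map_comp, h5]⟩

section Numbers

variable {E : Type u} [Category.{v} E] [Topos E] {K X Y : E}

/-- The natural numbers object, with codes in `K`. -/
noncomputable def natFib (i : Num E ⟶ K) [Mono i] (X : E) : (univCat K).Fib X :=
  coded (Ψ := fun _ _ _ => True) (rep_true _) i

theorem isElem_natFib (i : Num E ⟶ K) [Mono i] {Z : E} (z : Z ⟶ X) (k : Z ⟶ K) :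
    IsElem k (z ≫ nm (natFib i X)) ↔ ∃ n : Z ⟶ Num E, n ≫ i = k :=
  (isElem_coded (Ψ := fun _ _ _ => True) (rep_true _) i z k).trans (by simp)

theorem isElem_comp_natFib (i : Num E ⟶ K) [Mono i] {Z Q : E} (z : Z ⟶ X) (f : Q ⟶ Num E)
    (t : Z ⟶ Q) : IsElem (t ≫ f ≫ i) (z ≫ nm (natFib i X)) :=
  (isElem_natFib i z _).2 ⟨t ≫ f, Category.assoc _ _ _⟩

noncomputable def zeroFib (p : ⊤_ E ⟶ K) (i : Num E ⟶ K) [Mono i] (X : E) :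
    oneFib p X ⟶ natFib i X :=
  have : Mono p := terminalIsTerminal.mono_from p
  codedMap (Ψ := fun _ _ _ => True) (rep_true _) p (numZero E ≫ i) fun _ z t _ =>
    isElem_comp_natFib i z _ t

noncomputable def succFib (i : Num E ⟶ K) [Mono i] (X : E) : natFib i X ⟶ natFib i X :=
  codedMap (Ψ := fun _ _ _ => True) (rep_true _) i (numSucc E ≫ i) fun _ z t _ =>
    isElem_comp_natFib i z _ t

theorem reindex_natFib (i : Num E ⟶ K) [Mono i] (h : Y ⟶ X) :
    ((univCat K).reindex h).obj (natFib i X) = natFib i Y :=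
  reindex_coded (Ψ := fun _ _ _ => True) (rep_true _) i (Ψ' := fun _ _ _ => True) (rep_true _) h
    fun _ _ _ => Iff.rfl

theorem reindex_zeroFib (p : ⊤_ E ⟶ K) (i : Num E ⟶ K) [Mono i] (h : Y ⟶ X) :
    (((univCat K).reindex h).map (zeroFib p i X)).1 = (zeroFib p i Y).1 :=
  have : Mono p := terminalIsTerminal.mono_from p
  reindex_codedMap (Ψ := fun _ _ _ => True) (rep_true _) p (Ψ' := fun _ _ _ => True) (rep_true _) h
    (fun _ _ _ => Iff.rfl) (reindex_natFib i h) (numZero E ≫ i)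
    (fun _ z t _ => isElem_comp_natFib i z _ t)
    (fun _ z t _ => isElem_comp_natFib i z _ t)

theorem reindex_succFib (i : Num E ⟶ K) [Mono i] (h : Y ⟶ X) :
    (((univCat K).reindex h).map (succFib i X)).1 = (succFib i Y).1 :=
  reindex_codedMap (Ψ := fun _ _ _ => True) (rep_true _) i (Ψ' := fun _ _ _ => True) (rep_true _) h
    (fun _ _ _ => Iff.rfl) (reindex_natFib i h) _ _ _

/-- Comparing codes identifies the total objects with X and Num × X, and the maps with zero and
successor of the slice; the property is transported along these isomorphisms. -/
theorem isNNO_map_succFib (p : ⊤_ E ⟶ K) (i : Num E ⟶ K) [Mono i] (X : E) :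
    IsNNO ((inclFib K X).map (zeroFib p i X)) ((inclFib K X).map (succFib i X)) := by
  have : Mono p := terminalIsTerminal.mono_from p
  have hi : JointlyMonic (overNum X).hom ((prod.fst : Num E ⨯ X ⟶ Num E) ≫ i) := by
    intro Z u v h1 h2
    simp only [← Category.assoc, cancel_mono] at h2
    exact prod.hom_ext h2 h1
  obtain ⟨e, -⟩ := exists_iso_of_isElem_iff (oneFib p X) (Over.mk (𝟙 X)) (terminal.from X ≫ p)
    (jointlyMonic_of_mono_left (𝟙 X) _) fun Z z a => by
      rw [isElem_oneFib]
      constructor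
      · rintro rfl
        exact ⟨z, Category.comp_id _, (Category.assoc _ _ _).symm.trans
          (congrArg (· ≫ p) (terminal.comp_from z))⟩
      · rintro ⟨y, -, rfl⟩
        exact (Category.assoc _ _ _).symm.trans (congrArg (· ≫ p) (Subsingleton.elim _ _))
  obtain ⟨e', he'⟩ := exists_iso_of_isElem_iff (natFib i X) (overNum X)
    ((prod.fst : Num E ⨯ X ⟶ Num E) ≫ i) hi fun Z z a => by
      rw [isElem_natFib]
      constructor
      · rintro ⟨n, rfl⟩
        exact ⟨prod.lift n z, prod.lift_snd _ _, by simp⟩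
      · rintro ⟨y, -, rfl⟩
        exact ⟨y ≫ prod.fst, by simp⟩
  obtain ⟨n, hn, he'⟩ : ∃ n : El (nm (natFib i X)) ⟶ Num E ⨯ X, n = e'.hom.left ∧
    n ≫ prod.fst ≫ i = elCode (nm (natFib i X)) := ⟨_, rfl, he'⟩
  refine (isNNO_over X).of_iso e e' ?_ ?_
  · refine Over.OverMorphism.ext (hi _ _ ((Over.w _).trans (Over.w _).symm) ?_)
    obtain ⟨t, -, h1, h2⟩ := (app_codedMap (Ψ := fun _ _ _ => True) _ _ _
      (fun _ z t _ => isElem_comp_natFib i z _ t) _ _ _).1 (app_elMap (zeroFib p i X))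
    have h3 : (elMap (zeroFib p i X) ≫ n) ≫ prod.fst ≫ i = t ≫ numZero E ≫ i := by
      rw [Category.assoc, he', h2]
    obtain ⟨o, ho⟩ : ∃ o : El (nm (oneFib p X)) ⟶ X, o = e.hom.left := ⟨_, rfl⟩
    have h4 : (o ≫ prod.lift (terminal.from X ≫ numZero E) (𝟙 X)) ≫ prod.fst ≫ i =
        t ≫ numZero E ≫ i := by
      simp [Subsingleton.elim t (terminal.from _)]
    subst hn ho
    exact h3.trans h4.symm
  · refine Over.OverMorphism.ext (hi _ _ ((Over.w _).trans (Over.w _).symm) ?_)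
    obtain ⟨t, -, h1, h2⟩ := (app_codedMap (Ψ := fun _ _ _ => True) _ _ _ _ _ _ _).1
      (app_elMap (succFib i X))
    have h3 : (elMap (succFib i X) ≫ n) ≫ prod.fst ≫ i = t ≫ numSucc E ≫ i := by
      rw [Category.assoc, he', h2]
    have h5 : n ≫ prod.fst = t := by
      rw [← cancel_mono i, h1, Category.assoc, he']
    have h4 : (n ≫ prod.lift (prod.fst ≫ numSucc E) prod.snd) ≫ prod.fst ≫ i =
        t ≫ numSucc E ≫ i := by
      rw [← h5]
      simp
    subst hn
    exact h3.trans h4.symm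

end Numbers

/-! ### Internal power objects -/

/-- A jointly monic pair is a mono into the product, and both monos and products are preserved. -/
theorem JointlyMonic.map {C D : Type*} [Category* C] [Category* D] (F : C ⥤ D)
    [HasFiniteLimits C] [HasFiniteLimits D] [PreservesFiniteLimits F] {R B A : C} {b : R ⟶ B}
    {a : R ⟶ A} (h : JointlyMonic b a) : JointlyMonic (F.map b) (F.map a) := by
  have : Mono (prod.lift b a) := ⟨fun u v e => h u v (by simpa using congrArg (· ≫ prod.fst) e)
    (by simpa using congrArg (· ≫ prod.snd) e)⟩
  intro Z u v h1 h2
  rw [← cancel_mono (F.map (prod.lift b a)), ← cancel_mono (prodComparison F B A)]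
  ext
  · simpa [← F.map_comp] using h1
  · simpa [← F.map_comp] using h2

theorem IsPowerObject.of_map {C D : Type*} [Category* C] [Category* D] (F : C ⥤ D) [F.Full]
    [F.Faithful] [HasFiniteLimits C] [HasFiniteLimits D] [PreservesFiniteLimits F] {A P M : C}
    {π : M ⟶ P} {ε : M ⟶ A} (h : IsPowerObject (F.map π) (F.map ε)) : IsPowerObject π ε := by
  refine ⟨fun Z s t h1 h2 => F.map_injective (h.1 _ _ ?_ ?_), fun B R b a hR => ?_⟩
  · rw [← F.map_comp, h1, F.map_comp]
  · rw [← F.map_comp, h2, F.map_comp]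
  obtain ⟨χ, ⟨t, h1, h2⟩, h3⟩ := h.2 (F.map b) (F.map a) (hR.map F)
  obtain ⟨χ, rfl⟩ := F.map_surjective χ
  obtain ⟨t, rfl⟩ := F.map_surjective t
  rw [← F.map_comp] at h2
  refine ⟨χ, ⟨t, h1.of_map F (F.map_injective (by simpa using h1.w)), F.map_injective h2⟩,
    fun χ' ⟨t', h4, h5⟩ => F.map_injective (h3 _ ⟨F.map t', h4.map F, ?_⟩)⟩
  rw [← F.map_comp, h5]

section Powers

variable {E : Type u} [Category.{v} E] [Topos E] {K L X Y Z : E} (j : L ⟶ K)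
  (A : (univCat K).Fib X)

/-- The generalised elements of the object of subsets of `L` contained in `A`. -/
def PowElem (Z : E) (z : Z ⟶ X) (S : Z ⟶ Pow L) : Prop :=
  ∀ (Z' : E) (w : Z' ⟶ Z) (l : Z' ⟶ L), IsElem l (w ≫ S) → IsElem (l ≫ j) ((w ≫ z) ≫ nm A)

/-- The generalised elements of the membership relation. -/
def EltElem (Z : E) (z : Z ⟶ X) (t : Z ⟶ Pow L ⨯ L) : Prop :=
  PowElem j A Z z (t ≫ prod.fst) ∧ IsElem (t ≫ prod.snd) (t ≫ prod.fst)

theorem rep_powElem :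
    Rep (fun Z (z : Z ⟶ X ⨯ Pow L) => PowElem j A Z (z ≫ prod.fst) (z ≫ prod.snd)) :=
  (rep_forall_imp (X := X ⨯ Pow L) (K := L) (Φ := fun Z z l => IsElem l (z ≫ prod.snd))
    (Ψ := fun Z z l => IsElem (l ≫ j) (z ≫ prod.fst ≫ nm A))
    ((rep_isElem prod.snd (prod.fst ≫ prod.snd)).congr (by simp))
    ((rep_isElem (prod.snd ≫ j) (prod.fst ≫ prod.fst ≫ nm A)).congr (by simp))).congr
    (by simp [PowElem])

theorem rep_eltElem :
    Rep (fun Z (z : Z ⟶ X ⨯ (Pow L ⨯ L)) => EltElem j A Z (z ≫ prod.fst) (z ≫ prod.snd)) :=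
  (((rep_powElem j A).comp (prod.lift prod.fst (prod.snd ≫ prod.fst))).and
    (rep_isElem (prod.snd ≫ prod.snd) (prod.snd ≫ prod.fst))).congr (by simp [EltElem])

variable {j A}

theorem EltElem.mem {z : Z ⟶ X} {t : Z ⟶ Pow L ⨯ L} (h : EltElem j A Z z t) :
    IsElem (t ≫ prod.snd ≫ j) (z ≫ nm A) := by
  have := h.1 Z (𝟙 Z) (t ≫ prod.snd) (by simpa using h.2)
  simpa using this

variable (j A) (c : Pow L ⟶ K) (d : Pow L ⨯ L ⟶ K) [Mono c] [Mono d]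

noncomputable def powFib : (univCat K).Fib X := coded (rep_powElem j A) c

noncomputable def eltFib : (univCat K).Fib X := coded (rep_eltElem j A) d

theorem isElem_powFib (z : Z ⟶ X) (k : Z ⟶ K) :
    IsElem k (z ≫ nm (powFib j A c)) ↔ ∃ S : Z ⟶ Pow L, PowElem j A Z z S ∧ S ≫ c = k :=
  isElem_coded _ _ _ _

theorem EltElem.mem_powFib {z : Z ⟶ X} {t : Z ⟶ Pow L ⨯ L} (h : EltElem j A Z z t) :
    IsElem (t ≫ prod.fst ≫ c) (z ≫ nm (powFib j A c)) :=
  (isElem_powFib j A c z _).2 ⟨_, h.1, Category.assoc _ _ _⟩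

noncomputable def eltPowFib : eltFib j A d ⟶ powFib j A c :=
  codedMap (rep_eltElem j A) d (prod.fst ≫ c) fun _ _ _ h => h.mem_powFib j A c

noncomputable def eltArgFib : eltFib j A d ⟶ A :=
  codedMap (rep_eltElem j A) d (prod.snd ≫ j) fun _ _ _ h => h.mem

theorem powElem_reindex (h : Y ⟶ X) (Z : E) (z : Z ⟶ Y) (S : Z ⟶ Pow L) :
    PowElem j A Z (z ≫ h) S ↔ PowElem j (((univCat K).reindex h).obj A) Z z S := by
  simp only [PowElem, nm_reindex, Category.assoc]

theorem eltElem_reindex (h : Y ⟶ X) (Z : E) (z : Z ⟶ Y) (t : Z ⟶ Pow L ⨯ L) :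
    EltElem j A Z (z ≫ h) t ↔ EltElem j (((univCat K).reindex h).obj A) Z z t :=
  and_congr_left' (powElem_reindex j A h Z z _)

theorem reindex_eltPowFib (h : Y ⟶ X) : (((univCat K).reindex h).map (eltPowFib j A c d)).1 =
    (eltPowFib j (((univCat K).reindex h).obj A) c d).1 :=
  reindex_codedMap _ _ _ h (eltElem_reindex j A h)
    (reindex_coded _ _ _ h (powElem_reindex j A h)) _ _ _

theorem reindex_eltArgFib (h : Y ⟶ X) : (((univCat K).reindex h).map (eltArgFib j A d)).1 =
    (eltArgFib j (((univCat K).reindex h).obj A) d).1 :=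
  reindex_codedMap _ _ _ h (eltElem_reindex j A h) rfl _ _ _

/-- The criterion `isPowerObject_over` applies with the elements of A decoded to L by k and those of
the power object decoded to `Pow L` by s. Under this decoding, being contained in a fibre of A is
exactly `PowElem`. -/
theorem isPowerObject_map_eltPowFib [Mono j] (hA : BoundedBy j (nm A)) : IsPowerObject
    ((inclFib K X).map (eltPowFib j A c d)) ((inclFib K X).map (eltArgFib j A d)) := by
  obtain ⟨k, hk⟩ := hA _ _ _ (isElem_elCode (nm A))
  obtain ⟨s, hs, hs'⟩ := (isElem_powFib j A c _ _).1 (isElem_elCode (nm (powFib j A c)))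
  obtain ⟨m, hm, hm'⟩ := (isElem_coded (rep_eltElem j A) d _ _).1
    (isElem_elCode (nm (eltFib j A d)))
  have hπ : elMap (eltPowFib j A c d) ≫ s = m ≫ prod.fst := by
    obtain ⟨t, -, h1, h2⟩ := (app_codedMap _ _ _ _ _ _ _).1 (app_elMap (eltPowFib j A c d))
    rw [← hm', cancel_mono] at h1
    rw [← cancel_mono c, Category.assoc, hs', Category.assoc, ← h1]
    exact h2.symm
  have hε : elMap (eltArgFib j A d) ≫ k = m ≫ prod.snd := by
    obtain ⟨t, -, h1, h2⟩ := (app_codedMap _ _ _ _ _ _ _).1 (app_elMap (eltArgFib j A d))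
    rw [← hm', cancel_mono] at h1
    rw [← cancel_mono j, Category.assoc, hk, Category.assoc, ← h1]
    exact h2.symm
  have hm'' : m ≫ d = elCode (nm (eltFib j A d)) := hm'
  have hkm : JointlyMonic (elProj (nm A)) k := fun Z u v h1 h2 =>
    jointlyMonic_el _ _ _ h1 (by rw [← hk, reassoc_of% h2])
  have hsm : JointlyMonic (elProj (nm (powFib j A c))) s := fun Z u v h1 h2 =>
    jointlyMonic_el _ _ _ h1 (by rw [← hs', reassoc_of% h2])
  have hsub (Z : E) (x : Z ⟶ X) (S : Z ⟶ Pow L) :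
      SubFibre (elProj (nm A)) k x S ↔ PowElem j A Z x S := by
    refine forall_congr' fun Z' => forall_congr' fun w => forall_congr' fun l =>
      imp_congr_right fun _ => (Iff.trans ?_ (isElem_iff_el (nm A) (w ≫ x) (l ≫ j)).symm)
    refine exists_congr fun y => and_congr_right fun _ => ?_
    rw [← hk, ← Category.assoc, cancel_mono]
  refine isPowerObject_over _ _ k s hkm hsm ((hsub _ _ _).2 hs) (fun Z x S hS => ?_) ?_ ?_
    fun Z t y e hy => ?_
  · obtain ⟨t, h1, h2⟩ := (isElem_iff_el (nm (powFib j A c)) x (S ≫ c)).1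
      ((isElem_powFib j A c x _).2 ⟨S, (hsub _ _ _).1 hS, rfl⟩)
    refine ⟨t, h1, ?_⟩
    rwa [← hs', ← Category.assoc, cancel_mono] at h2
  · change JointlyMonic (elMap (eltPowFib j A c d)) (elMap (eltArgFib j A d))
    intro Z u v h1 h2
    refine jointlyMonic_el (nm (eltFib j A d)) u v ?_ ?_
    · rw [← elMap_proj (eltPowFib j A c d), reassoc_of% h1]
    · rw [← hm'', ← Category.assoc, ← Category.assoc]
      congr 1
      ext
      · rw [Category.assoc, Category.assoc, ← hπ, reassoc_of% h1]
      · rw [Category.assoc, Category.assoc, ← hε, reassoc_of% h2]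
  · change IsElem (elMap (eltArgFib j A d) ≫ k) (elMap (eltPowFib j A c d) ≫ s)
    rw [hπ, hε]
    exact hm.2
  · change ∃ m : Z ⟶ El (nm (eltFib j A d)), m ≫ elMap (eltPowFib j A c d) = t ∧
      m ≫ elMap (eltArgFib j A d) = y
    have he : t ≫ elProj (nm (powFib j A c)) = y ≫ elProj (nm A) := e
    have ht : EltElem j A Z (t ≫ elProj (nm (powFib j A c))) (prod.lift (t ≫ s) (y ≫ k)) := by
      refine ⟨?_, by simpa using hy⟩
      rw [prod.lift_fst]
      exact (hsub _ _ _).1 (((hsub _ _ _).2 hs).comp t)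
    obtain ⟨n, h1, h2⟩ := (isElem_iff_el (nm (eltFib j A d)) _ _).1
      ((isElem_coded (rep_eltElem j A) d _ _).2 ⟨_, ht, rfl⟩)
    rw [← hm'', ← Category.assoc, cancel_mono] at h2
    refine ⟨n, hsm _ _ ?_ ?_, hkm _ _ ?_ ?_⟩
    · rw [Category.assoc, elMap_proj, h1]
      rfl
    · rw [Category.assoc, hπ, reassoc_of% h2, prod.lift_fst]
      rfl
    · rw [Category.assoc, elMap_proj, h1, he]
      rfl
    · rw [Category.assoc, hε, reassoc_of% h2, prod.lift_snd]
      rfl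

end Powers

/-! ### The internal full sub-`r`-topos of the subobjects of the `r`-th term of the chain -/

section SubTopos

variable {E : Type u} [Category.{v} E] [Topos E] (A : E)

/-- The inclusion of the natural numbers in the terms of the chain. -/
noncomputable def chainNat (r : ℕ) : Num E ⟶ (chain A r).obj :=
  (chain A 0).nat ≫ chainMap A (Nat.zero_le r)

instance (r : ℕ) : Mono (chainNat A r) := mono_comp _ _

theorem chainNat_chainMap {i r : ℕ} (h : i ≤ r) :
    chainNat A i ≫ chainMap A h = chainNat A r := by
  rw [chainNat, chainNat, Category.assoc, chainMap_comp]

/-- The inclusion of the power objects of the terms of the chain. -/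
noncomputable def chainPow {i r : ℕ} (h : i + 1 ≤ r) : Pow (chain A i).obj ⟶ (chain A r).obj :=
  powToChain A i ≫ chainMap A h

instance {i r : ℕ} (h : i + 1 ≤ r) : Mono (chainPow A h) := mono_comp _ _

/-- A pair (S, l) is coded in the r-th term itself: the membership relation need only be an object
of the whole category, with no rank prescribed. -/
noncomputable def chainElt {i r : ℕ} (h : i + 1 ≤ r) :
    Pow (chain A i).obj ⨯ (chain A i).obj ⟶ (chain A r).obj :=
  prod.map (chainPow A h) (chainMap A ((Nat.le_succ i).trans h)) ≫ (chain A r).pair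

instance {i r : ℕ} (h : i + 1 ≤ r) : Mono (chainElt A h) := mono_comp _ _

theorem mem_chainLevel {i r : ℕ} (h : i ≤ r) {X : E} (B : (univCat (chain A r).obj).Fib X) :
    Mem (chainLevel A h) B ↔ BoundedBy (chainMap A h) (nm B) := bounded_factors _ _

theorem isPowerObject_eltPowFib {i r : ℕ} (h : i + 1 ≤ r) {X : E}
    {B : (univCat (chain A r).obj).Fib X} (hB : Mem (chainLevel A ((Nat.le_succ i).trans h)) B) :
    IsPowerObject ((inclFib _ X).map (eltPowFib (chainMap A ((Nat.le_succ i).trans h)) B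
      (chainPow A h) (chainElt A h))) ((inclFib _ X).map (eltArgFib _ B (chainElt A h))) :=
  isPowerObject_map_eltPowFib _ _ _ _ ((mem_chainLevel A _ B).1 hB)

/-- The internal `r`-topos of the subobjects of the `r`-th term of the chain. -/
noncomputable def chainTopos (r : ℕ) : InternalRTopos E r where
  toInternalCategory := univCat (chain A r).obj
  rank i := chainLevel A i.2.le
  rank_mono _ j h := chainLevel_mono A h j.2.le
  -- The whole category is the case of the identity inclusion, for which every object is bounded.
  reg := regularOn (T := chain A r) (L := chain A r) (𝟙 _) ⊤ fun B =>
    iff_of_true (mem_top B) fun _ _ k _ => ⟨k, Category.comp_id k⟩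
  cover_stable h he := isCover_of_isPullback h he
  regRank i := regularOn (T := chain A r) (L := chain A i) (chainMap A i.2.le) _
    (mem_chainLevel A i.2.le)
  nat X := natFib (chainNat A r) X
  zero X := zeroFib _ _ X
  succ X := succFib _ X
  nat_isNNO _ := (isNNO_map_succFib _ _ _).of_map
  nat_mem _ i := (mem_chainLevel A _ _).2 (boundedBy_coded _ _ _ _ (chainNat_chainMap A i.2.le))
  zero_reindex h := reindex_zeroFib _ _ h
  succ_reindex h := reindex_succFib _ h
  pow i hi _ B _ := powFib (chainMap A ((Nat.le_succ i).trans hi.le)) B (chainPow A hi.le)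
  pow_mem _ _ _ _ _ := (mem_chainLevel A _ _).2 (boundedBy_coded _ _ _ _ rfl)
  elt i hi _ B _ := eltFib (chainMap A ((Nat.le_succ i).trans hi.le)) B (chainElt A hi.le)
  eltPow _ _ _ B _ := eltPowFib _ B _ _
  eltArg _ _ _ B _ := eltArgFib _ B _
  pow_isPowerObject _ hi X _ hB :=
    have := preservesFiniteLimits_inclFib (chain A r) X
    (isPowerObject_eltPowFib A hi.le hB).of_map
  eltPow_reindex _ _ _ _ h B _ := reindex_eltPowFib _ B _ _ h
  eltArg_reindex _ _ _ _ h B _ := reindex_eltArgFib _ B _ h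

/-- The internal full sub-`r`-topos of the subobjects of the `r`-th term of the chain. -/
noncomputable def chainSubTopos (r : ℕ) : FullSubRTopos E r where
  toInternalRTopos := chainTopos A r
  incl := inclIndexed (chain A r).obj
  full _ := full_inclFib
  faithful _ := faithful_inclFib
  preservesFiniteLimits X := preservesFiniteLimits_inclFib (chain A r) X
  preserves_cover e he := isCover_map_of_strongEpi e (strongEpi_elMap_of_isCover he)
  preserves_nno X := isNNO_map_succFib _ _ X
  preserves_pow _ hi _ _ hB := isPowerObject_eltPowFib A hi.le hB

theorem contains_chainSubTopos (r : ℕ) {A B : E} (q : A ⟶ B) : (chainSubTopos A r).Contains q := by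
  have hq {i : ℕ} : JointlyMonic q (toChain A ≫ chainMap A (Nat.zero_le i)) :=
    jointlyMonic_of_mono_right _ _
  -- The elements of the fibres of q are coded through the initial term of the chain, hence lie in
  -- every term; this gives membership in each rank.
  refine ⟨ofName (nameOf q _ hq), fun i => (mem_chainLevel A i.2.le _).2 fun Z z k hk => ?_,
    exists_iso_ofName_nameOf (Over.mk q) _ hq⟩
  obtain ⟨a, -, rfl⟩ := (isElem_nameOf hq z k).1 hk
  exact ⟨a ≫ toChain A ≫ chainMap A (Nat.zero_le i), by simp [chainMap_comp]⟩

end SubTopos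

end RankedTopos

theorem mainTheorem10 {E : Type u} [Category.{v} E] [RankedTopos.Topos E] (r : ℕ)
    {A B : E} (q : A ⟶ B) :
    (∃ 𝒰 : RankedTopos.RUniverse E r,
      RankedTopos.IsContained q 𝒰.q ∧
        ∀ i, RankedTopos.IsContained q (RankedTopos.restrict 𝒰.q (𝒰.level i))) ∧
    (∃ 𝒯 : RankedTopos.FullSubRTopos E r, 𝒯.Contains q) :=
  ⟨RankedTopos.exists_rUniverse r q, _, RankedTopos.contains_chainSubTopos r q⟩
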